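/- Let $n\ge 3$. On $\mathbb{R}^{2,n}$, with coordinates $y^{-1},y^0,y^1,\dots,y^n$ and metric $\eta=\mathrm{diag}(1,1,-1,\dots,-1)$, put $y^2=\eta_{ab}y^ay^b$, $y_a=\eta_{ab}y^b$, $\partial_a=\partial/\partial y^a$, and let $\mathcal G_n=\mathfrak{so}(2,n)$, with basis $(M_{ab})_{a<b}$, act on functions by $U(M_{ab})=L_{ab}=y_a\partial_b-y_b\partial_a$; let $U(\mathbf C_2)=-\tfrac12L_{ab}L^{ab}$ be the Casimir operator. Let $X$ be the universal covering of $\{y\in\mathbb{R}^{2,n}: y^2\ge 0,\ y\ne 0\}$ and let $C^\infty(X)$ be the space of complex functions on $X$ that are smooth up to the boundary $y^2=0$, with the topology of uniform convergence of all derivatives on compact subsets of $X$. Put $x_{\pm1}=\frac{i}{\sqrt2}(y^{-1}\pm iy^0)$, fix a branch of $\log x_1$ on $X$, and let $$\varphi_1=x_{-1}x_1^{-n/2},\qquad \varphi_2=x_1^{-(n-2)/2},\qquad \varphi_3=y^2\,x_1^{-(n+2)/2}$$ in $C^\infty(X)$. Let $\mathcal H_i$ be the closure in $C^\infty(X)$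 of $\mathcal U(\mathcal G_n^{\mathbb C})\varphi_i$, $i=1,2,3$. For $E\in\mathbb{R}$ let $D(E,0,\dots,0)$ be the irreducible highest weight representation of $\mathcal G_n$ with highest weight $(-E,0,\dots,0)$, i.e. the irreducible one generated by a vector $v\neq0$ with $-iM_{-1,0}v=-Ev$, $M_{jk}v=0$ and $(M_{-1,k}+iM_{0,k})v=0$ for $1\le j,k\le n$. A topological $\mathcal G_n$-module carries $D(E,0,\dots,0)$ if its $\mathfrak{so}(2)\oplus\mathfrak{so}(n)$-finite vectors are dense and form a $\mathcal G_n$-module isomorphic to $D(E,0,\dots,0)$. Then: 1. $\mathcal H_1\supsetneq\mathcal H_2\supsetneq\mathcal H_3$, and each $\mathcal H_i$ is a closed $\mathcal G_n$-invariant subspace. 2. $\mathcal H_1/\mathcal H_2$ and $\mathcal H_3$ carry $D(\frac{n+2}2,0,\dots,0)$, while $\mathcal H_2/\mathcal H_3$ carries $D(\frac{n-2}2,0,\dots,0)$ (the $C_n$-massless representation of spin $0$). 3. $\bigl[U(\mathbf C_2)+\frac{(n-2)(n+2)}4\bigr]\varphi_i=0$ for $i=2,3$; $\bigl[U(\mathbf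 C_2)+\frac{(n-2)(n+2)}4\bigr]\varphi_1=-n\varphi_3\ne0$; and $\bigl[U(\mathbf C_2)+\frac{(n-2)(n+2)}4\bigr]^2\varphi_1=0$. 4. For every $\varphi\in\mathcal H_3$ and every point $p$ of $X$ over the cone $Q^{2,n}=\{y^2=0\}$, $\varphi(q)\to0$ as $q\to p$ with $y^2(q)>0$. Moreover a function of $\mathcal H_2$ vanishes on the cone if and only if it belongs to $\mathcal H_3$, and the space of restrictions to the cone of the functions of $\mathcal H_2$, a $\mathcal G_n$-module of smooth functions on the covering of $Q^{2,n}\setminus\{0\}$, carries $D(\frac{n-2}2,0,\dots,0)$. -/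

import Mathlib

open scoped ContDiff Topology

noncomputable section

namespace GuptaBleuler

/-- Indices of the coordinates of `ℝ^{2,n}`: `inl 0, inl 1` are the indices `-1, 0` of the
positive directions and `inr j` (`j = 0, …, n-1`) is the index `j + 1`. -/
abbrev Idx (n : ℕ) : Type := Fin 2 ⊕ Fin n

/-- The diagonal entries of the metric `η` of signature `(2, n)`. -/
def eta {n : ℕ} : Idx n → ℝ := Sum.elim (fun _ => 1) (fun _ => -1)

/-- Ambient space for the coordinates `(z, 𝐲)` of the covering space below. -/
abbrev Amb (n : ℕ) : Type := ℂ × EuclideanSpace ℝ (Fin n)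

/-- The universal covering of `{y ∈ ℝ^{2,n} | y² ≥ 0, y ≠ 0}`.  The point `(z, 𝐲)` lies over the
point `y` with `y^{-1} + i y^0 = exp z` and with spatial part `𝐲`, so that `y² ≥ 0` means
`‖𝐲‖ ≤ |exp z|`. -/
def cov (n : ℕ) : Set (Amb n) := {p | ‖p.2‖ ≤ Real.exp p.1.re}

/-- The coordinate functions `y^a`, as functions on the covering. -/
def coord {n : ℕ} : Idx n → Amb n → ℝ
  | Sum.inl 0, p => (Complex.exp p.1).re
  | Sum.inl 1, p => (Complex.exp p.1).im
  | Sum.inr j, p => p.2 j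

/-- `y² = y^a y_a`. -/
def ysq {n : ℕ} (p : Amb n) : ℝ := ∑ a, eta a * coord a p ^ 2

/-- The vector field `∂/∂y^a`, lifted to the covering. -/
def frame {n : ℕ} : Idx n → Amb n → Amb n
  | Sum.inl 0, p => (Complex.exp (-p.1), 0)
  | Sum.inl 1, p => (Complex.I * Complex.exp (-p.1), 0)
  | Sum.inr j, _ => (0, EuclideanSpace.single j 1)

theorem ysq_eq {n : ℕ} (p : Amb n) : ysq p = Real.exp p.1.re ^ 2 - ‖p.2‖ ^ 2 := by
  have h : ‖Complex.exp p.1‖ ^ 2 = (Complex.exp p.1).re ^ 2 + (Complex.exp p.1).im ^ 2 := by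
    rw [← Complex.normSq_eq_norm_sq, Complex.normSq_apply]; ring
  rw [Complex.norm_exp] at h
  rw [EuclideanSpace.norm_sq_eq, h]
  simp [ysq, eta, coord, Fintype.sum_sum_type, sub_eq_add_neg]

theorem mem_cov_iff {n : ℕ} (p : Amb n) : p ∈ cov n ↔ 0 ≤ ysq p := by
  rw [ysq_eq, sub_nonneg, sq_le_sq₀ (norm_nonneg _) (Real.exp_pos _).le]; rfl

theorem coord_contDiff {n : ℕ} (a : Idx n) : ContDiff ℝ ∞ (coord a) := by
  have h : ContDiff ℝ ∞ (fun p : Amb n => Complex.exp p.1) :=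
    (Complex.contDiff_exp (𝕜 := ℝ)).comp contDiff_fst
  match a with
  | Sum.inl 0 => exact Complex.reCLM.contDiff.comp h
  | Sum.inl 1 => exact Complex.imCLM.contDiff.comp h
  | Sum.inr j => exact (EuclideanSpace.proj (𝕜 := ℝ) j).contDiff.comp contDiff_snd

theorem frame_contDiff {n : ℕ} (a : Idx n) : ContDiff ℝ ∞ (frame a) := by
  have h : ContDiff ℝ ∞ (fun p : Amb n => Complex.exp (-p.1)) :=
    (Complex.contDiff_exp (𝕜 := ℝ)).comp contDiff_fst.neg
  match a with
  | Sum.inl 0 => exact h.prodMk contDiff_const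
  | Sum.inl 1 => exact (contDiff_const.mul h).prodMk contDiff_const
  | Sum.inr j => exact contDiff_const

theorem cov_uniqueDiffOn (n : ℕ) : UniqueDiffOn ℝ (cov n) := by
  let S : Set (Amb n) := Set.univ ×ˢ Metric.closedBall 0 1
  let Φ : Amb n → Amb n := fun q => (q.1, Real.exp q.1.re • q.2)
  have hS : UniqueDiffOn ℝ S :=
    uniqueDiffOn_univ.prod (uniqueDiffOn_convex (convex_closedBall _ _)
      ⟨0, Metric.ball_subset_interior_closedBall (Metric.mem_ball_self one_pos)⟩)
  have him : Φ '' S = cov n := by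
    ext ⟨z, y⟩
    constructor
    · rintro ⟨⟨w, u⟩, ⟨-, hu⟩, h⟩
      have hu' : ‖u‖ ≤ 1 := by simpa using hu
      obtain ⟨rfl, rfl⟩ := Prod.mk.inj h
      change ‖Real.exp w.re • u‖ ≤ Real.exp w.re
      rw [norm_smul, Real.norm_of_nonneg (Real.exp_pos _).le]
      nlinarith [Real.exp_pos w.re]
    · intro h
      have h' : ‖y‖ ≤ Real.exp z.re := h
      refine ⟨(z, (Real.exp z.re)⁻¹ • y), ⟨trivial, ?_⟩, ?_⟩
      · simp only [mem_closedBall_zero_iff, norm_smul, norm_inv,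
          Real.norm_of_nonneg (Real.exp_pos z.re).le]
        rw [inv_mul_le_iff₀ (Real.exp_pos _)]
        simpa using h'
      · simp [Φ, smul_smul, (Real.exp_pos z.re).ne']
  have hΦ : ∀ q : Amb n, HasFDerivAt Φ ((ContinuousLinearMap.fst ℝ _ _).prod
      (Real.exp q.1.re • ContinuousLinearMap.snd ℝ ℂ (EuclideanSpace ℝ (Fin n)) +
        (Real.exp q.1.re • (Complex.reCLM.comp (ContinuousLinearMap.fst ℝ _ _))).smulRight q.2)) q := by
    intro q
    have h1 : HasFDerivAt (fun q : Amb n => q.1.re)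
        (Complex.reCLM.comp (ContinuousLinearMap.fst ℝ _ _)) q :=
      Complex.reCLM.hasFDerivAt.comp q hasFDerivAt_fst
    exact hasFDerivAt_fst.prodMk (h1.exp.smul hasFDerivAt_snd)
  rw [← him]
  refine hS.image (fun q _ => (hΦ q).hasFDerivWithinAt) fun q _ => ?_
  refine Function.Surjective.denseRange ?_
  rintro ⟨ζ, w⟩
  refine ⟨(ζ, (Real.exp q.1.re)⁻¹ • w - ζ.re • q.2), ?_⟩
  simp [smul_sub, smul_smul, (Real.exp_pos q.1.re).ne']

instance (n : ℕ) : LocallyCompactSpace (cov n) :=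
  (isClosed_le (by fun_prop) (Real.continuous_exp.comp
    (Complex.continuous_re.comp continuous_fst)) : IsClosed (cov n)).locallyCompactSpace

theorem cov_subset_closure (n : ℕ) : cov n ⊆ closure (interior (cov n)) := by
  intro p hp
  have hc : Continuous fun s : ℝ => ((p.1 + s, p.2) : Amb n) := by fun_prop
  have ht : Filter.Tendsto (fun s : ℝ => ((p.1 + s, p.2) : Amb n)) (𝓝[>] 0) (𝓝 p) := by
    have := (hc.tendsto 0).mono_left (nhdsWithin_le_nhds (s := Set.Ioi 0))
    simpa using this
  refine mem_closure_of_tendsto ht (Filter.eventually_of_mem self_mem_nhdsWithin fun s hs => ?_)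
  have ho : IsOpen {q : Amb n | ‖q.2‖ < Real.exp q.1.re} :=
    isOpen_lt (by fun_prop) (Real.continuous_exp.comp (Complex.continuous_re.comp continuous_fst))
  refine interior_maximal (s := cov n) (t := {q : Amb n | ‖q.2‖ < Real.exp q.1.re})
    (fun q hq => (show ‖q.2‖ < Real.exp q.1.re from hq).le) ho ?_
  have hp' : ‖p.2‖ ≤ Real.exp p.1.re := hp
  refine lt_of_le_of_lt hp' ?_
  simpa using hs

/-- The derivative of `y^b` along `∂/∂y^a`. -/
theorem fderiv_coord {n : ℕ} (a b : Idx n) (p : Amb n) :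
    fderiv ℝ (coord b) p (frame a p) = if a = b then 1 else 0 := by
  have h : HasFDerivAt (fun p : Amb n => Complex.exp p.1)
      ((Complex.exp p.1 • (1 : ℂ →L[ℝ] ℂ)).comp (ContinuousLinearMap.fst ℝ _ _)) p :=
    (Complex.hasStrictFDerivAt_exp_real p.1).hasFDerivAt.comp p hasFDerivAt_fst
  have e : Complex.exp p.1 * Complex.exp (-p.1) = 1 := by rw [← Complex.exp_add]; simp
  have e' : Complex.exp p.1 * (Complex.I * Complex.exp (-p.1)) = Complex.I := by
    rw [mul_left_comm, e, mul_one]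
  match b with
  | Sum.inl 0 =>
    have h2 : HasFDerivAt (coord (Sum.inl 0)) _ p := Complex.reCLM.hasFDerivAt.comp p h
    rw [h2.fderiv]
    match a with
    | Sum.inl 0 => simp [frame, e, -Complex.mul_re]
    | Sum.inl 1 => simp [frame, e', -Complex.mul_re]
    | Sum.inr k => simp [frame]
  | Sum.inl 1 =>
    have h2 : HasFDerivAt (coord (Sum.inl 1)) _ p := Complex.imCLM.hasFDerivAt.comp p h
    rw [h2.fderiv]
    match a with
    | Sum.inl 0 => simp [frame, e, -Complex.mul_im]
    | Sum.inl 1 => simp [frame, e', -Complex.mul_im]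
    | Sum.inr k => simp [frame]
  | Sum.inr j =>
    have h2 : HasFDerivAt (coord (Sum.inr j)) ((EuclideanSpace.proj (𝕜 := ℝ) j).comp
        (ContinuousLinearMap.snd ℝ ℂ (EuclideanSpace ℝ (Fin n)))) p :=
      (EuclideanSpace.proj (𝕜 := ℝ) j).hasFDerivAt.comp p hasFDerivAt_snd
    rw [h2.fderiv]
    match a with
    | Sum.inl 0 => simp [frame]
    | Sum.inl 1 => simp [frame]
    | Sum.inr k => simp [frame, PiLp.single_apply, eq_comm]

/-- The fields `∂/∂y^a` commute. -/
theorem fderiv_frame {n : ℕ} (a b : Idx n) (p : Amb n) :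
    fderiv ℝ (frame b) p (frame a p) = fderiv ℝ (frame a) p (frame b p) := by
  have h : HasFDerivAt (fun p : Amb n => Complex.exp (-p.1))
      ((Complex.exp (-p.1) • (1 : ℂ →L[ℝ] ℂ)).comp (-ContinuousLinearMap.fst ℝ _ _)) p :=
    (Complex.hasStrictFDerivAt_exp_real (-p.1)).hasFDerivAt.comp p hasFDerivAt_fst.neg
  have key : ∀ (c : Idx n) (v : Amb n), fderiv ℝ (frame c) p v = (-(v.1 * (frame c p).1), 0) := by
    intro c v
    match c with
    | Sum.inl 0 =>
      have h2 : HasFDerivAt (frame (n := n) (Sum.inl 0)) _ p :=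
        h.prodMk (hasFDerivAt_const (0 : EuclideanSpace ℝ (Fin n)) p)
      rw [h2.fderiv]
      simp [frame, mul_comm]
    | Sum.inl 1 =>
      have h2 : HasFDerivAt (frame (n := n) (Sum.inl 1)) _ p :=
        (h.const_mul Complex.I).prodMk (hasFDerivAt_const (0 : EuclideanSpace ℝ (Fin n)) p)
      rw [h2.fderiv]
      simp [frame, mul_comm, mul_left_comm]
    | Sum.inr j =>
      have h2 : HasFDerivAt (frame (n := n) (Sum.inr j)) (0 : Amb n →L[ℝ] Amb n) p :=
        hasFDerivAt_const _ _
      rw [h2.fderiv]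
      simp [frame, Prod.ext_iff]
  rw [key, key, mul_comm]

/-- Smooth functions on the covering, up to and including its boundary `y² = 0`. -/
def smoothSubmodule (n : ℕ) : Submodule ℂ (cov n → ℂ) where
  carrier := {f | ∃ F : Amb n → ℂ, ContDiffOn ℝ ∞ F (cov n) ∧ ∀ p : cov n, F p = f p}
  add_mem' := by
    rintro f g ⟨F, hF, hf⟩ ⟨G, hG, hg⟩
    exact ⟨F + G, hF.add hG, fun p => by simp [hf, hg]⟩
  zero_mem' := ⟨0, contDiffOn_const, fun _ => rfl⟩
  smul_mem' := by
    rintro c f ⟨F, hF, hf⟩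
    exact ⟨fun p => c * F p, contDiffOn_const.mul hF, fun p => by simp [hf]⟩

/-- The space `C^∞` of smooth functions on the covering.  It is kept apart from the subtype so that
it does not inherit the topology of pointwise convergence. -/
def Smooth (n : ℕ) : Type := smoothSubmodule n

instance (n : ℕ) : AddCommGroup (Smooth n) := inferInstanceAs (AddCommGroup (smoothSubmodule n))
instance (n : ℕ) : Module ℂ (Smooth n) := inferInstanceAs (Module ℂ (smoothSubmodule n))
instance (n : ℕ) : CoeFun (Smooth n) (fun _ => cov n → ℂ) := ⟨fun f => f.1⟩

/-- Extension of a function on the covering by zero to the ambient space. -/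
def ext {n : ℕ} (f : cov n → ℂ) : Amb n → ℂ := Function.extend Subtype.val f 0

theorem ext_apply {n : ℕ} (f : cov n → ℂ) (p : cov n) : ext f p = f p :=
  Subtype.val_injective.extend_apply f 0 p

theorem Smooth.ext_contDiffOn {n : ℕ} (f : Smooth n) : ContDiffOn ℝ ∞ (ext f) (cov n) := by
  obtain ⟨F, hF, h⟩ := f.2
  exact hF.congr fun p hp => by rw [h ⟨p, hp⟩]; exact ext_apply f.1 ⟨p, hp⟩

theorem Smooth.hext {n : ℕ} {f g : Smooth n} (h : ∀ p, f p = g p) : f = g :=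
  Subtype.ext (funext h)

@[simp] theorem Smooth.add_apply {n : ℕ} (f g : Smooth n) (p : cov n) : (f + g) p = f p + g p := rfl
@[simp] theorem Smooth.smul_apply {n : ℕ} (c : ℂ) (f : Smooth n) (p : cov n) :
    (c • f) p = c * f p := rfl
@[simp] theorem Smooth.zero_apply {n : ℕ} (p : cov n) : (0 : Smooth n) p = 0 := rfl
@[simp] theorem Smooth.neg_apply {n : ℕ} (f : Smooth n) (p : cov n) : (-f) p = - f p := rfl

/-- A smooth function on the ambient space, restricted to the covering. -/
def Smooth.of {n : ℕ} (F : Amb n → ℂ) (hF : ContDiffOn ℝ ∞ F (cov n)) : Smooth n :=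
  ⟨fun p => F p, F, hF, fun _ => rfl⟩

theorem Smooth.of_ext {n : ℕ} (f : Smooth n) : Smooth.of (ext f) f.ext_contDiffOn = f :=
  Smooth.hext fun p => ext_apply f.1 p

theorem Smooth.differentiableWithinAt {n : ℕ} (f : Smooth n) (p : cov n) :
    DifferentiableWithinAt ℝ (ext f) (cov n) p :=
  f.ext_contDiffOn.differentiableOn (by simp) p p.2

theorem ext_of {n : ℕ} {F : Amb n → ℂ} (hF : ContDiffOn ℝ ∞ F (cov n)) :
    Set.EqOn (ext (Smooth.of F hF)) F (cov n) := fun p hp => ext_apply (fun q : cov n => F q) ⟨p, hp⟩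

theorem fderivWithin_frame_contDiffOn {n : ℕ} (a : Idx n) {F : Amb n → ℂ}
    (hF : ContDiffOn ℝ ∞ F (cov n)) :
    ContDiffOn ℝ ∞ (fun p => fderivWithin ℝ F (cov n) p (frame a p)) (cov n) :=
  (hF.fderivWithin (cov_uniqueDiffOn n) (by simp)).clm_apply (frame_contDiff a).contDiffOn

/-- The operator `∂_a = ∂/∂y^a` on smooth functions. -/
def pd {n : ℕ} (a : Idx n) : Smooth n →ₗ[ℂ] Smooth n where
  toFun f := Smooth.of (fun p => fderivWithin ℝ (ext f) (cov n) p (frame a p))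
    (fderivWithin_frame_contDiffOn a f.ext_contDiffOn)
  map_add' f g := Smooth.hext fun p => by
    have h : Set.EqOn (ext (f + g)) (ext f + ext g) (cov n) := fun q hq => by
      have := ext_apply (f + g).1 ⟨q, hq⟩
      have h1 := ext_apply f.1 ⟨q, hq⟩
      have h2 := ext_apply g.1 ⟨q, hq⟩
      simp only [Pi.add_apply] at *
      rw [this, h1, h2]; rfl
    change fderivWithin ℝ (ext (f + g)) (cov n) p (frame a p) =
      fderivWithin ℝ (ext f) (cov n) p (frame a p) + fderivWithin ℝ (ext g) (cov n) p (frame a p)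
    rw [fderivWithin_congr h (h p.2), fderivWithin_add (cov_uniqueDiffOn n p p.2)
      (f.differentiableWithinAt p) (g.differentiableWithinAt p)]
    rfl
  map_smul' c f := Smooth.hext fun p => by
    have h : Set.EqOn (ext (c • f)) (c • ext f) (cov n) := fun q hq => by
      have := ext_apply (c • f).1 ⟨q, hq⟩
      have h1 := ext_apply f.1 ⟨q, hq⟩
      simp only [Pi.smul_apply] at *
      rw [this, h1]; rfl
    change fderivWithin ℝ (ext (c • f)) (cov n) p (frame a p) =
      c * fderivWithin ℝ (ext f) (cov n) p (frame a p)
    rw [fderivWithin_congr h (h p.2), fderivWithin_const_smul (cov_uniqueDiffOn n p p.2)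
      (f.differentiableWithinAt p)]
    rfl

/-- Multiplication by the coordinate `y^b`. -/
def mulCoord {n : ℕ} (b : Idx n) : Smooth n →ₗ[ℂ] Smooth n where
  toFun f := Smooth.of (fun p => (coord b p : ℂ) * ext f p)
    ((Complex.ofRealCLM.contDiff.comp (coord_contDiff b)).contDiffOn.mul f.ext_contDiffOn)
  map_add' f g := Smooth.hext fun p => by
    change (coord b p : ℂ) * ext (f + g) p = (coord b p : ℂ) * ext f p + (coord b p : ℂ) * ext g p
    rw [ext_apply, ext_apply, ext_apply, ← mul_add]; rfl
  map_smul' c f := Smooth.hext fun p => by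
    change (coord b p : ℂ) * ext (c • f) p = c * ((coord b p : ℂ) * ext f p)
    rw [ext_apply, ext_apply, mul_left_comm]; rfl

theorem mulCoord_apply {n : ℕ} (b : Idx n) (f : Smooth n) (p : cov n) :
    mulCoord b f p = (coord b p : ℂ) * f p := by
  change (coord b p : ℂ) * ext f p = _
  rw [ext_apply]

theorem pd_apply {n : ℕ} (a : Idx n) (f : Smooth n) (p : cov n) :
    pd a f p = fderivWithin ℝ (ext f) (cov n) p (frame a p) := rfl

theorem pd_of {n : ℕ} (a : Idx n) {F : Amb n → ℂ} (hF : ContDiffOn ℝ ∞ F (cov n)) (p : cov n) :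
    pd a (Smooth.of F hF) p = fderivWithin ℝ F (cov n) p (frame a p) := by
  rw [pd_apply, fderivWithin_congr (ext_of hF) (ext_of hF p.2)]

theorem mulCoord_comm {n : ℕ} (a b : Idx n) (f : Smooth n) :
    mulCoord a (mulCoord b f) = mulCoord b (mulCoord a f) :=
  Smooth.hext fun p => by simp only [mulCoord_apply]; ring

theorem pd_mulCoord {n : ℕ} (a b : Idx n) (f : Smooth n) :
    pd a (mulCoord b f) = (if a = b then f else 0) + mulCoord b (pd a f) :=
  Smooth.hext fun p => by
    have hu := cov_uniqueDiffOn n p p.2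
    have hc : HasFDerivWithinAt (fun q : Amb n => (coord b q : ℂ))
        (Complex.ofRealCLM.comp (fderiv ℝ (coord b) p)) (cov n) p :=
      (Complex.ofRealCLM.hasFDerivAt.comp (p : Amb n)
        ((coord_contDiff b).differentiable (by simp) p).hasFDerivAt).hasFDerivWithinAt
    have h := (hc.mul (f.differentiableWithinAt p).hasFDerivWithinAt).fderivWithin hu
    have h2 : pd a (mulCoord b f) p = fderivWithin ℝ
        ((fun q : Amb n => (coord b q : ℂ)) * ext f) (cov n) p (frame a p) := pd_of a _ p
    rw [h2, h, Smooth.add_apply, mulCoord_apply, pd_apply]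
    simp [fderiv_coord, ext_apply]
    split_ifs <;> simp [add_comm]

theorem pd_comm {n : ℕ} (a b : Idx n) (f : Smooth n) : pd a (pd b f) = pd b (pd a f) :=
  Smooth.hext fun p => by
    have hu := cov_uniqueDiffOn n p p.2
    have key : ∀ a b : Idx n, pd a (pd b f) p =
        fderivWithin ℝ (fderivWithin ℝ (ext f) (cov n)) (cov n) p (frame a p) (frame b p) +
        fderivWithin ℝ (ext f) (cov n) p (fderiv ℝ (frame b) p (frame a p)) := by
      intro a b
      have h1 : DifferentiableWithinAt ℝ (fderivWithin ℝ (ext f) (cov n)) (cov n) p :=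
        (f.ext_contDiffOn.fderivWithin (m := ∞) (cov_uniqueDiffOn n) (by simp)).differentiableOn
          (by simp) p p.2
      have h2 : HasFDerivWithinAt (frame b) (fderiv ℝ (frame b) p) (cov n) p :=
        ((frame_contDiff b).differentiable (by simp) p).hasFDerivAt.hasFDerivWithinAt
      have h := (h1.hasFDerivWithinAt.clm_apply h2).fderivWithin hu
      have h3 : pd a (pd b f) p = fderivWithin ℝ (fun q =>
        fderivWithin ℝ (ext f) (cov n) q (frame b q)) (cov n) p (frame a p) := pd_of a _ p
      rw [h3, h]
      simp [add_comm]
    have hs : IsSymmSndFDerivWithinAt ℝ (ext f) (cov n) p :=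
      (f.ext_contDiffOn p p.2).isSymmSndFDerivWithinAt (by simp; exact WithTop.coe_le_coe.2 le_top) (cov_uniqueDiffOn n)
        (cov_subset_closure n p.2) p.2
    rw [key a b, key b a, fderiv_frame a b, hs]

/-- The complexification of the Lie algebra `so(2,n)`. -/
abbrev 𝔤 (n : ℕ) : Type := LieAlgebra.Orthogonal.so' (Fin 2) (Fin n) ℂ

theorem bracket_aux {ι R : Type*} [Fintype ι] [DecidableEq ι] [Ring R] [Algebra ℂ R]
    (E : ι → ι → R) (hE : ∀ a b c d, E a b * E c d - E c d * E a b =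
      (if a = d then E c b else 0) - (if c = b then E a d else 0)) (A B : Matrix ι ι ℂ) :
    (∑ a, ∑ b, A a b • E a b) * (∑ a, ∑ b, B a b • E a b) -
      (∑ a, ∑ b, B a b • E a b) * (∑ a, ∑ b, A a b • E a b) =
    -∑ a, ∑ b, (A * B - B * A) a b • E a b := by
  have h1 : ∀ A B : Matrix ι ι ℂ, (∑ a, ∑ b, A a b • E a b) * (∑ a, ∑ b, B a b • E a b) =
      ∑ x : (ι × ι) × (ι × ι), (A x.1.1 x.1.2 * B x.2.1 x.2.2) • (E x.1.1 x.1.2 * E x.2.1 x.2.2) := by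
    intro A B
    simp only [← Fintype.sum_prod_type', Finset.sum_mul_sum, smul_mul_smul_comm]
  have h2 : (∑ a, ∑ b, B a b • E a b) * (∑ a, ∑ b, A a b • E a b) =
      ∑ x : (ι × ι) × (ι × ι), (A x.1.1 x.1.2 * B x.2.1 x.2.2) • (E x.2.1 x.2.2 * E x.1.1 x.1.2) := by
    rw [h1, ← (Equiv.prodComm (ι × ι) (ι × ι)).sum_comp]
    simp [mul_comm]
  rw [h1, h2, ← Finset.sum_sub_distrib]
  simp only [← smul_sub, hE]
  simp only [smul_sub, Finset.sum_sub_distrib, Matrix.sub_apply, sub_smul, neg_sub]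
  congr 1
  · simp only [Fintype.sum_prod_type, smul_ite, smul_zero, Finset.sum_ite_eq, Finset.mem_univ,
      if_true, Matrix.mul_apply, Finset.sum_smul]
    rw [Finset.sum_comm]
    calc _ = ∑ y, ∑ c, ∑ a, (A a y * B c a) • E c y :=
          Finset.sum_congr rfl fun y _ => Finset.sum_comm
      _ = _ := by
          rw [Finset.sum_comm]
          exact Finset.sum_congr rfl fun _ _ => Finset.sum_congr rfl fun _ _ =>
            Finset.sum_congr rfl fun _ _ => by rw [mul_comm]
  · simp only [Fintype.sum_prod_type, smul_ite, smul_zero, Matrix.mul_apply, Finset.sum_smul]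
    refine Finset.sum_congr rfl fun a _ => ?_
    calc _ = ∑ b, ∑ d, (A a b * B b d) • E a d := by
          refine Finset.sum_congr rfl fun b _ => ?_
          rw [Finset.sum_comm]
          exact Finset.sum_congr rfl fun d _ => by simp
      _ = _ := Finset.sum_comm

theorem field_comm {n : ℕ} (a b c d : Idx n) :
    (mulCoord b * pd a) * (mulCoord d * pd c) - (mulCoord d * pd c) * (mulCoord b * pd a) =
      (if a = d then mulCoord b * pd c else 0) -
        (if c = b then mulCoord d * pd a else (0 : Module.End ℂ (Smooth n))) := by
  refine LinearMap.ext fun f => ?_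
  simp only [Module.End.mul_apply, pd_mulCoord, map_add, LinearMap.sub_apply]
  rw [pd_comm a c, mulCoord_comm b d]
  split_ifs <;> simp

section Action

attribute [local instance 100] LieRing.ofAssociativeRing

/-- The linear vector field `-∑ A_{ab} y^b ∂_a` attached to a matrix `A`. -/
def vectorField (n : ℕ) : Matrix (Idx n) (Idx n) ℂ →ₗ⁅ℂ⁆ Module.End ℂ (Smooth n) where
  toFun A := -∑ a, ∑ b, A a b • (mulCoord b * pd a)
  map_add' A B := by
    simp only [Matrix.add_apply, add_smul, Finset.sum_add_distrib, neg_add]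
  map_smul' c A := by
    simp only [Matrix.smul_apply, smul_eq_mul, mul_smul, Finset.smul_sum, smul_neg, RingHom.id_apply]
  map_lie' {A B} := by
    rw [LieRing.of_associative_ring_bracket, LieRing.of_associative_ring_bracket, neg_mul_neg,
      neg_mul_neg]
    exact (bracket_aux (fun a b => mulCoord b * pd a) (fun a b c d => field_comm a b c d) A B).symm

instance (n : ℕ) : LieRingModule (𝔤 n) (Smooth n) :=
  LieRingModule.compLieHom (Smooth n)
    ((vectorField n).comp (LieAlgebra.Orthogonal.so' (Fin 2) (Fin n) ℂ).incl)

instance (n : ℕ) : LieModule ℂ (𝔤 n) (Smooth n) :=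
  LieModule.compLieHom (Smooth n)
    ((vectorField n).comp (LieAlgebra.Orthogonal.so' (Fin 2) (Fin n) ℂ).incl)

end Action

theorem lie_def {n : ℕ} (A : 𝔤 n) (f : Smooth n) :
    ⁅A, f⁆ = -∑ a, ∑ b, A.1 a b • mulCoord b (pd a f) := by
  change (-∑ a, ∑ b, A.1 a b • (mulCoord b * pd a) : Module.End ℂ (Smooth n)) f = _
  simp [LinearMap.sum_apply]

theorem mem_so' {n : ℕ} (A : Matrix (Idx n) (Idx n) ℂ) :
    A ∈ LieAlgebra.Orthogonal.so' (Fin 2) (Fin n) ℂ ↔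
      ∀ a b, (eta b : ℂ) * A b a = -(eta a * A a b) := by
  have hd : LieAlgebra.Orthogonal.indefiniteDiagonal (Fin 2) (Fin n) ℂ =
      Matrix.diagonal fun a => (eta a : ℂ) := by
    unfold LieAlgebra.Orthogonal.indefiniteDiagonal
    congr 1
    funext a
    rcases a with i | j <;> simp [eta]
  rw [LieAlgebra.Orthogonal.so', mem_skewAdjointMatricesLieSubalgebra,
    mem_skewAdjointMatricesSubmodule, hd, Matrix.IsSkewAdjoint, Matrix.IsAdjointPair,
    ← Matrix.ext_iff]
  refine forall_congr' fun a => forall_congr' fun b => ?_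
  rw [Matrix.mul_diagonal, Matrix.diagonal_mul, Matrix.transpose_apply, Matrix.neg_apply, mul_neg,
    mul_comm]

/-- The basis element `M_{ab}` of `so(2,n)`: it acts on functions as `y_a ∂_b - y_b ∂_a`. -/
def M {n : ℕ} (a b : Idx n) : 𝔤 n :=
  ⟨Matrix.single a b (eta b : ℂ) - Matrix.single b a (eta a : ℂ), by
    rw [mem_so']
    intro c d
    simp only [Matrix.sub_apply, Matrix.single_apply]
    by_cases h1 : a = c <;> by_cases h2 : b = d <;> by_cases h3 : a = d <;> by_cases h4 : b = c <;>
      simp_all [mul_comm]⟩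

theorem lie_M {n : ℕ} (a b : Idx n) (f : Smooth n) :
    ⁅M a b, f⁆ = (eta a : ℂ) • mulCoord a (pd b f) - (eta b : ℂ) • mulCoord b (pd a f) := by
  have h : ∀ (c d : Idx n) (t : ℂ),
      ∑ x, ∑ y, Matrix.single c d t x y • mulCoord y (pd x f) = t • mulCoord d (pd c f) := by
    intro c d t
    rw [Finset.sum_eq_single c, Finset.sum_eq_single d]
    · simp
    · intro y _ hy
      simp [hy.symm]
    · simp
    · intro x _ hx
      exact Finset.sum_eq_zero fun y _ => by simp [hx.symm]
    · simp
  rw [lie_def]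
  simp only [M, Matrix.sub_apply, sub_smul, Finset.sum_sub_distrib, h, neg_sub]

/-- Iterated derivatives. -/
def derivs {n : ℕ} : List (Idx n) → Smooth n →ₗ[ℂ] Smooth n
  | [] => LinearMap.id
  | a :: l => derivs l ∘ₗ pd a

/-- A smooth function, as a continuous function. -/
def toC (n : ℕ) : Smooth n →ₗ[ℂ] C(cov n, ℂ) where
  toFun f := ⟨f, by
    have h := f.ext_contDiffOn.continuousOn.domRestrict
    exact h.congr fun p => ext_apply f.1 p⟩
  map_add' _ _ := rfl
  map_smul' _ _ := rfl

/-- All derivatives of a smooth function. -/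
def jets (n : ℕ) : Smooth n →ₗ[ℂ] (List (Idx n) → C(cov n, ℂ)) :=
  LinearMap.pi fun l => toC n ∘ₗ derivs l

/-- The `C^∞` topology: uniform convergence of all derivatives on the compact subsets of the
covering. -/
instance (n : ℕ) : TopologicalSpace (Smooth n) := .induced (jets n) inferInstance

instance (n : ℕ) : IsTopologicalAddGroup (Smooth n) := topologicalAddGroup_induced (jets n)

instance (n : ℕ) : ContinuousSMul ℂ (Smooth n) := continuousSMul_induced (jets n)

theorem continuous_pd {n : ℕ} (a : Idx n) : Continuous (pd (n := n) a) :=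
  continuous_induced_rng.2 <| continuous_pi fun l =>
    (continuous_apply (a :: l)).comp (continuous_induced_dom (f := jets n))

theorem continuous_mulCoord {n : ℕ} (b : Idx n) : Continuous (mulCoord (n := n) b) := by
  refine continuous_induced_rng.2 (continuous_pi fun l => ?_)
  change Continuous fun f => toC n (derivs l (mulCoord b f))
  have hj : ∀ l : List (Idx n), Continuous fun f => toC n (derivs l f) := fun l =>
    (continuous_apply l).comp (continuous_induced_dom (f := jets n))
  induction l with
  | nil =>
    let c : C(cov n, ℂ) := ⟨fun p => (coord b p : ℂ),
      Complex.continuous_ofReal.comp ((coord_contDiff b).continuous.comp continuous_subtype_val)⟩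
    have h : ∀ f, toC n (derivs [] (mulCoord b f)) = c * toC n (derivs [] f) := fun f =>
      ContinuousMap.ext fun p => mulCoord_apply b f p
    simp only [h]
    exact continuous_const.mul (hj [])
  | cons a l ih =>
    have h : ∀ f, toC n (derivs (a :: l) (mulCoord b f)) =
        toC n (derivs l (if a = b then f else 0)) + toC n (derivs l (mulCoord b (pd a f))) := by
      intro f
      change toC n (derivs l (pd a (mulCoord b f))) = _
      rw [pd_mulCoord, map_add, map_add]
    simp only [h]
    refine Continuous.add ?_ (ih.comp (continuous_pd a))
    split_ifs
    · exact hj l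
    · exact continuous_const

theorem continuous_lie {n : ℕ} (A : 𝔤 n) : Continuous fun f : Smooth n => ⁅A, f⁆ := by
  simp only [lie_def]
  exact (continuous_finsetSum _ fun a _ => continuous_finsetSum _ fun b _ =>
    ((continuous_mulCoord b).comp (continuous_pd a)).const_smul (A.1 a b)).neg

/-- The closure of a submodule, which is again a submodule. -/
def lieClosure {n : ℕ} (N : LieSubmodule ℂ (𝔤 n) (Smooth n)) : LieSubmodule ℂ (𝔤 n) (Smooth n) where
  __ := N.toSubmodule.topologicalClosure
  lie_mem {A _} hf := map_mem_closure (continuous_lie A) hf fun _ hg => N.lie_mem hg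

/-- `cl(U(𝔤) φ)`: the closure of the module generated by `φ`. -/
def closedSpan {n : ℕ} (φ : Smooth n) : LieSubmodule ℂ (𝔤 n) (Smooth n) :=
  lieClosure (LieSubmodule.lieSpan ℂ (𝔤 n) {φ})

/-- The derivative of a function that vanishes on the cone `y² = 0`, in a direction tangent to the
cone, is zero. -/
theorem tangent_deriv_eq_zero {n : ℕ} {f : Smooth n} (hf : ∀ p : cov n, ysq p.1 = 0 → f p = 0)
    (p : cov n) (hp : ysq p.1 = 0) (W : Amb n)
    (hW : Real.exp p.1.1.re ^ 2 * W.1.re = inner ℝ p.1.2 W.2) :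
    fderivWithin ℝ (ext f) (cov n) p W = 0 := by
  obtain ⟨⟨z, y⟩, hpc⟩ := p
  obtain ⟨ζ, w⟩ := W
  simp only at hW hp ⊢
  have hexp := Real.exp_pos z.re
  have hy2 : ‖y‖ ^ 2 = Real.exp z.re ^ 2 := by
    have := ysq_eq (n := n) (z, y)
    simp only at this
    linarith
  have hy : ‖y‖ = Real.exp z.re := by
    rwa [sq_eq_sq₀ (norm_nonneg _) hexp.le] at hy2
  let S : Set ℝ := {s | y + s • w ≠ 0}
  have hSo : IsOpen S := isOpen_ne_fun (by fun_prop) continuous_const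
  have hS0 : (0 : ℝ) ∈ S := by
    have : y ≠ 0 := norm_ne_zero_iff.1 (by rw [hy]; exact hexp.ne')
    simpa [S] using this
  let γ : ℝ → Amb n := fun s =>
    (((2⁻¹ * Real.log (‖y + s • w‖ ^ 2) : ℝ) : ℂ) + ((z.im + s * ζ.im : ℝ) : ℂ) * Complex.I, y + s • w)
  have hcone : ∀ s ∈ S, ysq (γ s) = 0 := by
    intro s hs
    have hpos : 0 < ‖y + s • w‖ := norm_pos_iff.2 hs
    have hre : (γ s).1.re = Real.log ‖y + s • w‖ := by
      simp [γ, Real.log_pow]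
    rw [ysq_eq, hre, Real.exp_log hpos]
    simp [γ]
  have hcov : ∀ s ∈ S, γ s ∈ cov n := fun s hs => (mem_cov_iff _).2 (hcone s hs).ge
  have hγ0 : γ 0 = (z, y) := by
    refine Prod.ext ?_ (by simp [γ])
    simp only [γ, zero_smul, add_zero, zero_mul, hy, Real.log_pow, Real.log_exp]
    push_cast
    rw [show (2 : ℂ)⁻¹ * (2 * (z.re : ℂ)) = z.re by ring]
    exact Complex.re_add_im z
  have hline : HasDerivAt (fun s : ℝ => y + s • w) w 0 := by
    simpa using ((hasDerivAt_id (0 : ℝ)).smul_const w).const_add y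
  have hγ : HasDerivAt γ (ζ, w) 0 := by
    have h1 : HasDerivAt (fun s : ℝ => ‖y + s • w‖ ^ 2) (2 * inner ℝ y w) 0 := by
      simpa using hline.norm_sq
    have h2 : HasDerivAt (fun s : ℝ => 2⁻¹ * Real.log (‖y + s • w‖ ^ 2)) ζ.re 0 := by
      have := (h1.log (by simp [hy2, hexp.ne'])).const_mul (2⁻¹ : ℝ)
      have hval : (2⁻¹ : ℝ) * (2 * inner ℝ y w / ‖y + (0 : ℝ) • w‖ ^ 2) = ζ.re := by
        rw [← hW, zero_smul, add_zero, hy2]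
        field_simp
      rwa [hval] at this
    have h3 : HasDerivAt (fun s : ℝ => z.im + s * ζ.im) ζ.im 0 := by
      simpa using ((hasDerivAt_id (0 : ℝ)).mul_const ζ.im).const_add z.im
    have h4 := h2.ofReal_comp.add (h3.ofReal_comp.mul_const Complex.I)
    rw [Complex.re_add_im] at h4
    exact h4.prodMk hline
  have hd := f.differentiableWithinAt ⟨(z, y), hpc⟩
  have hd' : HasFDerivWithinAt (ext f) (fderivWithin ℝ (ext f) (cov n) (z, y)) (cov n) (γ 0) := by
    rw [hγ0]; exact hd.hasFDerivWithinAt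
  have hcomp := hd'.comp_hasDerivWithinAt (0 : ℝ) (hγ.hasDerivWithinAt (s := S)) hcov
  have hzero : HasDerivWithinAt (ext f ∘ γ) 0 S 0 :=
    (hasDerivWithinAt_const (0 : ℝ) S (0 : ℂ)).congr (fun s hs => by
      change ext f (γ s) = 0
      rw [ext_apply f.1 ⟨γ s, hcov s hs⟩]
      exact hf _ (hcone s hs)) (by
      change ext f (γ 0) = 0
      rw [ext_apply f.1 ⟨γ 0, hcov 0 hS0⟩]
      exact hf _ (hcone 0 hS0))
  exact (hSo.uniqueDiffWithinAt hS0).eq_deriv _ hcomp hzero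

theorem cone_pair {n : ℕ} {f : Smooth n} (hf : ∀ p : cov n, ysq p.1 = 0 → f p = 0)
    (p : cov n) (hp : ysq p.1 = 0) (a b : Idx n) :
    ((eta b * coord b p.1 : ℝ) : ℂ) * pd a f p = ((eta a * coord a p.1 : ℝ) : ℂ) * pd b f p := by
  have key : ∀ c : Idx n, Real.exp p.1.1.re ^ 2 * (frame c p.1).1.re -
      inner ℝ p.1.2 (frame c p.1).2 = eta c * coord c p.1 := by
    intro c
    have e1 : ∀ t : ℝ, Real.exp p.1.1.re ^ 2 * (Real.exp (-p.1.1.re) * t) = Real.exp p.1.1.re * t := by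
      intro t
      rw [Real.exp_neg]
      field_simp
    match c with
    | Sum.inl 0 => simp [frame, eta, coord, Complex.exp_re, e1]
    | Sum.inl 1 =>
      have := e1 (Real.sin p.1.1.im)
      simp [frame, eta, coord, Complex.exp_im, this]
    | Sum.inr j => simp [frame, eta, coord, EuclideanSpace.inner_single_right]
  have h := tangent_deriv_eq_zero hf p hp
    ((eta b * coord b p.1) • frame a p.1 - (eta a * coord a p.1) • frame b p.1) (by
      have ha := key a
      have hb := key b
      simp only [Prod.fst_sub, Prod.smul_fst, Prod.snd_sub, Prod.smul_snd, Complex.sub_re,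
        Complex.real_smul, Complex.re_ofReal_mul, inner_sub_right, inner_smul_right]
      rw [← ha, ← hb]
      ring)
  rw [map_sub, map_smul, map_smul, sub_eq_zero] at h
  simpa only [pd_apply, Complex.real_smul] using h

/-- The functions that vanish on the cone `y² = 0`. -/
def coneIdeal (n : ℕ) : LieSubmodule ℂ (𝔤 n) (Smooth n) where
  carrier := {f | ∀ p : cov n, ysq p.1 = 0 → f p = 0}
  add_mem' {f g} hf hg p hp := by rw [Smooth.add_apply, hf p hp, hg p hp, add_zero]
  zero_mem' _ _ := rfl
  smul_mem' c f hf p hp := by rw [Smooth.smul_apply, hf p hp, mul_zero]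
  lie_mem {A f} hf p hp := by
    have hA := (mem_so' A.1).1 A.2
    have he : ∀ a : Idx n, (eta a : ℂ) * eta a = 1 := by
      rintro (i | j) <;> simp [eta]
    have hpair := cone_pair hf p hp
    have hS : ⁅A, f⁆ p = -∑ a, ∑ b, A.1 a b * ((coord b p.1 : ℂ) * pd a f p) := by
      have hsum : ∀ (s : Finset (Idx n)) (g : Idx n → Smooth n), (∑ a ∈ s, g a) p = ∑ a ∈ s, g a p :=
        fun s g => map_sum (⟨⟨fun h : Smooth n => h p, rfl⟩, fun _ _ => rfl⟩ : Smooth n →+ ℂ) g s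
      rw [lie_def, Smooth.neg_apply, hsum]
      congr 1
      refine Finset.sum_congr rfl fun a _ => ?_
      rw [hsum]
      exact Finset.sum_congr rfl fun b _ => by rw [Smooth.smul_apply, mulCoord_apply]
    have hanti : ∑ a, ∑ b, A.1 a b * ((coord b p.1 : ℂ) * pd a f p) =
        -∑ a, ∑ b, A.1 a b * ((coord b p.1 : ℂ) * pd a f p) := by
      conv_rhs => rw [Finset.sum_comm]
      rw [← Finset.sum_neg_distrib]
      refine Finset.sum_congr rfl fun a _ => ?_
      rw [← Finset.sum_neg_distrib]
      refine Finset.sum_congr rfl fun b _ => ?_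
      have h1 := hpair a b
      have h2 := hA a b
      push_cast at h1
      linear_combination (eta b * A.1 a b) * h1 - (A.1 a b * coord b p.1 * pd a f p) * he b +
        (eta b * coord a p.1 * pd b f p) * h2 - (A.1 b a * coord a p.1 * pd b f p) * he b
    rw [hS, neg_eq_zero]
    exact self_eq_neg.1 hanti

instance {n : ℕ} {V : Type*} [AddCommGroup V] [Module ℂ V] [TopologicalSpace V]
    [LieRingModule (𝔤 n) V] (N : LieSubmodule ℂ (𝔤 n) V) : TopologicalSpace (V ⧸ N) :=
  inferInstanceAs (TopologicalSpace (V ⧸ N.toSubmodule))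

/-- A branch of `log x₁` on the covering, where `x₁ = (i/√2)(y^{-1} + i y^0)`. -/
def logX {n : ℕ} (p : Amb n) : ℂ := p.1 + Complex.log (Complex.I / (√2 : ℝ))

/-- `x₁ ^ s` on the covering. -/
def xPow {n : ℕ} (s : ℂ) (p : Amb n) : ℂ := Complex.exp (s * logX p)

/-- `x₋₁ = (i/√2)(y^{-1} - i y^0)`. -/
def xNeg {n : ℕ} (p : Amb n) : ℂ :=
  Complex.I / (√2 : ℝ) * (coord (Sum.inl 0) p - Complex.I * coord (Sum.inl 1) p)

theorem xPow_one {n : ℕ} (p : Amb n) : xPow 1 p =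
    Complex.I / (√2 : ℝ) * (coord (Sum.inl 0) p + Complex.I * coord (Sum.inl 1) p) := by
  have h0 : Complex.I / ((√2 : ℝ) : ℂ) ≠ 0 := by simp
  have h1 : (coord (Sum.inl 0) p : ℂ) + Complex.I * coord (Sum.inl 1) p = Complex.exp p.1 := by
    rw [mul_comm]; exact Complex.re_add_im _
  rw [xPow, one_mul, logX, Complex.exp_add, Complex.exp_log h0, h1, mul_comm]

theorem xPow_contDiff {n : ℕ} (s : ℂ) : ContDiff ℝ ∞ (xPow (n := n) s) :=
  (Complex.contDiff_exp (𝕜 := ℝ)).comp (contDiff_const.mul (contDiff_fst.add contDiff_const))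

theorem coordC_contDiff {n : ℕ} (a : Idx n) : ContDiff ℝ ∞ fun p : Amb n => (coord a p : ℂ) :=
  Complex.ofRealCLM.contDiff.comp (coord_contDiff a)

theorem xNeg_contDiff {n : ℕ} : ContDiff ℝ ∞ (xNeg (n := n)) :=
  contDiff_const.mul ((coordC_contDiff _).sub (contDiff_const.mul (coordC_contDiff _)))

theorem ysq_contDiff {n : ℕ} : ContDiff ℝ ∞ fun p : Amb n => (ysq p : ℂ) := by
  have h : ContDiff ℝ ∞ (ysq (n := n)) := by
    unfold ysq
    exact ContDiff.sum fun a _ => contDiff_const.mul ((coord_contDiff a).pow 2)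
  exact Complex.ofRealCLM.contDiff.comp h

/-- `φ₁ = x₋₁ x₁^{-n/2}`. -/
def φ₁ (n : ℕ) : Smooth n := Smooth.of (fun p => xNeg p * xPow (-(n / 2)) p)
  (xNeg_contDiff.mul (xPow_contDiff _)).contDiffOn

/-- `φ₂ = x₁^{-(n-2)/2}`. -/
def φ₂ (n : ℕ) : Smooth n := Smooth.of (fun p => xPow (-((n - 2) / 2)) p)
  (xPow_contDiff _).contDiffOn

/-- `φ₃ = y² x₁^{-(n+2)/2}`. -/
def φ₃ (n : ℕ) : Smooth n := Smooth.of (fun p => ysq p * xPow (-((n + 2) / 2)) p)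
  (ysq_contDiff.mul (xPow_contDiff _)).contDiffOn

/-- `H₁ = cl(U(𝔤) φ₁)`. -/
def H₁ (n : ℕ) : LieSubmodule ℂ (𝔤 n) (Smooth n) := closedSpan (φ₁ n)

/-- `H₂ = cl(U(𝔤) φ₂)`. -/
def H₂ (n : ℕ) : LieSubmodule ℂ (𝔤 n) (Smooth n) := closedSpan (φ₂ n)

/-- `H₃ = cl(U(𝔤) φ₃)`. -/
def H₃ (n : ℕ) : LieSubmodule ℂ (𝔤 n) (Smooth n) := closedSpan (φ₃ n)

/-- The subquotient `N₁ / (N₁ ∩ N₂)`, which is `N₁ / N₂` when `N₂ ⊆ N₁`. -/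
abbrev SubQuot {n : ℕ} (N₁ N₂ : LieSubmodule ℂ (𝔤 n) (Smooth n)) : Type :=
  N₁ ⧸ N₂.comap N₁.incl

/-- The smooth functions on the (covering of the) cone `Q = {y² = 0}` without its vertex: the
smooth functions on the covering, modulo those that vanish on the cone. -/
abbrev ConeFn (n : ℕ) : Type := Smooth n ⧸ coneIdeal n

/-- The restrictions to the cone of the functions in `N`. -/
abbrev onCone {n : ℕ} (N : LieSubmodule ℂ (𝔤 n) (Smooth n)) : LieSubmodule ℂ (𝔤 n) (ConeFn n) :=
  N.map (LieSubmodule.Quotient.mk' (coneIdeal n))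

section Modules

variable {n : ℕ} {V : Type*} [AddCommGroup V] [Module ℂ V] [LieRingModule (𝔤 n) V]

/-- The action of the Casimir element `C₂ = -½ M_{ab} M^{ab}`. -/
def casimir (n : ℕ) {V : Type*} [AddCommGroup V] [Module ℂ V] [LieRingModule (𝔤 n) V] (v : V) : V :=
  (-(1 / 2) : ℂ) • ∑ a : Idx n, ∑ b : Idx n, ((eta a * eta b : ℝ) : ℂ) • ⁅M a b, ⁅M a b, v⁆⁆

/-- The operator `C₂ + (n-2)(n+2)/4`. -/
def shiftedCasimir (n : ℕ) {V : Type*} [AddCommGroup V] [Module ℂ V] [LieRingModule (𝔤 n) V]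
    (v : V) : V :=
  casimir n v + (((n - 2) * (n + 2) / 4 : ℝ) : ℂ) • v

/-- `X` lies in the complexification of the maximal compact subalgebra `so(2) ⊕ so(n)`, the algebra
of block diagonal matrices. -/
def IsCompactElt (X : 𝔤 n) : Prop :=
  ∀ (i : Fin 2) (j : Fin n), X.1 (Sum.inl i) (Sum.inr j) = 0 ∧ X.1 (Sum.inr j) (Sum.inl i) = 0

/-- `v` lies in a finite dimensional subspace that is stable under `so(2) ⊕ so(n)`. -/
def IsKFinite (n : ℕ) {V : Type*} [AddCommGroup V] [Module ℂ V] [LieRingModule (𝔤 n) V] (v : V) :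
    Prop :=
  ∃ W : Submodule ℂ V, FiniteDimensional ℂ W ∧ v ∈ W ∧
    ∀ X : 𝔤 n, IsCompactElt X → ∀ w ∈ W, ⁅X, w⁆ ∈ W

/-- `v` is a highest weight vector of weight `(-E, 0, …, 0)`.  The `so(2) ⊕ so(n)`-module with this
highest weight is one dimensional: `so(n)` acts by zero and the element `H₁ = -i M_{-1,0}` of the
Cartan algebra acts by `-E`.  The noncompact positive root vectors, which span `𝔭⁺`, are the
combinations of the elements `M_{-1,k} + i M_{0,k}`; they annihilate `v`. -/
structure IsHighestWeightVector (n : ℕ) {V : Type*} [AddCommGroup V] [Module ℂ V]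
    [LieRingModule (𝔤 n) V] (E : ℝ) (v : V) : Prop where
  ne_zero : v ≠ 0
  energy : -Complex.I • ⁅(M (Sum.inl 0) (Sum.inl 1) : 𝔤 n), v⁆ = -(E : ℂ) • v
  rotation : ∀ j k : Fin n, ⁅(M (Sum.inr j) (Sum.inr k) : 𝔤 n), v⁆ = 0
  raising : ∀ k : Fin n,
    ⁅(M (Sum.inl 0) (Sum.inr k) : 𝔤 n), v⁆ + Complex.I • ⁅(M (Sum.inl 1) (Sum.inr k) : 𝔤 n), v⁆ = 0

/-- The topological module `V` carries `D(E, 0, …, 0)`, the irreducible representation with highest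
weight `(-E, 0, …, 0)`: the `so(2) ⊕ so(n)`-finite vectors are dense in `V`, and they form an
irreducible module that contains a highest weight vector of weight `(-E, 0, …, 0)`. -/
structure Carries (n : ℕ) (V : Type*) [AddCommGroup V] [Module ℂ V] [TopologicalSpace V]
    [LieRingModule (𝔤 n) V] (E : ℝ) : Prop where
  dense : Dense {v : V | IsKFinite n v}
  irreducible : ∀ W : LieSubmodule ℂ (𝔤 n) V, (∀ w ∈ W, IsKFinite n w) →
    W = ⊥ ∨ ∀ v : V, IsKFinite n v → v ∈ W
  highest : ∃ v : V, IsKFinite n v ∧ IsHighestWeightVector n E v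

end Modules

end GuptaBleuler

end

open scoped ContDiff Topology

noncomputable section

namespace GuptaBleuler

open MvPolynomial

/-! Write w = y^{-1} + i y^0, u_k = y^k / w, t = y² / w² and λ = -(n-2)/2. All three generators have
the form x₁^λ F(u, t): F is 1 for φ₂, -2t for φ₃, and t + u² = w̄/w for φ₁. On such functions
M_{-1,k} + i M_{0,k} acts as ∂/∂u_k (`lie_raise`), M_{-1,k} - i M_{0,k} acts by the first-order
operator `lower k` (`lie_lower`), and commutators of these give the energy and the rotations. So the
algebraic cyclic modules are cyclic modules of polynomials under `raise` and `lower`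
(`lieSpan_realize`, `realize_injective`).

The decisive tool is the operator `wave` = t(Δ_u + 4t∂_t²): λ is the degree at which it commutes
with every `lower k`. For F = ∑ t^m F_m, the equation `wave F = 0` says that F_0 is harmonic, leaves
F_1 free, and determines F_{m+1} from F_m for m ≥ 1. The module of t consists of all solutions with
F_0 = 0 (`gen_tPoly`), the module of 1 of all solutions (`gen_onePoly`), and `wave` sends t + u² to
2n t. Differentiating in u down to constants recovers the generators t and 1 of the two lower
layers. The top layer is irreducible because `wave` embeds it in the module of t.

Closures are handled by rotating the plane of y^{-1}, y^0. Among the polynomial functions each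
eigenspace of these rotations is finite dimensional (`level`), Fourier coefficients give continuous
projections (`levelProj`), and two applications of the energy operator gain a summable factor, so
that a function in the closure is recovered from its components (`mem_of_levelProj_mem`). Hence
closing adds nothing inside a level (`levelProj_mem_lieSpan`), a finite vector of a quotient lifts
to an algebraic one (`IsKFinite.exists_preimage`), and irreducibility passes from polynomials to
topological modules (`carries_of_projection`).

Since t vanishes on the cone and 1 does not, the same componentwise argument shows that the
functions of H₂ vanishing on the cone form H₃. In the Casimir operator (`casimir_realize`) all terms
are scalar on the three generators except ∑ `lower k` `raise k`; this kills 1 and t but sends t + u²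
to 2n t, which produces -nφ₃. -/

/-! ### Polynomials in `u` -/

/-- Polynomials in the variables `u_k = y^k / (y^{-1} + i y^0)`. -/
abbrev UPoly (n : ℕ) : Type := MvPolynomial (Fin n) ℂ

/-- The Laplacian `∑ ∂²/∂u_k²`. -/
def lap {n : ℕ} : UPoly n →ₗ[ℂ] UPoly n :=
  ∑ k, (pderiv k).toLinearMap ∘ₗ (pderiv k).toLinearMap

/-- The Euler derivation `∑ u_k ∂/∂u_k`. -/
def euler {n : ℕ} : Derivation ℂ (UPoly n) (UPoly n) := mkDerivation ℂ X

/-- `∑ u_k²`. -/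
def usq {n : ℕ} : UPoly n := ∑ k, X k ^ 2

/-- The first-order operator `u² ∂_k + 2 u_k (c - ∑ u_j ∂_j)`. -/
def conf {n : ℕ} (c : ℂ) (k : Fin n) : UPoly n →ₗ[ℂ] UPoly n :=
  LinearMap.mulLeft ℂ usq ∘ₗ (pderiv k).toLinearMap +
    LinearMap.mulLeft ℂ (2 * X k) ∘ₗ (c • LinearMap.id - euler.toLinearMap)

theorem lap_apply {n : ℕ} (q : UPoly n) : lap q = ∑ k, pderiv k (pderiv k q) := by
  simp [lap, LinearMap.sum_apply]

theorem conf_apply {n : ℕ} (c : ℂ) (k : Fin n) (q : UPoly n) :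
    conf c k q = usq * pderiv k q + 2 * X k * (c • q - euler q) := by
  simp [conf, mul_assoc]

theorem euler_X {n : ℕ} (k : Fin n) : euler (X k : UPoly n) = X k := by
  simp [euler]

theorem euler_apply {n : ℕ} (q : UPoly n) : euler q = ∑ k, X k * pderiv k q := by
  have h : (euler : Derivation ℂ (UPoly n) (UPoly n)) = ∑ k, (X k : UPoly n) • pderiv k := by
    refine derivation_ext fun j => ?_
    have : (∑ k, (X k : UPoly n) • pderiv k : Derivation ℂ (UPoly n) (UPoly n)) (X j) =
        ∑ k, ((X k : UPoly n) • pderiv k : Derivation ℂ (UPoly n) (UPoly n)) (X j) := by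
      rw [← Derivation.coeFnAddMonoidHom_apply, map_sum, Finset.sum_apply]; rfl
    rw [euler_X, this]
    simp [pderiv_X, Pi.single_apply]
  rw [h, ← Derivation.coeFnAddMonoidHom_apply, map_sum, Finset.sum_apply]; rfl

theorem euler_of_isHomogeneous {n r : ℕ} {q : UPoly n} (h : q.IsHomogeneous r) :
    euler q = (r : ℂ) • q := by
  rw [euler_apply, h.sum_X_mul_pderiv, Nat.cast_smul_eq_nsmul]

theorem pderiv_comm {n : ℕ} (j k : Fin n) (q : UPoly n) :
    pderiv j (pderiv k q) = pderiv k (pderiv j q) := by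
  have h : ⁅(pderiv j : Derivation ℂ (UPoly n) (UPoly n)), (pderiv k : Derivation ℂ (UPoly n) (UPoly n))⁆ = 0 := by
    refine derivation_ext fun i => ?_
    rw [Derivation.commutator_apply]
    simp only [pderiv_X, Pi.single_apply]
    split_ifs <;> simp
  have := DFunLike.congr_fun h q
  rw [Derivation.commutator_apply] at this
  exact sub_eq_zero.1 this

theorem pderiv_euler {n : ℕ} (k : Fin n) (q : UPoly n) :
    pderiv k (euler q) = euler (pderiv k q) + pderiv k q := by
  have h : ⁅(pderiv k : Derivation ℂ (UPoly n) (UPoly n)), euler⁆ = pderiv k := by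
    refine derivation_ext fun i => ?_
    rw [Derivation.commutator_apply, euler_X]
    simp only [pderiv_X, Pi.single_apply]
    split_ifs <;> simp
  have := DFunLike.congr_fun h q
  rw [Derivation.commutator_apply] at this
  linear_combination this

theorem pderiv_usq {n : ℕ} (k : Fin n) : pderiv k (usq : UPoly n) = 2 * X k := by
  simp only [usq, map_sum, pderiv_pow, pderiv_X, Pi.single_apply]
  simp

theorem pderiv_lap {n : ℕ} (k : Fin n) (q : UPoly n) : pderiv k (lap q) = lap (pderiv k q) := by
  simp only [lap_apply, map_sum]
  exact Finset.sum_congr rfl fun j _ => by rw [pderiv_comm k j, pderiv_comm k j]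

theorem lap_euler {n : ℕ} (q : UPoly n) : lap (euler q) = euler (lap q) + 2 * lap q := by
  simp only [lap_apply, pderiv_euler, map_add, map_sum, Finset.sum_add_distrib, Finset.mul_sum]
  rw [add_assoc, ← Finset.sum_add_distrib]
  exact congrArg _ (Finset.sum_congr rfl fun j _ => by ring)

theorem lap_X_mul {n : ℕ} (k : Fin n) (q : UPoly n) :
    lap (X k * q) = X k * lap q + 2 * pderiv k q := by
  have h : ∀ j, pderiv j (pderiv j (X k * q)) =
      X k * pderiv j (pderiv j q) + if j = k then 2 * pderiv k q else 0 := by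
    intro j
    simp only [pderiv_mul, pderiv_X, Pi.single_apply, map_add]
    split_ifs with h1 h2 h2
    · subst h1; simp; ring
    · exact absurd h1.symm h2
    · exact absurd h2.symm h1
    · simp
  simp only [lap_apply, h, Finset.sum_add_distrib, Finset.mul_sum]
  simp

theorem lap_usq_mul {n : ℕ} (q : UPoly n) :
    lap (usq * q) = usq * lap q + 4 * euler q + 2 * (n : UPoly n) * q := by
  have h : ∀ j, pderiv j (pderiv j (usq * q)) =
      usq * pderiv j (pderiv j q) + 4 * (X j * pderiv j q) + 2 * q := by
    intro j
    have h2 : pderiv j (2 * X j : UPoly n) = 2 := by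
      rw [two_mul, map_add, pderiv_X_self]; norm_num
    simp only [pderiv_mul, pderiv_usq, map_add, h2]
    ring
  simp only [lap_apply, h, Finset.sum_add_distrib, ← Finset.mul_sum, euler_apply]
  simp; ring

theorem lap_usq {n : ℕ} : lap (usq : UPoly n) = 2 * (n : UPoly n) := by
  have := lap_usq_mul (n := n) 1
  simpa [lap_apply] using this

theorem pderiv_conf {n : ℕ} (c : ℂ) (j k : Fin n) (q : UPoly n) :
    pderiv j (conf c k q) = conf c k (pderiv j q) + 2 * (X j * pderiv k q - X k * pderiv j q) +
      if j = k then 2 * (c • q - euler q) else 0 := by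
  have h2 : pderiv j (2 * X k : UPoly n) = if j = k then 2 else 0 := by
    rw [two_mul, map_add, pderiv_X]; simp only [Pi.single_apply]
    split_ifs with h h' h'
    · norm_num
    · exact absurd h.symm h'
    · exact absurd h'.symm h
    · simp
  simp only [conf_apply, map_add, pderiv_mul, pderiv_usq, map_sub, Derivation.map_smul, h2,
    pderiv_euler, pderiv_comm j k]
  split_ifs <;> ring

/-- The shift of c by 2 reflects that Δ lowers the degree by 2. The error term vanishes exactly for
c = 1 - n/2, the conformal weight `wt n`; for the other values that occur it is absorbed by the
t-derivatives in `wave_lower`. -/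
theorem lap_conf {n : ℕ} (c : ℂ) (k : Fin n) (q : UPoly n) :
    lap (conf c k q) = conf (c - 2) k (lap q) + (2 * n + 4 * c - 4) • pderiv k q := by
  simp only [conf_apply, map_add, mul_assoc, lap_usq_mul]
  rw [two_mul (X k * _), map_add, lap_X_mul, map_sub, map_smul, lap_euler, map_sub,
    Derivation.map_smul, pderiv_euler, pderiv_lap]
  simp only [smul_eq_C_mul, map_add, map_sub, map_mul, map_natCast, map_ofNat]
  ring

/-- Euler's identity turns ∑ u_k ∂_k into the degree. The formula is used to climb from degree r to
degree r + 1: a polynomial is produced from its own partial derivatives as soon as the operator on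
the right can be inverted. -/
theorem sum_conf_pderiv {n r : ℕ} (c : ℂ) {q : UPoly n} (h : q.IsHomogeneous (r + 1)) :
    ∑ k, conf c k (pderiv k q) = usq * lap q + (2 * (c - r) * (r + 1)) • q := by
  have h1 : ∀ k : Fin n, conf c k (pderiv k q) =
      usq * pderiv k (pderiv k q) + (2 * (c - r)) • (X k * pderiv k q) := by
    intro k
    have := euler_of_isHomogeneous (h.pderiv (i := k))
    rw [conf_apply, this]
    simp only [Nat.add_sub_cancel, smul_eq_C_mul, map_mul, map_sub, map_ofNat]
    ring
  simp only [h1, Finset.sum_add_distrib, ← Finset.mul_sum, ← Finset.smul_sum]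
  rw [← euler_apply, euler_of_isHomogeneous h, ← lap_apply, smul_smul]
  push_cast; rfl

theorem usq_isHomogeneous {n : ℕ} : (usq : UPoly n).IsHomogeneous 2 :=
  IsHomogeneous.sum _ _ _ fun k _ => (isHomogeneous_X ℂ k).pow 2

theorem lap_isHomogeneous {n r : ℕ} {q : UPoly n} (h : q.IsHomogeneous r) :
    (lap q).IsHomogeneous (r - 2) := by
  rw [lap_apply]
  exact IsHomogeneous.sum _ _ _ fun k _ => by
    have := (h.pderiv (i := k)).pderiv (i := k)
    rwa [Nat.sub_sub] at this

theorem lap_eq_zero_of_isHomogeneous {n r : ℕ} {q : UPoly n} (h : q.IsHomogeneous r) (hr : r < 2) :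
    lap q = 0 := by
  rw [lap_apply]
  refine Finset.sum_eq_zero fun k _ => ?_
  have h1 : (pderiv k q).IsHomogeneous 0 := by
    have := h.pderiv (i := k)
    rwa [show r - 1 = 0 by omega] at this
  rw [← totalDegree_zero_iff_isHomogeneous, totalDegree_eq_zero_iff_eq_C] at h1
  rw [h1, pderiv_C]

/-- `u² Δ` has no large eigenvalue on homogeneous polynomials. -/
theorem eq_zero_of_usq_mul_lap {n : ℕ} (r : ℕ) : ∀ (l : ℝ) (q : UPoly n), q.IsHomogeneous r →
    0 < l → (r : ℝ) * (2 * r + n) ≤ l → usq * lap q = (l : ℂ) • q → q = 0 := by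
  induction r using Nat.strong_induction_on with
  | _ r ih =>
    intro l q hq hl hr h
    have hl' : (l : ℂ) ≠ 0 := by exact_mod_cast hl.ne'
    by_cases h2 : r < 2
    · rw [lap_eq_zero_of_isHomogeneous hq h2, mul_zero] at h
      exact (smul_eq_zero.1 h.symm).resolve_left hl'
    obtain ⟨s, rfl⟩ : ∃ s, r = s + 2 := ⟨r - 2, by omega⟩
    set p : UPoly n := (l : ℂ)⁻¹ • lap q with hp
    have hps : p.IsHomogeneous s := by
      have := lap_isHomogeneous hq
      rw [hp, smul_eq_C_mul]
      simpa using (isHomogeneous_C (Fin n) (l : ℂ)⁻¹).mul this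
    have hqp : q = usq * p := by
      rw [hp, mul_smul_comm, h, smul_smul, inv_mul_cancel₀ hl', one_smul]
    have hlp : lap q = (l : ℂ) • p := by rw [hp, smul_smul, mul_inv_cancel₀ hl', one_smul]
    -- An eigenvector is q = u² p with p of degree s = r - 2. Since Δ(u² p) = u² Δp + (4s + 2n) p,
    -- the quotient p is again an eigenvector, with eigenvalue reduced by 4s + 2n. The lower bound
    -- survives: (s+2)(2(s+2)+n) - (4s+2n) = s(2s+n) + 4(s+2).
    have key : usq * lap p = ((l - (4 * s + 2 * n) : ℝ) : ℂ) • p := by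
      have h3 := lap_usq_mul p
      rw [← hqp, hlp, euler_of_isHomogeneous hps] at h3
      simp only [smul_eq_C_mul] at h3 ⊢
      push_cast at h3 ⊢
      simp only [map_sub, map_add, map_mul, map_natCast, map_ofNat] at h3 ⊢
      linear_combination -h3
    have hb : (s : ℝ) * (2 * s + n) + 4 * (s + 2) ≤ l - (4 * s + 2 * n) := by
      push_cast at hr; nlinarith
    have hs : (0 : ℝ) ≤ s := s.cast_nonneg
    have hn : (0 : ℝ) ≤ n := n.cast_nonneg
    rw [hqp, ih s (by omega) _ p hps (by nlinarith) (by nlinarith) key, mul_zero]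

/-- The operator preserves the finite-dimensional space of homogeneous polynomials of degree r;
there it is injective by `eq_zero_of_usq_mul_lap`, hence surjective. The constant r(2r + n) is the
one that `sum_conf_pderiv` produces for c = `wt n - 2`. -/
theorem exists_usq_mul_lap_sub {n r : ℕ} (hr : 0 < r) (q : UPoly n) (hq : q.IsHomogeneous r) :
    ∃ p : UPoly n, p.IsHomogeneous r ∧
      usq * lap p - ((r : ℂ) * (2 * r + n)) • p = q := by
  let V := homogeneousSubmodule (Fin n) ℂ r
  have : FiniteDimensional ℂ V := Module.Finite.iff_fg.2 (homogeneousSubmodule_fg (Fin n) ℂ r)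
  let T : UPoly n →ₗ[ℂ] UPoly n :=
    LinearMap.mulLeft ℂ usq ∘ₗ lap - ((r : ℂ) * (2 * r + n)) • LinearMap.id
  have hT : ∀ p, T p = usq * lap p - ((r : ℂ) * (2 * r + n)) • p := fun p => by simp [T]
  have hV : ∀ p ∈ V, T p ∈ V := by
    intro p hp
    rw [hT]
    refine V.sub_mem ?_ (V.smul_mem _ hp)
    by_cases h2 : r < 2
    · rw [lap_eq_zero_of_isHomogeneous hp h2, mul_zero]; exact V.zero_mem
    · have := usq_isHomogeneous.mul (lap_isHomogeneous (show p.IsHomogeneous r from hp))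
      rwa [show 2 + (r - 2) = r by omega] at this
  have hinj : Function.Injective (T.restrict hV) := by
    rw [← LinearMap.ker_eq_bot, LinearMap.ker_eq_bot']
    rintro ⟨p, hp⟩ h
    have h' : T p = 0 := congrArg Subtype.val h
    rw [hT, sub_eq_zero] at h'
    have hr' : (0 : ℝ) < r := by exact_mod_cast hr
    refine Subtype.ext (eq_zero_of_usq_mul_lap r ((r : ℝ) * (2 * r + n)) p hp (by positivity) le_rfl ?_)
    rw [h']; push_cast; rfl
  obtain ⟨⟨p, hp⟩, h⟩ := LinearMap.injective_iff_surjective.1 hinj ⟨q, hq⟩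
  exact ⟨p, hp, by rw [← hT]; exact congrArg Subtype.val h⟩

theorem eq_C_of_pderiv_eq_zero {n : ℕ} {q : UPoly n} (h : ∀ k, pderiv k q = 0) :
    q = C (coeff 0 q) := by
  ext α
  rw [coeff_C]
  split_ifs with h0
  · rw [h0]
  · obtain ⟨k, hk⟩ := Finsupp.ne_iff.1 (Ne.symm h0)
    have hk' : α k ≠ 0 := by simpa using hk
    have hα : α - Finsupp.single k 1 + Finsupp.single k 1 = α :=
      tsub_add_cancel_of_le (by
        rw [Finsupp.single_le_iff]; omega)
    have := coeff_pderiv (i := k) q (α - Finsupp.single k 1)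
    rw [h k, coeff_zero, hα] at this
    exact (mul_eq_zero.1 this.symm).resolve_right (Nat.cast_add_one_ne_zero _)

theorem homogeneousComponent_lap {n : ℕ} (r : ℕ) (q : UPoly n) :
    homogeneousComponent r (lap q) = lap (homogeneousComponent (r + 2) q) := by
  have h : ∀ e, ∀ p : UPoly n, p.IsHomogeneous e →
      homogeneousComponent r (lap p) = lap (homogeneousComponent (r + 2) p) := by
    intro e p hp
    rw [homogeneousComponent_of_mem hp]
    by_cases he : e < 2
    · rw [lap_eq_zero_of_isHomogeneous hp he]
      split_ifs <;> simp [lap_eq_zero_of_isHomogeneous hp he]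
    · rw [homogeneousComponent_of_mem (lap_isHomogeneous hp)]
      split_ifs with h1 h2 h2
      · rfl
      · omega
      · omega
      · simp
  rw [← sum_homogeneousComponent q]
  simp only [map_sum]
  exact Finset.sum_congr rfl fun e _ => h e _ (homogeneousComponent_isHomogeneous e q)

theorem lap_homogeneousComponent {n : ℕ} {q : UPoly n} (h : lap q = 0) (r : ℕ) :
    lap (homogeneousComponent r q) = 0 := by
  by_cases hr : r < 2
  · exact lap_eq_zero_of_isHomogeneous (homogeneousComponent_isHomogeneous r q) hr
  · obtain ⟨s, rfl⟩ : ∃ s, r = s + 2 := ⟨r - 2, by omega⟩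
    rw [← homogeneousComponent_lap, h, map_zero]

/-! ### Polynomials in `u` and `t` -/

/-- Polynomials in `u` and in `t = y² / (y^{-1} + i y^0)²`: the coefficient of `t^m` is the value
at `m`. -/
abbrev UTPoly (n : ℕ) : Type := ℕ →₀ UPoly n

/-- The degree of homogeneity `-(n-2)/2`. -/
def wt (n : ℕ) : ℂ := -((n - 2) / 2)

/-- The operator `∂/∂u_k`. -/
def raise {n : ℕ} (k : Fin n) : UTPoly n →ₗ[ℂ] UTPoly n :=
  Finsupp.lsum ℂ fun m => Finsupp.lsingle m ∘ₗ (pderiv k).toLinearMap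

/-- The operator `(t + u²) ∂/∂u_k + 2 u_k (wt - ∑ u_j ∂/∂u_j - 2 t ∂/∂t)`. -/
def lower {n : ℕ} (k : Fin n) : UTPoly n →ₗ[ℂ] UTPoly n :=
  Finsupp.lsum ℂ fun m => Finsupp.lsingle (m + 1) ∘ₗ (pderiv k).toLinearMap +
    Finsupp.lsingle m ∘ₗ conf (wt n - 2 * m) k

/-- The operator `t (Δ + 4 t ∂²/∂t²)`, which is minus the wave operator times `y²`. -/
def wave {n : ℕ} : UTPoly n →ₗ[ℂ] UTPoly n :=
  Finsupp.lsum ℂ fun m => Finsupp.lsingle (m + 1) ∘ₗ lap +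
    (4 * m * (m - 1) : ℂ) • Finsupp.lsingle m

theorem raise_single {n : ℕ} (k : Fin n) (m : ℕ) (q : UPoly n) :
    raise k (Finsupp.single m q) = Finsupp.single m (pderiv k q) := by
  simp [raise]

theorem lower_single {n : ℕ} (k : Fin n) (m : ℕ) (q : UPoly n) :
    lower k (Finsupp.single m q) = Finsupp.single (m + 1) (pderiv k q) +
      Finsupp.single m (conf (wt n - 2 * m) k q) := by
  simp [lower]

theorem wave_single {n : ℕ} (m : ℕ) (q : UPoly n) :
    wave (Finsupp.single m q) = Finsupp.single (m + 1) (lap q) +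
      (4 * m * (m - 1) : ℂ) • Finsupp.single m q := by
  simp [wave]

theorem utPoly_ext {n : ℕ} {V : Type*} [AddCommGroup V] [Module ℂ V] {f g : UTPoly n →ₗ[ℂ] V}
    (h : ∀ m q, f (Finsupp.single m q) = g (Finsupp.single m q)) (F : UTPoly n) : f F = g F :=
  LinearMap.congr_fun (Finsupp.lhom_ext h) F

theorem raise_apply {n : ℕ} (k : Fin n) (F : UTPoly n) (m : ℕ) :
    raise k F m = pderiv k (F m) := by
  refine utPoly_ext (f := Finsupp.lapply m ∘ₗ raise k)
    (g := (pderiv k).toLinearMap ∘ₗ Finsupp.lapply m) (fun j q => ?_) F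
  simp only [LinearMap.comp_apply, raise_single, Finsupp.lapply_apply, Finsupp.single_apply]
  split_ifs <;> simp

theorem lower_apply_zero {n : ℕ} (k : Fin n) (F : UTPoly n) :
    lower k F 0 = conf (wt n) k (F 0) := by
  refine utPoly_ext (f := Finsupp.lapply 0 ∘ₗ lower k)
    (g := conf (wt n) k ∘ₗ Finsupp.lapply 0) (fun j q => ?_) F
  simp only [LinearMap.comp_apply, lower_single, map_add, Finsupp.lapply_apply,
    Finsupp.single_apply]
  rcases j with _ | j <;> simp

theorem lower_apply_succ {n : ℕ} (k : Fin n) (F : UTPoly n) (m : ℕ) :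
    lower k F (m + 1) = pderiv k (F m) + conf (wt n - 2 * (m + 1)) k (F (m + 1)) := by
  refine utPoly_ext (f := Finsupp.lapply (m + 1) ∘ₗ lower k)
    (g := (pderiv k).toLinearMap ∘ₗ Finsupp.lapply m +
      conf (wt n - 2 * (m + 1)) k ∘ₗ Finsupp.lapply (m + 1)) (fun j q => ?_) F
  simp only [LinearMap.comp_apply, LinearMap.add_apply, lower_single, map_add,
    Finsupp.lapply_apply, Finsupp.single_apply]
  by_cases h : j = m
  · subst h; simp
  · by_cases h' : j = m + 1
    · subst h'; simp
    · simp [h, h']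

theorem wave_apply_succ {n : ℕ} (F : UTPoly n) (m : ℕ) :
    wave F (m + 1) = lap (F m) + (4 * (m + 1) * m : ℂ) • F (m + 1) := by
  refine utPoly_ext (f := Finsupp.lapply (m + 1) ∘ₗ wave)
    (g := lap ∘ₗ Finsupp.lapply m + (4 * (m + 1) * m : ℂ) • Finsupp.lapply (m + 1))
    (fun j q => ?_) F
  simp only [LinearMap.comp_apply, LinearMap.add_apply, LinearMap.smul_apply, wave_single, map_add,
    map_smul, Finsupp.lapply_apply, Finsupp.single_apply]
  by_cases h : j = m
  · subst h; simp
  · by_cases h' : j = m + 1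
    · subst h'; simp
    · simp [h, h']

theorem wave_raise {n : ℕ} (k : Fin n) (F : UTPoly n) : wave (raise k F) = raise k (wave F) := by
  refine utPoly_ext (f := wave ∘ₗ raise k) (g := raise k ∘ₗ wave) (fun m q => ?_) F
  simp [raise_single, wave_single, pderiv_lap]

/-- Here the value of `wt n` is essential. At t^{m+1}, the multiple of ∂_k q on the left is 4(m+1)m
from `wave` acting on t^{m+1}, plus 2n + 4(wt - 2m) - 4 = -8m from `lap_conf`; the sum 4m(m-1) is
what the right side requires. -/
theorem wave_lower {n : ℕ} (k : Fin n) (F : UTPoly n) : wave (lower k F) = lower k (wave F) := by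
  refine utPoly_ext (f := wave ∘ₗ lower k) (g := lower k ∘ₗ wave) (fun m q => ?_) F
  simp only [LinearMap.comp_apply, lower_single, wave_single, map_add, map_smul, pderiv_lap,
    lap_conf]
  have e1 : (2 * n + 4 * (wt n - 2 * m) - 4 : ℂ) = -8 * m := by rw [wt]; ring
  have e2 : wt n - 2 * ((m + 1 : ℕ) : ℂ) = wt n - 2 * m - 2 := by push_cast; ring
  rw [e1, e2, Finsupp.single_add, Finsupp.smul_single, Finsupp.smul_single]
  have e3 : Finsupp.single (m + 1) ((4 * ((m + 1 : ℕ) : ℂ) * (((m + 1 : ℕ) : ℂ) - 1)) • pderiv k q) +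
      Finsupp.single (m + 1) ((-8 * m : ℂ) • pderiv k q) =
      Finsupp.single (m + 1) ((4 * m * (m - 1) : ℂ) • pderiv k q) := by
    rw [← Finsupp.single_add, ← add_smul]
    congr 2; push_cast; ring
  rw [smul_add, Finsupp.smul_single, ← e3, Finsupp.smul_single]
  abel

/-- The commutators are those of the Lie algebra: a rotation for j ≠ k, the energy for j = k.
Consequently stability under `raise` and `lower` alone gives stability under the whole algebra. -/
theorem raise_lower {n : ℕ} (j k : Fin n) (m : ℕ) (q : UPoly n) :
    raise j (lower k (Finsupp.single m q)) - lower k (raise j (Finsupp.single m q)) =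
      Finsupp.single m (2 * (X j * pderiv k q - X k * pderiv j q) +
        if j = k then 2 * ((wt n - 2 * m) • q - euler q) else 0) := by
  simp only [raise_single, lower_single, map_add, pderiv_conf, pderiv_comm j k]
  rw [add_sub_add_left_eq_sub, ← Finsupp.single_sub]
  congr 1
  ring

/-! ### Stable subspaces -/

/-- `N` is stable under all `raise k` and `lower k`. -/
def IsStable {n : ℕ} (N : Submodule ℂ (UTPoly n)) : Prop :=
  ∀ k, ∀ F ∈ N, raise k F ∈ N ∧ lower k F ∈ N

/-- The stable subspace generated by `F`. -/
def gen {n : ℕ} (F : UTPoly n) : Submodule ℂ (UTPoly n) := sInf {N | IsStable N ∧ F ∈ N}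

theorem mem_gen_self {n : ℕ} (F : UTPoly n) : F ∈ gen F :=
  Submodule.mem_sInf.2 fun _ hN => hN.2

theorem gen_isStable {n : ℕ} (F : UTPoly n) : IsStable (gen F) := fun k G hG =>
  ⟨Submodule.mem_sInf.2 fun N hN => (hN.1 k G (Submodule.mem_sInf.1 hG N hN)).1,
    Submodule.mem_sInf.2 fun N hN => (hN.1 k G (Submodule.mem_sInf.1 hG N hN)).2⟩

theorem gen_le {n : ℕ} {F : UTPoly n} {N : Submodule ℂ (UTPoly n)} (hN : IsStable N) (hF : F ∈ N) :
    gen F ≤ N := sInf_le ⟨hN, hF⟩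

theorem isStable_ker_wave {n : ℕ} : IsStable (LinearMap.ker (wave (n := n))) := fun k F hF => by
  rw [LinearMap.mem_ker] at hF
  simp [wave_raise, wave_lower, hF]

theorem isStable_map_wave {n : ℕ} {N : Submodule ℂ (UTPoly n)} (hN : IsStable N) :
    IsStable (N.map wave) := by
  rintro k _ ⟨F, hF, rfl⟩
  exact ⟨⟨_, (hN k F hF).1, wave_raise k F⟩, ⟨_, (hN k F hF).2, wave_lower k F⟩⟩

theorem isStable_comap_wave {n : ℕ} {N : Submodule ℂ (UTPoly n)} (hN : IsStable N) :
    IsStable (N.comap wave) := fun k F hF => by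
  simp only [Submodule.mem_comap, wave_raise, wave_lower] at hF ⊢
  exact hN k _ hF

/-- The solutions of the wave equation that vanish on the cone. -/
def gauge (n : ℕ) : Submodule ℂ (UTPoly n) :=
  LinearMap.ker wave ⊓ LinearMap.ker (Finsupp.lapply (R := ℂ) 0)

theorem mem_gauge {n : ℕ} {F : UTPoly n} : F ∈ gauge n ↔ wave F = 0 ∧ F 0 = 0 := Iff.rfl

theorem isStable_gauge {n : ℕ} : IsStable (gauge n) := fun k F hF => by
  obtain ⟨h1, h2⟩ := mem_gauge.1 hF
  exact ⟨mem_gauge.2 ⟨(isStable_ker_wave k F h1).1, by rw [raise_apply, h2, map_zero]⟩,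
    mem_gauge.2 ⟨(isStable_ker_wave k F h1).2, by rw [lower_apply_zero, h2, map_zero]⟩⟩

/-- Applying derivatives to a polynomial one arrives at a nonzero constant. -/
theorem exists_raise_eq_zero {n : ℕ} {N : Submodule ℂ (UTPoly n)}
    (hN : ∀ k, ∀ F ∈ N, raise k F ∈ N) (I : Set ℕ) {F : UTPoly n} (hF : F ∈ N)
    (hI : ∃ m ∈ I, F m ≠ 0) :
    ∃ G ∈ N, (∃ m ∈ I, G m ≠ 0) ∧ ∀ m ∈ I, G m = C (coeff 0 (G m)) := by
  -- Induction on a strict bound N₀ for the u-degree of all coefficients. The set `I` selects the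
  -- powers of t at which the coefficients must become constant without all vanishing; at other
  -- powers nothing is claimed.
  have key : ∀ (N₀ : ℕ) (F : UTPoly n), F ∈ N → (∃ m ∈ I, F m ≠ 0) →
      (∀ m, ∀ α : Fin n →₀ ℕ, N₀ ≤ α.degree → coeff α (F m) = 0) →
      ∃ G ∈ N, (∃ m ∈ I, G m ≠ 0) ∧ ∀ m ∈ I, G m = C (coeff 0 (G m)) := by
    intro N₀
    induction N₀ with
    | zero =>
      rintro F - ⟨m, -, hm⟩ h
      exact absurd (MvPolynomial.ext _ _ fun α => by simpa using h m α (Nat.zero_le _)) hm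
    | succ N₀ ih =>
      intro F hF hI h
      by_cases hk : ∃ k, ∃ m ∈ I, raise k F m ≠ 0
      · obtain ⟨k, hk⟩ := hk
        refine ih (raise k F) (hN k F hF) hk fun m α hα => ?_
        rw [raise_apply, coeff_pderiv, h m _ (by simpa using hα), zero_mul]
      · push Not at hk
        exact ⟨F, hF, hI, fun m hm => eq_C_of_pderiv_eq_zero fun k => by
          rw [← raise_apply]; exact hk k m hm⟩
  refine key (F.support.sup (fun m => (F m).totalDegree) + 1) F hF hI fun m α hα => ?_
  refine coeff_eq_zero_of_totalDegree_lt (lt_of_le_of_lt ?_ (Nat.lt_of_succ_le hα))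
  by_cases hm : m ∈ F.support
  · exact Finset.le_sup (f := fun m => (F m).totalDegree) hm
  · rw [Finsupp.notMem_support_iff.1 hm]; simp

/-! ### The modules generated by 1, t and t + u². -/

/-- The polynomial `1`. -/
def onePoly (n : ℕ) : UTPoly n := Finsupp.single 0 1

/-- The polynomial `t`. -/
def tPoly (n : ℕ) : UTPoly n := Finsupp.single 1 1

/-- The polynomial `t + u²`. -/
def vPoly (n : ℕ) : UTPoly n := Finsupp.single 1 1 + Finsupp.single 0 usq

theorem wave_onePoly {n : ℕ} : wave (onePoly n) = 0 := by
  simp [onePoly, wave_single, lap_apply]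

theorem wave_tPoly {n : ℕ} : wave (tPoly n) = 0 := by
  simp [tPoly, wave_single, lap_apply]

theorem wave_vPoly {n : ℕ} : wave (vPoly n) = (2 * n : ℂ) • tPoly n := by
  have h : (2 * (n : UPoly n)) = (2 * n : ℂ) • 1 := by
    simp only [smul_eq_C_mul, map_mul, map_natCast, map_ofNat, mul_one]
  rw [vPoly, map_add, wave_single, wave_single, lap_usq, h]
  simp [lap_apply, tPoly]

theorem tPoly_mem_gauge {n : ℕ} : tPoly n ∈ gauge n :=
  mem_gauge.2 ⟨wave_tPoly, by simp [tPoly]⟩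

/-- The wave equation reads Δ(F m) + 4(m+1)m F(m+1) = 0. For m ≥ 1 the factor is nonzero, so F 1
determines all later coefficients; for m = 0 it vanishes, which is why F 1 itself is unconstrained.
-/
theorem gauge_ext {n : ℕ} {F : UTPoly n} (hF : F ∈ gauge n) (h1 : F 1 = 0) : F = 0 := by
  obtain ⟨hw, h0⟩ := mem_gauge.1 hF
  have h : ∀ m, F (m + 1) = 0 := by
    intro m
    induction m with
    | zero => exact h1
    | succ m ih =>
      have h := wave_apply_succ F (m + 1)
      rw [hw, ih, map_zero, zero_add, Finsupp.zero_apply] at h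
      refine (smul_eq_zero.1 h.symm).resolve_left ?_
      have h1 : ((m + 1 : ℕ) : ℂ) ≠ 0 := by exact_mod_cast Nat.succ_ne_zero m
      have h2 : ((m + 1 : ℕ) : ℂ) + 1 ≠ 0 := by exact_mod_cast Nat.succ_ne_zero (m + 1)
      exact mul_ne_zero (mul_ne_zero (by norm_num) h2) h1
  ext1 m
  rcases m with _ | m
  · exact h0
  · exact h m

theorem mem_of_forall_homogeneous_mem {n : ℕ} (V : Submodule ℂ (UPoly n))
    (h : ∀ r, ∀ q : UPoly n, q.IsHomogeneous r → q ∈ V) (q : UPoly n) : q ∈ V := by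
  rw [← sum_homogeneousComponent q]
  exact V.sum_mem fun r _ => h r _ (homogeneousComponent_isHomogeneous r q)

/-- By `gauge_ext` it suffices to reach every polynomial as coefficient of t. When F 0 = 0, `lower
k` acts on that coefficient as `conf (wt n - 2) k`. Applying these to lifts of the partial
derivatives of p and summing gives u² Δp - R(2R+n)p in degree R = r + 1 (`sum_conf_pderiv`), and
`exists_usq_mul_lap_sub` says that every polynomial of degree R has this form. -/
theorem gen_tPoly {n : ℕ} : gen (tPoly n) = gauge n := by
  refine le_antisymm (gen_le isStable_gauge tPoly_mem_gauge) fun F hF => ?_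
  have key : ∀ q : UPoly n, q ∈ (gen (tPoly n)).map (Finsupp.lapply (R := ℂ) 1) := by
    refine mem_of_forall_homogeneous_mem _ fun r => ?_
    induction r with
    | zero =>
      intro q hq
      rw [← totalDegree_zero_iff_isHomogeneous, totalDegree_eq_zero_iff_eq_C] at hq
      refine ⟨coeff 0 q • tPoly n, Submodule.smul_mem _ _ (mem_gen_self _), ?_⟩
      conv_rhs => rw [hq]
      simp [tPoly, smul_eq_C_mul]
    | succ r ih =>
      intro q hq
      obtain ⟨p, hp, rfl⟩ := exists_usq_mul_lap_sub (Nat.succ_pos r) q hq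
      have h1 := sum_conf_pderiv (wt n - 2) hp
      have h2 : usq * lap p - (((r + 1 : ℕ) : ℂ) * (2 * (r + 1 : ℕ) + n)) • p =
          ∑ k, conf (wt n - 2) k (pderiv k p) := by
        rw [h1, sub_eq_add_neg, ← neg_smul]
        congr 2
        rw [wt]; push_cast; ring
      rw [h2]
      refine Submodule.sum_mem _ fun k _ => ?_
      obtain ⟨G, hG, hGp⟩ := ih (pderiv k p) (by simpa using hp.pderiv (i := k))
      refine ⟨lower k G, (gen_isStable _ k G hG).2, ?_⟩
      have h0 := (mem_gauge.1 (gen_le isStable_gauge tPoly_mem_gauge hG)).2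
      have := lower_apply_succ k G 0
      rw [h0, map_zero, zero_add] at this
      rw [Finsupp.lapply_apply] at hGp ⊢
      rw [zero_add] at this
      rw [this, hGp]
      congr 2; simp
  obtain ⟨G, hG, hGF⟩ := key (F 1)
  have hG' := gen_le isStable_gauge tPoly_mem_gauge hG
  have : F - G = 0 := gauge_ext (Submodule.sub_mem _ hF hG') (by
    rw [Finsupp.sub_apply, sub_eq_zero]; exact hGF.symm)
  rwa [sub_eq_zero.1 this]

theorem wt_ne_zero {n : ℕ} (hn : 3 ≤ n) : wt n ≠ 0 := by
  have : (n : ℂ) - 2 ≠ 0 := by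
    rw [sub_ne_zero]; exact_mod_cast (by omega : n ≠ 2)
  simp [wt, this]

/-- Lowering 1 twice in the direction k gives 2 wt (t + u² + 2(wt - 1)u_k²). In the sum over k the
u² terms cancel because n + 2(wt - 1) = 0, leaving 2n wt t, and wt ≠ 0 for n ≥ 3. -/
theorem tPoly_mem_gen_onePoly {n : ℕ} (hn : 3 ≤ n) : tPoly n ∈ gen (onePoly n) := by
  have h : ∑ k, lower k (lower k (onePoly n)) = (2 * wt n * n) • tPoly n := by
    have hk : ∀ k : Fin n, lower k (lower k (onePoly n)) =
        (2 * wt n) • (tPoly n + Finsupp.single 0 (usq + (2 * (wt n - 1)) • X k ^ 2)) := by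
      intro k
      have e : conf (wt n) k (1 : UPoly n) = (2 * wt n) • X k := by
        rw [conf_apply, pderiv_one, Derivation.map_one_eq_zero]
        simp only [smul_eq_C_mul, map_mul, map_ofNat]; ring
      rw [onePoly, lower_single, pderiv_one, Finsupp.single_zero, zero_add, Nat.cast_zero, mul_zero,
        sub_zero, e, ← Finsupp.smul_single, map_smul, lower_single, pderiv_X_self]
      congr 3
      rw [conf_apply, pderiv_X_self, euler_X]
      simp only [smul_eq_C_mul, map_mul, map_sub, map_ofNat, map_one, Nat.cast_zero, mul_zero,
        sub_zero]
      ring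
    simp only [hk, ← Finset.smul_sum, Finset.sum_add_distrib, ← Finsupp.single_finsetSum]
    have hz : ((n : ℂ) • usq + (2 * (wt n - 1)) • usq : UPoly n) = 0 := by
      rw [← add_smul, wt]; ring_nf; simp
    rw [← usq]
    simp only [Finset.sum_const, Finset.card_univ, Fintype.card_fin, ← Nat.cast_smul_eq_nsmul ℂ]
    rw [hz, Finsupp.single_zero, add_zero, smul_smul]
  have h2 : (2 * wt n * n) ≠ 0 :=
    mul_ne_zero (mul_ne_zero two_ne_zero (wt_ne_zero hn)) (by exact_mod_cast (by omega : n ≠ 0))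
  have h3 : ∑ k, lower k (lower k (onePoly n)) ∈ gen (onePoly n) := Submodule.sum_mem _ fun k _ =>
    (gen_isStable _ k _ (gen_isStable _ k _ (mem_gen_self _)).2).2
  rw [h] at h3
  exact (Submodule.smul_mem_iff _ h2).1 h3

theorem lap_apply_zero_of_wave {n : ℕ} {F : UTPoly n} (hF : wave F = 0) : lap (F 0) = 0 := by
  have := wave_apply_succ F 0
  rw [hF] at this
  simpa using this.symm

/-- Every harmonic polynomial occurs as coefficient of t^0: for harmonic q of degree r + 1 the sum
in `sum_conf_pderiv` with c = `wt n` is the scalar (2 - n - 2r)(r + 1), nonzero for n ≥ 3, times q.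
Two solutions with the same F 0 differ by an element of `gauge n` = `gen (tPoly n)`, which lies in
the module of 1. -/
theorem gen_onePoly {n : ℕ} (hn : 3 ≤ n) : gen (onePoly n) = LinearMap.ker wave := by
  have hle : gen (onePoly n) ≤ LinearMap.ker wave := gen_le isStable_ker_wave wave_onePoly
  refine le_antisymm hle fun F hF => ?_
  have key : ∀ r, ∀ q : UPoly n, q.IsHomogeneous r → lap q = 0 →
      q ∈ (gen (onePoly n)).map (Finsupp.lapply (R := ℂ) 0) := by
    intro r
    induction r with
    | zero =>
      intro q hq _
      rw [← totalDegree_zero_iff_isHomogeneous, totalDegree_eq_zero_iff_eq_C] at hq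
      refine ⟨coeff 0 q • onePoly n, Submodule.smul_mem _ _ (mem_gen_self _), ?_⟩
      conv_rhs => rw [hq]
      simp [onePoly, smul_eq_C_mul]
    | succ r ih =>
      intro q hq hl
      have h1 := sum_conf_pderiv (wt n) hq
      rw [hl, mul_zero, zero_add] at h1
      have hc : 2 * (wt n - r) * (r + 1) ≠ 0 := by
        have e : 2 * (wt n - r) * (r + 1) = (((2 - n - 2 * r) * (r + 1) : ℤ) : ℂ) := by
          rw [wt]; push_cast; ring
        rw [e, Int.cast_ne_zero]
        exact mul_ne_zero (by omega) (by omega)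
      refine (Submodule.smul_mem_iff _ hc).1 ?_
      rw [← h1]
      refine Submodule.sum_mem _ fun k _ => ?_
      obtain ⟨G, hG, hGq⟩ := ih (pderiv k q) (by simpa using hq.pderiv (i := k))
        (by rw [← pderiv_lap, hl, map_zero])
      refine ⟨lower k G, (gen_isStable _ k G hG).2, ?_⟩
      rw [Finsupp.lapply_apply] at hGq ⊢
      rw [lower_apply_zero, hGq]
  have key2 : F 0 ∈ (gen (onePoly n)).map (Finsupp.lapply (R := ℂ) 0) := by
    rw [← sum_homogeneousComponent (F 0)]
    exact Submodule.sum_mem _ fun r _ => key r _ (homogeneousComponent_isHomogeneous r _)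
      (lap_homogeneousComponent (lap_apply_zero_of_wave hF) r)
  obtain ⟨G, hG, hGF⟩ := key2
  have h1 : F - G ∈ gauge n := mem_gauge.2 ⟨by
    rw [map_sub, LinearMap.mem_ker.1 hF, LinearMap.mem_ker.1 (hle hG), sub_zero], by
    rw [Finsupp.sub_apply, sub_eq_zero]; exact hGF.symm⟩
  rw [← gen_tPoly] at h1
  have h2 := gen_le (gen_isStable _) (tPoly_mem_gen_onePoly hn) h1
  simpa using Submodule.add_mem _ h2 hG

theorem onePoly_mem_gen_vPoly {n : ℕ} (hn : 3 ≤ n) : onePoly n ∈ gen (vPoly n) := by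
  let k : Fin n := ⟨0, by omega⟩
  have h : raise k (raise k (vPoly n)) = (2 : ℂ) • onePoly n := by
    rw [vPoly, map_add, raise_single, raise_single, pderiv_one, pderiv_usq, Finsupp.single_zero,
      zero_add, raise_single, two_mul, map_add, pderiv_X_self, onePoly, Finsupp.smul_single,
      two_smul]
  have h3 := (gen_isStable _ k _ (gen_isStable _ k _ (mem_gen_self (vPoly n))).1).1
  rw [h] at h3
  exact (Submodule.smul_mem_iff _ two_ne_zero).1 h3

/-- Irreducibility of the bottom layer. Differentiate F until all its coefficients are constant in
u. The Laplacian terms of the wave equation then vanish and force the coefficients of t², t³, … to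
be zero, so that a nonzero multiple of t remains. -/
theorem tPoly_mem_gen {n : ℕ} {F : UTPoly n} (hF : F ∈ gen (tPoly n)) (h0 : F ≠ 0) :
    tPoly n ∈ gen F := by
  rw [gen_tPoly] at hF
  obtain ⟨G, hG, ⟨m, -, hm⟩, hc⟩ := exists_raise_eq_zero
    (fun k F hF => (gen_isStable _ k F hF).1) Set.univ (mem_gen_self F)
    (by simpa [Finsupp.ne_iff] using h0)
  obtain ⟨hw, hG0⟩ := mem_gauge.1 (gen_le isStable_gauge hF hG)
  have h2 : ∀ m, G (m + 2) = 0 := by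
    intro m
    have h := wave_apply_succ G (m + 1)
    rw [hw, hc (m + 1) trivial, lap_apply] at h
    simp only [pderiv_C, map_zero, Finset.sum_const_zero, zero_add, Finsupp.zero_apply] at h
    refine (smul_eq_zero.1 h.symm).resolve_left ?_
    have h1 : ((m + 1 : ℕ) : ℂ) ≠ 0 := by exact_mod_cast Nat.succ_ne_zero m
    have h2 : ((m + 1 : ℕ) : ℂ) + 1 ≠ 0 := by exact_mod_cast Nat.succ_ne_zero (m + 1)
    exact mul_ne_zero (mul_ne_zero (by norm_num) h2) h1
  have hGt : G = coeff 0 (G 1) • tPoly n := by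
    ext1 j
    match j with
    | 0 => simp [hG0, tPoly]
    | 1 => rw [hc 1 trivial]; simp [tPoly, smul_eq_C_mul]
    | j + 2 => simp [h2, tPoly]
  have hne : coeff 0 (G 1) ≠ 0 := by
    intro h
    rw [h, zero_smul] at hGt
    simp [hGt] at hm
  rw [hGt] at hG
  exact (Submodule.smul_mem_iff _ hne).1 hG

/-- Irreducibility of the middle layer. Being outside `gen (tPoly n)` means F 0 ≠ 0, so only the
coefficient of t^0 has to be differentiated down to a nonzero constant; after scaling, what remains
lies in `gauge n`. -/
theorem exists_mem_gen_sub_onePoly {n : ℕ} (hn : 3 ≤ n) {F : UTPoly n} (hF : F ∈ gen (onePoly n))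
    (h0 : F ∉ gen (tPoly n)) : ∃ G ∈ gen F, G - onePoly n ∈ gen (tPoly n) := by
  rw [gen_onePoly hn] at hF
  rw [gen_tPoly] at h0 ⊢
  have hF0 : F 0 ≠ 0 := fun h => h0 (mem_gauge.2 ⟨hF, h⟩)
  obtain ⟨G, hG, ⟨m, hm0, hm⟩, hc⟩ := exists_raise_eq_zero
    (fun k F hF => (gen_isStable _ k F hF).1) {0} (mem_gen_self F) ⟨0, rfl, hF0⟩
  obtain rfl : m = 0 := hm0
  have hc0 := hc 0 rfl
  have hne : coeff 0 (G 0) ≠ 0 := by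
    intro h
    exact hm (by rw [hc0, h, C_0])
  refine ⟨(coeff 0 (G 0))⁻¹ • G, Submodule.smul_mem _ _ hG, mem_gauge.2 ⟨?_, ?_⟩⟩
  · rw [map_sub, map_smul, LinearMap.mem_ker.1 (gen_le isStable_ker_wave hF hG), wave_onePoly,
      smul_zero, sub_zero]
  · rw [Finsupp.sub_apply, Finsupp.smul_apply, hc0, onePoly, Finsupp.single_eq_same, smul_eq_C_mul,
      ← map_mul, coeff_C]
    simp [hne]

/-- Irreducibility of the top layer, transported from the bottom one. `wave` commutes with the
action, has kernel `gen (onePoly n)` and maps into `gen (tPoly n)`; so `wave F` is nonzero there and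
t = `wave G` for some G in `gen F`. Now `wave` takes the same value on 2nG and t + u². -/
theorem exists_mem_gen_sub_vPoly {n : ℕ} (hn : 3 ≤ n) {F : UTPoly n} (hF : F ∈ gen (vPoly n))
    (h0 : F ∉ gen (onePoly n)) : ∃ G ∈ gen F, G - vPoly n ∈ gen (onePoly n) := by
  rw [gen_onePoly hn] at h0 ⊢
  have h1 : wave F ∈ gen (tPoly n) :=
    gen_le (isStable_comap_wave (gen_isStable (tPoly n))) (F := vPoly n) (by
      rw [Submodule.mem_comap, wave_vPoly]
      exact Submodule.smul_mem _ _ (mem_gen_self _)) hF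
  have h2 := tPoly_mem_gen h1 h0
  obtain ⟨G, hG, hGt⟩ := gen_le (isStable_map_wave (gen_isStable F)) ⟨F, mem_gen_self F, rfl⟩ h2
  refine ⟨(2 * n : ℂ) • G, Submodule.smul_mem _ _ hG, ?_⟩
  rw [LinearMap.mem_ker, map_sub, map_smul, hGt, wave_vPoly, sub_self]

/-! ### Realization of the polynomials as functions on the covering -/

/-- The function `u_k = y^k / (y^{-1} + i y^0)`. -/
def uFun {n : ℕ} (k : Fin n) (p : Amb n) : ℂ := p.2 k * Complex.exp (-p.1)

/-- The function `t = y² / (y^{-1} + i y^0)²`. -/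
def tFun {n : ℕ} (p : Amb n) : ℂ := ysq p * Complex.exp (-p.1) ^ 2

/-- The function `x₁^wt t^m q(u)`. -/
def monoFun {n : ℕ} (m : ℕ) (q : UPoly n) (p : Amb n) : ℂ :=
  xPow (wt n) p * tFun p ^ m * aeval (fun k => uFun k p) q

theorem expNeg_contDiff {n : ℕ} : ContDiff ℝ ∞ fun p : Amb n => Complex.exp (-p.1) :=
  (Complex.contDiff_exp (𝕜 := ℝ)).comp contDiff_fst.neg

theorem uFun_contDiff {n : ℕ} (k : Fin n) : ContDiff ℝ ∞ (uFun k) :=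
  (coordC_contDiff (Sum.inr k)).mul expNeg_contDiff

theorem tFun_contDiff {n : ℕ} : ContDiff ℝ ∞ (tFun (n := n)) :=
  ysq_contDiff.mul (expNeg_contDiff.pow 2)

theorem aeval_contDiff {n : ℕ} (q : UPoly n) :
    ContDiff ℝ ∞ fun p : Amb n => (aeval fun k => uFun k p) q := by
  induction q using MvPolynomial.induction_on with
  | C a => simpa using contDiff_const
  | add p q hp hq => simpa using hp.add hq
  | mul_X p k hp => simpa using hp.mul (uFun_contDiff k)

theorem monoFun_contDiff {n : ℕ} (m : ℕ) (q : UPoly n) : ContDiff ℝ ∞ (monoFun m q) :=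
  ((xPow_contDiff _).mul (tFun_contDiff.pow m)).mul (aeval_contDiff q)

/-- The function `x₁^wt t^m q(u)`, as an element of `C^∞`, linearly in `q`. -/
def mono {n : ℕ} (m : ℕ) : UPoly n →ₗ[ℂ] Smooth n where
  toFun q := Smooth.of (monoFun m q) (monoFun_contDiff m q).contDiffOn
  map_add' p q := Smooth.hext fun x => by
    change monoFun m (p + q) x.1 = monoFun m p x.1 + monoFun m q x.1
    simp only [monoFun, map_add, mul_add]
  map_smul' c q := Smooth.hext fun x => by
    change monoFun m (c • q) x.1 = c * monoFun m q x.1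
    simp only [monoFun, map_smul, smul_eq_mul]
    ring

/-- The function `x₁^wt F(u, t)` attached to the polynomial `F`. -/
def realize {n : ℕ} : UTPoly n →ₗ[ℂ] Smooth n := Finsupp.lsum ℂ mono

theorem realize_single {n : ℕ} (m : ℕ) (q : UPoly n) :
    realize (Finsupp.single m q) = mono m q := by
  simp [realize]

theorem mono_apply {n : ℕ} (m : ℕ) (q : UPoly n) (p : cov n) : mono m q p = monoFun m q p.1 := rfl

/-! ### The action of so(2,n) on the polynomial functions. -/

/-- The vector field `y_a ∂_b - y_b ∂_a`. -/
def rotField {n : ℕ} (a b : Idx n) (p : Amb n) : Amb n :=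
  (eta a * coord a p) • frame b p - (eta b * coord b p) • frame a p

theorem lie_M_of {n : ℕ} (a b : Idx n) {F : Amb n → ℂ} (hF : ContDiffOn ℝ ∞ F (cov n)) (p : cov n)
    {F' : Amb n →L[ℝ] ℂ} (h : HasFDerivAt F F' p.1) :
    ⁅M a b, Smooth.of F hF⁆ p = F' (rotField a b p.1) := by
  have hw : fderivWithin ℝ F (cov n) p = F' :=
    h.hasFDerivWithinAt.fderivWithin (cov_uniqueDiffOn n p p.2)
  rw [lie_M, sub_eq_add_neg, Smooth.add_apply, Smooth.neg_apply, Smooth.smul_apply,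
    Smooth.smul_apply, mulCoord_apply, mulCoord_apply, pd_of, pd_of, hw, rotField, map_sub,
    map_smul, map_smul, Complex.real_smul, Complex.real_smul]
  push_cast
  ring

theorem fderiv_ysq_frame {n : ℕ} (a : Idx n) (p : Amb n) :
    fderiv ℝ ysq p (frame a p) = 2 * (eta a * coord a p) := by
  have h : HasFDerivAt ysq (∑ b, (eta b : ℝ) • ((2 * coord b p) • fderiv ℝ (coord b) p)) p := by
    unfold ysq
    refine HasFDerivAt.fun_sum fun b _ => ?_
    have := (((coord_contDiff b).differentiable (by simp) p).hasFDerivAt.pow 2).const_mul (eta b)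
    simpa using this
  rw [h.fderiv]
  simp only [sum_apply, smul_apply, fderiv_coord,
    smul_eq_mul, mul_ite, mul_one, mul_zero, Finset.sum_ite_eq, Finset.mem_univ, if_true]
  ring

theorem fderiv_ysq_rotField {n : ℕ} (a b : Idx n) (p : Amb n) :
    fderiv ℝ ysq p (rotField a b p) = 0 := by
  rw [rotField, map_sub, map_smul, map_smul, fderiv_ysq_frame, fderiv_ysq_frame, smul_eq_mul,
    smul_eq_mul]
  ring

theorem hasFDerivAt_aeval {n : ℕ} (q : UPoly n) (p : Amb n) :
    HasFDerivAt (fun p : Amb n => (aeval fun k => uFun k p) q)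
      (∑ k, (aeval (fun k => uFun k p) (pderiv k q)) • fderiv ℝ (uFun k) p) p := by
  induction q using MvPolynomial.induction_on with
  | C a =>
    simp only [aeval_C, Algebra.algebraMap_self, RingHom.id_apply]
    refine (hasFDerivAt_const a p).congr_fderiv (ContinuousLinearMap.ext fun v => ?_)
    simp only [sum_apply, smul_apply, pderiv_C, map_zero, zero_smul, Finset.sum_const_zero,
      zero_apply]
  | add q r hq hr =>
    have e : (fun p : Amb n => (aeval fun k => uFun k p) (q + r)) =
        (fun p => (aeval fun k => uFun k p) q) + (fun p => (aeval fun k => uFun k p) r) := by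
      funext p; simp
    rw [e]
    refine (hq.add hr).congr_fderiv (ContinuousLinearMap.ext fun v => ?_)
    simp only [add_apply, sum_apply, smul_apply, smul_eq_mul, map_add, add_mul,
      Finset.sum_add_distrib]
  | mul_X q j hq =>
    have hj := ((uFun_contDiff j).differentiable (by simp) p).hasFDerivAt
    have e : (fun p : Amb n => (aeval fun k => uFun k p) (q * X j)) =
        (fun p => (aeval fun k => uFun k p) q) * uFun j := by
      funext p; simp
    rw [e]
    refine (hq.mul hj).congr_fderiv (ContinuousLinearMap.ext fun v => ?_)
    simp only [add_apply, sum_apply, smul_apply, smul_eq_mul, pderiv_mul, map_add, map_mul,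
      aeval_X, pderiv_X, add_mul, Finset.sum_add_distrib, Finset.mul_sum]
    rw [add_comm]
    congr 1
    · exact Finset.sum_congr rfl fun k _ => by ring
    · rw [Finset.sum_eq_single j]
      · simp
      · intro k _ hk; simp [hk.symm]
      · simp

theorem hasFDerivAt_expNeg {n : ℕ} (p : Amb n) :
    HasFDerivAt (fun p : Amb n => Complex.exp (-p.1))
      ((Complex.exp (-p.1) • (1 : ℂ →L[ℝ] ℂ)).comp (-ContinuousLinearMap.fst ℝ _ _)) p :=
  (Complex.hasStrictFDerivAt_exp_real (-p.1)).hasFDerivAt.comp p hasFDerivAt_fst.neg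

theorem fderiv_uFun {n : ℕ} (k : Fin n) (p v : Amb n) :
    fderiv ℝ (uFun k) p v = v.2 k * Complex.exp (-p.1) - v.1 * uFun k p := by
  have h1 : HasFDerivAt (fun p : Amb n => (p.2 k : ℂ)) (Complex.ofRealCLM.comp
      ((EuclideanSpace.proj (𝕜 := ℝ) k).comp
        (ContinuousLinearMap.snd ℝ ℂ (EuclideanSpace ℝ (Fin n))))) p :=
    Complex.ofRealCLM.hasFDerivAt.comp p
      ((EuclideanSpace.proj (𝕜 := ℝ) k).hasFDerivAt.comp p hasFDerivAt_snd)
  have h := h1.mul (hasFDerivAt_expNeg p)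
  have h' : fderiv ℝ (uFun k) p = _ := h.fderiv
  rw [h']
  simp [uFun]
  ring

theorem fderiv_tFun_rotField {n : ℕ} (a b : Idx n) (p : Amb n) :
    fderiv ℝ tFun p (rotField a b p) = -2 * (rotField a b p).1 * tFun p := by
  have hd : DifferentiableAt ℝ (ysq (n := n)) p := by
    have : ContDiff ℝ ∞ (ysq (n := n)) := by
      unfold ysq
      exact ContDiff.sum fun a _ => contDiff_const.mul ((coord_contDiff a).pow 2)
    exact this.differentiable (by simp) p
  have h1 : HasFDerivAt (fun p : Amb n => (ysq p : ℂ)) (Complex.ofRealCLM.comp (fderiv ℝ ysq p)) p :=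
    Complex.ofRealCLM.hasFDerivAt.comp p hd.hasFDerivAt
  have h := h1.mul ((hasFDerivAt_expNeg p).pow 2)
  have h' : fderiv ℝ tFun p = _ := h.fderiv
  rw [h']
  simp [tFun, fderiv_ysq_rotField]
  ring

theorem fderiv_xPow {n : ℕ} (s : ℂ) (p : Amb n) (v : Amb n) :
    fderiv ℝ (xPow s) p v = s * v.1 * xPow s p := by
  have h : HasFDerivAt (xPow (n := n) s) ((Complex.exp (s * logX p) • (1 : ℂ →L[ℝ] ℂ)).comp
      (s • ContinuousLinearMap.fst ℝ _ _)) p :=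
    (Complex.hasStrictFDerivAt_exp_real (s * logX p)).hasFDerivAt.comp p
      ((hasFDerivAt_fst.add_const _).const_mul s)
  rw [h.fderiv]
  simp [xPow]
  ring

/-- Let (ζ, v) be the rotation field at p = (z, 𝐲). It kills y², so along it x₁^wt, t and u_k have
derivatives wt ζ x₁^wt, -2ζ t and v_k e^{-z} - ζ u_k. Collecting the terms in ζ gives wt - 2m minus
the Euler derivation. -/
theorem lie_M_mono {n : ℕ} (a b : Idx n) (m : ℕ) (q : UPoly n) (p : cov n) :
    ⁅M a b, mono m q⁆ p = (rotField a b p.1).1 * mono m ((wt n - 2 * m) • q - euler q) p +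
      ∑ k, ((rotField a b p.1).2 k * Complex.exp (-p.1.1)) * mono m (pderiv k q) p := by
  have hx := ((xPow_contDiff (n := n) (wt n)).differentiable (by simp) p.1).hasFDerivAt
  have ht := ((tFun_contDiff (n := n)).differentiable (by simp) p.1).hasFDerivAt
  have h : HasFDerivAt (monoFun m q) _ p.1 := (hx.mul (ht.pow m)).mul (hasFDerivAt_aeval q p.1)
  have hl : ⁅M a b, mono m q⁆ p = _ := lie_M_of a b (monoFun_contDiff m q).contDiffOn p h
  have hE : ∀ c : ℂ, mono m (c • q - euler q) p = xPow (wt n) p.1 * tFun p.1 ^ m *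
      (c * aeval (fun k => uFun k p.1) q -
        ∑ k, uFun k p.1 * (aeval fun k => uFun k p.1) (pderiv k q)) := by
    intro c
    simp only [mono_apply, monoFun, map_sub (aeval _), map_smul (aeval _), euler_apply,
      map_sum (aeval _), map_mul, aeval_X, smul_eq_mul]
  rw [hl, hE]
  simp only [mono_apply, monoFun, add_apply, smul_apply,
    sum_apply, smul_eq_mul, fderiv_xPow, fderiv_tFun_rotField, fderiv_uFun,
    Pi.mul_apply, nsmul_eq_mul]
  have hm : (m : ℂ) * tFun p.1 ^ (m - 1) * (-2 * (rotField a b p.1).1 * tFun p.1) =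
      -2 * m * (rotField a b p.1).1 * tFun p.1 ^ m := by
    rcases m with _ | m
    · simp
    · simp only [Nat.add_sub_cancel, pow_succ]; ring
  have hs : ∑ k, (aeval fun k => uFun k p.1) (pderiv k q) *
      ((rotField a b p.1).2 k * Complex.exp (-p.1.1) - (rotField a b p.1).1 * uFun k p.1) =
      ∑ k, ((rotField a b p.1).2 k * Complex.exp (-p.1.1)) * (aeval fun k => uFun k p.1) (pderiv k q) -
      (rotField a b p.1).1 * ∑ k, uFun k p.1 * (aeval fun k => uFun k p.1) (pderiv k q) := by
    rw [Finset.mul_sum, ← Finset.sum_sub_distrib]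
    exact Finset.sum_congr rfl fun k _ => by ring
  have hs2 : ∑ k, ((rotField a b p.1).2 k * Complex.exp (-p.1.1)) *
      (xPow (wt n) p.1 * tFun p.1 ^ m * (aeval fun k => uFun k p.1) (pderiv k q)) =
      xPow (wt n) p.1 * tFun p.1 ^ m * ∑ k, ((rotField a b p.1).2 k * Complex.exp (-p.1.1)) *
        (aeval fun k => uFun k p.1) (pderiv k q) := by
    rw [Finset.mul_sum]
    exact Finset.sum_congr rfl fun k _ => by ring
  rw [hs, hs2]
  linear_combination (xPow (wt n) p.1 * (aeval fun k => uFun k p.1) q) * hm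

theorem Smooth.sum_apply {n : ℕ} {ι : Type*} (s : Finset ι) (g : ι → Smooth n) (p : cov n) :
    (∑ a ∈ s, g a) p = ∑ a ∈ s, g a p :=
  map_sum (⟨⟨fun h : Smooth n => h p, rfl⟩, fun _ _ => rfl⟩ : Smooth n →+ ℂ) g s

theorem exp_mul_exp_neg (z : ℂ) : Complex.exp z * Complex.exp (-z) = 1 := by
  rw [← Complex.exp_add]; simp

/-- Both sides are w̄/w for w = exp z, because y² plus the squared norm of the spatial part is |w|².
This identity keeps the lowering operators polynomial in u and t, and identifies φ₁. -/
theorem tFun_add_usq {n : ℕ} (p : Amb n) : tFun p + aeval (fun k => uFun k p) (usq : UPoly n) =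
    ((coord (Sum.inl 0) p : ℂ) - Complex.I * coord (Sum.inl 1) p) * Complex.exp (-p.1) := by
  have h1 : (coord (Sum.inl 0) p : ℂ) + Complex.I * coord (Sum.inl 1) p = Complex.exp p.1 := by
    rw [mul_comm]; exact Complex.re_add_im _
  have h2 : (ysq p : ℂ) = (coord (Sum.inl 0) p : ℂ) ^ 2 + (coord (Sum.inl 1) p : ℂ) ^ 2 -
      ∑ k, (p.2 k : ℂ) ^ 2 := by
    simp [ysq, eta, coord, Fintype.sum_sum_type, sub_eq_add_neg]
  have h3 : aeval (fun k => uFun k p) (usq : UPoly n) =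
      (∑ k, (p.2 k : ℂ) ^ 2) * Complex.exp (-p.1) ^ 2 := by
    simp only [usq, map_sum, map_pow, aeval_X, uFun, mul_pow, Finset.sum_mul]
  have h4 := exp_mul_exp_neg p.1
  rw [← h1] at h4
  rw [h3, tFun, h2]
  linear_combination (((coord (Sum.inl 0) p : ℂ) - Complex.I * coord (Sum.inl 1) p) *
    Complex.exp (-p.1)) * h4 - ((coord (Sum.inl 1) p : ℂ) ^ 2 * Complex.exp (-p.1) ^ 2) *
      (-Complex.I_sq)

theorem mono_mul_X {n : ℕ} (m : ℕ) (k : Fin n) (q : UPoly n) (p : cov n) :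
    mono m (X k * q) p = uFun k p.1 * mono m q p := by
  simp only [mono_apply, monoFun, map_mul, aeval_X]; ring

theorem mono_succ_add {n : ℕ} (m : ℕ) (q : UPoly n) (p : cov n) :
    mono (m + 1) q p + mono m (usq * q) p = ((coord (Sum.inl 0) p.1 : ℂ) -
      Complex.I * coord (Sum.inl 1) p.1) * Complex.exp (-p.1.1) * mono m q p := by
  rw [← tFun_add_usq]
  simp only [mono_apply, monoFun, map_mul]; ring

theorem lie_boost_zero {n : ℕ} (k : Fin n) (m : ℕ) (q : UPoly n) (p : cov n) :
    ⁅(M (Sum.inl 0) (Sum.inr k) : 𝔤 n), mono m q⁆ p =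
      uFun k p.1 * mono m ((wt n - 2 * m) • q - euler q) p +
      (coord (Sum.inl 0) p.1 * Complex.exp (-p.1.1)) * mono m (pderiv k q) p := by
  rw [lie_M_mono]
  congr 1
  · simp [rotField, frame, eta, coord, uFun]
  · rw [Finset.sum_eq_single k]
    · simp [rotField, frame, eta]
    · intro j _ hj; simp [rotField, frame, hj]
    · simp

theorem lie_boost_one {n : ℕ} (k : Fin n) (m : ℕ) (q : UPoly n) (p : cov n) :
    ⁅(M (Sum.inl 1) (Sum.inr k) : 𝔤 n), mono m q⁆ p =
      Complex.I * uFun k p.1 * mono m ((wt n - 2 * m) • q - euler q) p +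
      (coord (Sum.inl 1) p.1 * Complex.exp (-p.1.1)) * mono m (pderiv k q) p := by
  rw [lie_M_mono]
  congr 1
  · have : (rotField (Sum.inl 1) (Sum.inr k) p.1).1 = Complex.I * uFun k p.1 := by
      simp [rotField, frame, eta, coord, uFun]; ring
    rw [this]
  · rw [Finset.sum_eq_single k]
    · simp [rotField, frame, eta]
    · intro j _ hj; simp [rotField, frame, hj]
    · simp

/-- The two boosts carry the Euler terms u_k and i u_k, which cancel as u_k + i·i u_k = 0, while the
coefficient of ∂_k becomes (y^{-1} + i y^0)e^{-z} = 1. -/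
theorem lie_raise {n : ℕ} (k : Fin n) (F : UTPoly n) :
    ⁅(M (Sum.inl 0) (Sum.inr k) : 𝔤 n), realize F⁆ +
      Complex.I • ⁅(M (Sum.inl 1) (Sum.inr k) : 𝔤 n), realize F⁆ = realize (raise k F) := by
  refine utPoly_ext (f := (LieModule.toEnd ℂ (𝔤 n) (Smooth n) (M (Sum.inl 0) (Sum.inr k)) +
    Complex.I • LieModule.toEnd ℂ (𝔤 n) (Smooth n) (M (Sum.inl 1) (Sum.inr k))) ∘ₗ realize)
    (g := realize ∘ₗ raise k) (fun m q => ?_) F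
  refine Smooth.hext fun p => ?_
  change (⁅(M (Sum.inl 0) (Sum.inr k) : 𝔤 n), realize (Finsupp.single m q)⁆ +
    Complex.I • ⁅(M (Sum.inl 1) (Sum.inr k) : 𝔤 n), realize (Finsupp.single m q)⁆) p =
      realize (raise k (Finsupp.single m q)) p
  rw [raise_single, realize_single, realize_single, Smooth.add_apply, Smooth.smul_apply,
    lie_boost_zero, lie_boost_one]
  have h1 : (coord (Sum.inl 0) p.1 : ℂ) + Complex.I * coord (Sum.inl 1) p.1 =
      Complex.exp p.1.1 := by
    rw [mul_comm]; exact Complex.re_add_im _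
  have h4 := exp_mul_exp_neg p.1.1
  rw [← h1] at h4
  linear_combination mono m (pderiv k q) p * h4 +
    (uFun k p.1 * mono m ((wt n - 2 * m) • q - euler q) p) * Complex.I_sq

/-- With the opposite sign the Euler terms add up to 2u_k, and the coefficient of ∂_k is w̄/w = t +
u² by `tFun_add_usq`. -/
theorem lie_lower {n : ℕ} (k : Fin n) (F : UTPoly n) :
    ⁅(M (Sum.inl 0) (Sum.inr k) : 𝔤 n), realize F⁆ -
      Complex.I • ⁅(M (Sum.inl 1) (Sum.inr k) : 𝔤 n), realize F⁆ = realize (lower k F) := by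
  refine utPoly_ext (f := (LieModule.toEnd ℂ (𝔤 n) (Smooth n) (M (Sum.inl 0) (Sum.inr k)) -
    Complex.I • LieModule.toEnd ℂ (𝔤 n) (Smooth n) (M (Sum.inl 1) (Sum.inr k))) ∘ₗ realize)
    (g := realize ∘ₗ lower k) (fun m q => ?_) F
  refine Smooth.hext fun p => ?_
  change (⁅(M (Sum.inl 0) (Sum.inr k) : 𝔤 n), realize (Finsupp.single m q)⁆ -
    Complex.I • ⁅(M (Sum.inl 1) (Sum.inr k) : 𝔤 n), realize (Finsupp.single m q)⁆) p =
      realize (lower k (Finsupp.single m q)) p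
  have e : conf (wt n - 2 * m) k q =
      usq * pderiv k q + (2 : ℂ) • (X k * ((wt n - 2 * m) • q - euler q)) := by
    rw [conf_apply, smul_eq_C_mul (X k * _), map_ofNat, mul_assoc]
  rw [lower_single, map_add, realize_single, realize_single, realize_single, sub_eq_add_neg, e,
    map_add, map_smul, Smooth.add_apply, Smooth.add_apply, Smooth.add_apply, Smooth.neg_apply,
    Smooth.smul_apply, Smooth.smul_apply, lie_boost_zero, lie_boost_one, ← add_assoc, mono_succ_add,
    mono_mul_X]
  linear_combination -(uFun k p.1 * mono m ((wt n - 2 * m) • q - euler q) p) * Complex.I_sq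

theorem lie_boost_zero_realize {n : ℕ} (k : Fin n) (F : UTPoly n) :
    ⁅(M (Sum.inl 0) (Sum.inr k) : 𝔤 n), realize F⁆ =
      realize ((1 / 2 : ℂ) • (raise k F + lower k F)) := by
  rw [map_smul, map_add, ← lie_raise, ← lie_lower]
  module

theorem lie_boost_one_realize {n : ℕ} (k : Fin n) (F : UTPoly n) :
    ⁅(M (Sum.inl 1) (Sum.inr k) : 𝔤 n), realize F⁆ =
      realize ((-(Complex.I / 2) : ℂ) • (raise k F - lower k F)) := by
  rw [map_smul, map_sub, ← lie_raise, ← lie_lower]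
  have : ∀ a b : Smooth n, a + Complex.I • b - (a - Complex.I • b) = (2 * Complex.I) • b := by
    intro a b; module
  rw [this, smul_smul, show -(Complex.I / 2) * (2 * Complex.I) = 1 by
    linear_combination -Complex.I_sq, one_smul]

/-- The operator `wt - ∑ u_j ∂/∂u_j - 2 t ∂/∂t`. -/
def energy {n : ℕ} : UTPoly n →ₗ[ℂ] UTPoly n :=
  Finsupp.lsum ℂ fun m => Finsupp.lsingle m ∘ₗ ((wt n - 2 * m) • LinearMap.id - euler.toLinearMap)

/-- The operator `u_j ∂/∂u_k - u_k ∂/∂u_j`. -/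
def angular {n : ℕ} (j k : Fin n) : UTPoly n →ₗ[ℂ] UTPoly n :=
  Finsupp.lsum ℂ fun m => Finsupp.lsingle m ∘ₗ
    (LinearMap.mulLeft ℂ (X j) ∘ₗ (pderiv k).toLinearMap -
      LinearMap.mulLeft ℂ (X k) ∘ₗ (pderiv j).toLinearMap)

theorem energy_single {n : ℕ} (m : ℕ) (q : UPoly n) : energy (Finsupp.single m q) =
    Finsupp.single m ((wt n - 2 * m) • q - euler q) := by
  simp [energy]

theorem angular_single {n : ℕ} (j k : Fin n) (m : ℕ) (q : UPoly n) :
    angular j k (Finsupp.single m q) = Finsupp.single m (X j * pderiv k q - X k * pderiv j q) := by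
  simp [angular]

theorem two_smul_energy {n : ℕ} (k : Fin n) (F : UTPoly n) :
    (2 : ℂ) • energy F = raise k (lower k F) - lower k (raise k F) := by
  refine utPoly_ext (f := (2 : ℂ) • energy) (g := raise k ∘ₗ lower k - lower k ∘ₗ raise k)
    (fun m q => ?_) F
  change (2 : ℂ) • energy (Finsupp.single m q) = raise k (lower k (Finsupp.single m q)) -
    lower k (raise k (Finsupp.single m q))
  rw [raise_lower, energy_single, Finsupp.smul_single, smul_eq_C_mul, if_pos rfl, sub_self, mul_zero,
    zero_add, map_ofNat]

theorem two_smul_angular {n : ℕ} {j k : Fin n} (h : j ≠ k) (F : UTPoly n) :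
    (2 : ℂ) • angular j k F = raise j (lower k F) - lower k (raise j F) := by
  refine utPoly_ext (f := (2 : ℂ) • angular j k) (g := raise j ∘ₗ lower k - lower k ∘ₗ raise j)
    (fun m q => ?_) F
  change (2 : ℂ) • angular j k (Finsupp.single m q) = raise j (lower k (Finsupp.single m q)) -
    lower k (raise j (Finsupp.single m q))
  rw [raise_lower, angular_single, Finsupp.smul_single, smul_eq_C_mul, if_neg h, add_zero, map_ofNat]

theorem lie_energy {n : ℕ} (F : UTPoly n) :
    ⁅(M (Sum.inl 0) (Sum.inl 1) : 𝔤 n), realize F⁆ = Complex.I • realize (energy F) := by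
  refine utPoly_ext (f := LieModule.toEnd ℂ (𝔤 n) (Smooth n) (M (Sum.inl 0) (Sum.inl 1)) ∘ₗ realize)
    (g := Complex.I • (realize ∘ₗ energy)) (fun m q => ?_) F
  refine Smooth.hext fun p => ?_
  change ⁅(M (Sum.inl 0) (Sum.inl 1) : 𝔤 n), realize (Finsupp.single m q)⁆ p =
    (Complex.I • realize (energy (Finsupp.single m q))) p
  rw [energy_single, realize_single, realize_single, Smooth.smul_apply, lie_M_mono]
  have h1 : (coord (Sum.inl 0) p.1 : ℂ) + Complex.I * coord (Sum.inl 1) p.1 =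
      Complex.exp p.1.1 := by
    rw [mul_comm]; exact Complex.re_add_im _
  have h4 := exp_mul_exp_neg p.1.1
  rw [← h1] at h4
  have h5 : (rotField (Sum.inl 0) (Sum.inl 1) p.1).1 = Complex.I := by
    simp only [rotField, frame, eta, Sum.elim_inl, one_mul, Prod.fst_sub, Prod.smul_fst,
      Complex.real_smul]
    linear_combination Complex.I * h4 - (coord (Sum.inl 1) p.1 * Complex.exp (-p.1.1)) * Complex.I_sq
  rw [h5]
  simp [rotField, frame]

theorem lie_angular {n : ℕ} (j k : Fin n) (F : UTPoly n) :
    ⁅(M (Sum.inr j) (Sum.inr k) : 𝔤 n), realize F⁆ = -realize (angular j k F) := by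
  refine utPoly_ext (f := LieModule.toEnd ℂ (𝔤 n) (Smooth n) (M (Sum.inr j) (Sum.inr k)) ∘ₗ realize)
    (g := -(realize ∘ₗ angular j k)) (fun m q => ?_) F
  refine Smooth.hext fun p => ?_
  change ⁅(M (Sum.inr j) (Sum.inr k) : 𝔤 n), realize (Finsupp.single m q)⁆ p =
    (-realize (angular j k (Finsupp.single m q))) p
  rw [angular_single, realize_single, realize_single, Smooth.neg_apply, lie_M_mono,
    map_sub (mono m) (X j * _), sub_eq_add_neg (mono m (X j * _)), Smooth.add_apply, Smooth.neg_apply, mono_mul_X, mono_mul_X]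
  have h5 : (rotField (Sum.inr j) (Sum.inr k) p.1).1 = 0 := by simp [rotField, frame]
  have h6 : ∀ i, ((rotField (Sum.inr j) (Sum.inr k) p.1).2 i : ℂ) =
      (if i = j then (p.1.2 k : ℂ) else 0) - if i = k then (p.1.2 j : ℂ) else 0 := by
    intro i
    simp only [rotField, frame, eta, coord, PiLp.single_apply, Sum.elim_inr, Prod.snd_sub,
      Prod.smul_snd, PiLp.sub_apply, PiLp.smul_apply, smul_eq_mul]
    split_ifs <;> push_cast <;> ring
  rw [h5]
  simp only [h6, sub_mul, ite_mul, zero_mul, Finset.sum_sub_distrib, Finset.sum_ite_eq',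
    Finset.mem_univ, if_true, uFun]
  ring

/-! ### Generators of the Lie algebra -/

/-- The sum runs over ordered pairs, so each basis element occurs twice; skew-adjointness of A makes
the two contributions equal, whence the factor 1/2. -/
theorem eq_sum_M {n : ℕ} (A : 𝔤 n) :
    A = ∑ a, ∑ b, ((1 / 2 : ℂ) * (A.1 a b * eta b)) • M a b := by
  have hA := (mem_so' A.1).1 A.2
  have he : ∀ a : Idx n, (eta a : ℂ) * eta a = 1 := by
    rintro (i | j) <;> simp [eta]
  refine Subtype.ext (Matrix.ext fun c d => ?_)
  have hco : ((∑ a, ∑ b, ((1 / 2 : ℂ) * (A.1 a b * eta b)) • M a b : 𝔤 n) : Matrix (Idx n) (Idx n) ℂ) =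
      ∑ a, ∑ b, ((1 / 2 : ℂ) * (A.1 a b * eta b)) •
        (Matrix.single a b (eta b : ℂ) - Matrix.single b a (eta a : ℂ)) := by
    push_cast
    rfl
  rw [hco]
  simp only [Matrix.sum_apply, Matrix.smul_apply, Matrix.sub_apply, Matrix.single_apply, smul_eq_mul,
    mul_sub, Finset.sum_sub_distrib, mul_ite, mul_zero]
  have e1 : ∑ x, ∑ y, (if x = c ∧ y = d then (1 / 2 : ℂ) * (A.1 x y * eta y) * eta y else 0) =
      (1 / 2 : ℂ) * (A.1 c d * eta d) * eta d := by
    rw [Finset.sum_eq_single c, Finset.sum_eq_single d] <;> simp +contextual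
  have e2 : ∑ x, ∑ y, (if y = c ∧ x = d then (1 / 2 : ℂ) * (A.1 x y * eta y) * eta x else 0) =
      (1 / 2 : ℂ) * (A.1 d c * eta c) * eta d := by
    rw [Finset.sum_eq_single d, Finset.sum_eq_single c] <;> simp +contextual
  rw [e1, e2]
  have h1 := hA c d
  have h2 := he c
  have h3 := he d
  linear_combination (1 / 2 : ℂ) * eta c * h1 - (1 / 2 : ℂ) * A.1 c d * h2 - (1 / 2 : ℂ) * A.1 c d * h3

theorem M_self {n : ℕ} (a : Idx n) : (M a a : 𝔤 n) = 0 := Subtype.ext (sub_self _)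

theorem M_swap {n : ℕ} (a b : Idx n) : (M b a : 𝔤 n) = -M a b :=
  Subtype.ext (neg_sub _ _).symm

section

variable {n : ℕ} {V : Type*} [AddCommGroup V] [Module ℂ V] [LieRingModule (𝔤 n) V]
  [LieModule ℂ (𝔤 n) V]

theorem compact_lie_mem {N : Submodule ℂ V}
    (he : ∀ v ∈ N, ⁅(M (Sum.inl 0) (Sum.inl 1) : 𝔤 n), v⁆ ∈ N)
    (hr : ∀ j k, ∀ v ∈ N, ⁅(M (Sum.inr j) (Sum.inr k) : 𝔤 n), v⁆ ∈ N)
    {A : 𝔤 n} (hA : IsCompactElt A) {v : V} (hv : v ∈ N) : ⁅A, v⁆ ∈ N := by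
  rw [eq_sum_M A, sum_lie]
  refine N.sum_mem fun a _ => ?_
  rw [sum_lie]
  refine N.sum_mem fun b _ => ?_
  rw [smul_lie]
  have hee : ∀ i j : Fin 2, ⁅(M (Sum.inl i) (Sum.inl j) : 𝔤 n), v⁆ ∈ N := by
    intro i j
    fin_cases i <;> fin_cases j
    · simp [M_self]
    · exact he v hv
    · change ⁅(M (Sum.inl 1) (Sum.inl 0) : 𝔤 n), v⁆ ∈ N
      rw [M_swap, neg_lie]; exact N.neg_mem (he v hv)
    · simp [M_self]
  rcases a with i | j <;> rcases b with i' | j'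
  · exact N.smul_mem _ (hee i i')
  · rw [(hA i j').1]; simp
  · rw [(hA i' j).2]; simp
  · exact N.smul_mem _ (hr j j' v hv)

theorem lie_mem_of_M {N : Submodule ℂ V}
    (he : ∀ v ∈ N, ⁅(M (Sum.inl 0) (Sum.inl 1) : 𝔤 n), v⁆ ∈ N)
    (hr : ∀ j k, ∀ v ∈ N, ⁅(M (Sum.inr j) (Sum.inr k) : 𝔤 n), v⁆ ∈ N)
    (hb : ∀ i k, ∀ v ∈ N, ⁅(M (Sum.inl i) (Sum.inr k) : 𝔤 n), v⁆ ∈ N)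
    (A : 𝔤 n) {v : V} (hv : v ∈ N) : ⁅A, v⁆ ∈ N := by
  have hM : ∀ a b, ⁅(M a b : 𝔤 n), v⁆ ∈ N := by
    have hc : ∀ a b : Idx n, (a.isLeft = b.isLeft) → IsCompactElt (M a b : 𝔤 n) := by
      intro a b hab i j
      rcases a with a | a <;> rcases b with b | b <;> simp_all [M]
    intro a b
    rcases a with i | j <;> rcases b with i' | j'
    · exact compact_lie_mem he hr (hc (Sum.inl i) (Sum.inl i') rfl) hv
    · exact hb i j' v hv
    · rw [M_swap, neg_lie]; exact N.neg_mem (hb i' j v hv)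
    · exact hr j j' v hv
  rw [eq_sum_M A, sum_lie]
  refine N.sum_mem fun a _ => ?_
  rw [sum_lie]
  exact N.sum_mem fun b _ => by rw [smul_lie]; exact N.smul_mem _ (hM a b)

end

/-- Twice the energy is the commutator of `raise k` and `lower k` for any one k; the bound on n only
supplies such an index. -/
theorem energy_mem {n : ℕ} (hn : 3 ≤ n) {N : Submodule ℂ (UTPoly n)} (hN : IsStable N)
    {F : UTPoly n} (hF : F ∈ N) : energy F ∈ N := by
  let k : Fin n := ⟨0, by omega⟩
  refine (Submodule.smul_mem_iff N (two_ne_zero (α := ℂ))).1 ?_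
  rw [two_smul_energy k]
  exact N.sub_mem (hN k _ (hN k F hF).2).1 (hN k _ (hN k F hF).1).2

theorem angular_mem {n : ℕ} {N : Submodule ℂ (UTPoly n)} (hN : IsStable N) (j k : Fin n)
    {F : UTPoly n} (hF : F ∈ N) : angular j k F ∈ N := by
  by_cases h : j = k
  · subst h
    have : angular j j F = 0 := by
      refine utPoly_ext (f := angular j j) (g := 0) (fun m q => ?_) F
      simp [angular_single]
    rw [this]; exact N.zero_mem
  · refine (Submodule.smul_mem_iff N (two_ne_zero (α := ℂ))).1 ?_
    rw [two_smul_angular h]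
    exact N.sub_mem (hN j _ (hN k F hF).2).1 (hN k _ (hN j F hF).1).2

/-- The functions attached to the polynomials in a stable subspace. -/
def realizeSub {n : ℕ} (hn : 3 ≤ n) (N : Submodule ℂ (UTPoly n)) (hN : IsStable N) :
    LieSubmodule ℂ (𝔤 n) (Smooth n) where
  __ := N.map realize
  lie_mem {A f} hf := by
    refine lie_mem_of_M (N := N.map realize) ?_ ?_ ?_ A hf
    · rintro _ ⟨F, hF, rfl⟩
      rw [lie_energy, ← map_smul]
      exact ⟨_, N.smul_mem _ (energy_mem hn hN hF), rfl⟩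
    · rintro j k _ ⟨F, hF, rfl⟩
      rw [lie_angular, ← map_neg]
      exact ⟨_, N.neg_mem (angular_mem hN j k hF), rfl⟩
    · rintro i k _ ⟨F, hF, rfl⟩
      fin_cases i
      · change ⁅(M (Sum.inl 0) (Sum.inr k) : 𝔤 n), realize F⁆ ∈ _
        rw [lie_boost_zero_realize]
        exact ⟨_, N.smul_mem _ (N.add_mem (hN k F hF).1 (hN k F hF).2), rfl⟩
      · change ⁅(M (Sum.inl 1) (Sum.inr k) : 𝔤 n), realize F⁆ ∈ _
        rw [lie_boost_one_realize]
        exact ⟨_, N.smul_mem _ (N.sub_mem (hN k F hF).1 (hN k F hF).2), rfl⟩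

theorem mem_realizeSub {n : ℕ} (hn : 3 ≤ n) {N : Submodule ℂ (UTPoly n)} (hN : IsStable N)
    {f : Smooth n} : f ∈ realizeSub hn N hN ↔ ∃ F ∈ N, realize F = f := Iff.rfl

theorem isStable_comap_realize {n : ℕ} (W : LieSubmodule ℂ (𝔤 n) (Smooth n)) :
    IsStable (W.toSubmodule.comap realize) := fun k F hF => by
  have hF' : realize F ∈ W := hF
  constructor
  · change realize (raise k F) ∈ W
    rw [← lie_raise]
    exact W.add_mem (W.lie_mem hF') (W.smul_mem _ (W.lie_mem hF'))
  · change realize (lower k F) ∈ W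
    rw [← lie_lower]
    exact W.sub_mem (W.lie_mem hF') (W.smul_mem _ (W.lie_mem hF'))

/-- The bridge from functions to polynomials: a stable space of polynomials realizes to a Lie
submodule, and conversely the preimage of a Lie submodule is stable, because raising and lowering
operators come from the complexified algebra. -/
theorem lieSpan_realize {n : ℕ} (hn : 3 ≤ n) (F : UTPoly n) :
    LieSubmodule.lieSpan ℂ (𝔤 n) {realize F} = realizeSub hn (gen F) (gen_isStable F) := by
  refine le_antisymm (LieSubmodule.lieSpan_le.2 ?_) ?_
  · rintro _ rfl
    exact ⟨F, mem_gen_self F, rfl⟩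
  · rintro _ ⟨G, hG, rfl⟩
    have h : realize F ∈ LieSubmodule.lieSpan ℂ (𝔤 n) {realize F} :=
      LieSubmodule.subset_lieSpan (Set.mem_singleton _)
    exact gen_le (isStable_comap_realize (LieSubmodule.lieSpan ℂ (𝔤 n) {realize F})) h hG

/-- The map from polynomials to functions is injective. -/
theorem realize_injective {n : ℕ} : Function.Injective (realize (n := n)) := by
  rw [← LinearMap.ker_eq_bot, LinearMap.ker_eq_bot']
  intro F hF
  by_contra h0
  have hs : ∀ k, ∀ F ∈ LinearMap.ker (realize (n := n)), raise k F ∈ LinearMap.ker (realize (n := n)) := by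
    intro k F hF
    rw [LinearMap.mem_ker] at hF ⊢
    rw [← lie_raise, hF, lie_zero, lie_zero, smul_zero, add_zero]
  -- The kernel is stable under raising, so a nonzero element of it would yield a nonzero polynomial
  -- in t alone.
  obtain ⟨G, hG, ⟨m, -, hm⟩, hc⟩ := exists_raise_eq_zero hs Set.univ (F := F) hF
    (by simpa [Finsupp.ne_iff] using h0)
  let P : Polynomial ℂ := ∑ m ∈ G.support, Polynomial.monomial m (coeff 0 (G m))
  have hP : ∀ p : cov n, realize G p = xPow (wt n) p.1 * P.eval (tFun p.1) := by
    intro p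
    have : realize G = ∑ m ∈ G.support, mono m (G m) := by simp [realize, Finsupp.sum]
    rw [this, Smooth.sum_apply, Polynomial.eval_finsetSum, Finset.mul_sum]
    refine Finset.sum_congr rfl fun m _ => ?_
    rw [mono_apply, monoFun, hc m trivial]
    simp; ring
  -- At spatial part zero and z = is one has t = e^{-2is}. For s in (0, 1) the exponent stays within
  -- the principal range of the argument, so t takes infinitely many values there.
  have hroot : ∀ s : ℝ, P.eval (Complex.exp (((-2 * s : ℝ) : ℂ) * Complex.I)) = 0 := by
    intro s
    have hmem : (((s : ℂ) * Complex.I, 0) : Amb n) ∈ cov n := by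
      change ‖(0 : EuclideanSpace ℝ (Fin n))‖ ≤ _
      rw [norm_zero]; exact (Real.exp_pos _).le
    have h1 := hP ⟨_, hmem⟩
    rw [LinearMap.mem_ker.1 hG] at h1
    have ht : tFun (((s : ℂ) * Complex.I, 0) : Amb n) =
        Complex.exp (((-2 * s : ℝ) : ℂ) * Complex.I) := by
      rw [tFun, ysq_eq, ← Complex.exp_nat_mul]
      simp [mul_assoc]
    rw [ht] at h1
    exact (mul_eq_zero.1 h1.symm).resolve_left (Complex.exp_ne_zero _)
  have hP0 : P = 0 := by
    refine Polynomial.eq_zero_of_infinite_isRoot P ?_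
    refine Set.Infinite.mono (s := (fun s : ℝ => Complex.exp (((-2 * s : ℝ) : ℂ) * Complex.I)) '' Set.Ioo 0 1)
      ?_ ?_
    · rintro _ ⟨s, -, rfl⟩; exact hroot s
    · refine Set.Infinite.image ?_ (Set.Ioo_infinite one_pos)
      intro s hs t ht hst
      have := congrArg Complex.arg hst
      rw [Complex.arg_exp_mul_I, Complex.arg_exp_mul_I] at this
      have hpi := Real.pi_gt_three
      rw [(toIocMod_eq_self _).2, (toIocMod_eq_self _).2] at this
      · linarith
      · constructor <;> linarith [ht.1, ht.2]
      · constructor <;> linarith [hs.1, hs.2]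
  apply hm
  have hcoef : P.coeff m = coeff 0 (G m) := by
    simp only [P, Polynomial.finsetSum_coeff, Polynomial.coeff_monomial, Finset.sum_ite_eq']
    split_ifs with h
    · rfl
    · exact absurd (Finsupp.notMem_support_iff.1 h) hm
  rw [hc m trivial, ← hcoef, hP0]
  simp

/-! ### Energy levels -/

/-- The polynomials of degree `k`, where `u_j` has degree `1` and `t` has degree `2`. -/
def level (n k : ℕ) : Submodule ℂ (UTPoly n) :=
  ⨆ m : Fin (k / 2 + 1), (homogeneousSubmodule (Fin n) ℂ (k - 2 * m)).map (Finsupp.lsingle m)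

instance (n k : ℕ) : FiniteDimensional ℂ (level n k) := by
  have : ∀ r, FiniteDimensional ℂ (homogeneousSubmodule (Fin n) ℂ r) := fun r =>
    Module.Finite.iff_fg.2 (homogeneousSubmodule_fg (Fin n) ℂ r)
  unfold level
  infer_instance

theorem single_mem_level {n k m r : ℕ} (h : r + 2 * m = k) {q : UPoly n} (hq : q.IsHomogeneous r) :
    Finsupp.single m q ∈ level n k := by
  refine Submodule.mem_iSup_of_mem (⟨m, by omega⟩ : Fin (k / 2 + 1)) ⟨q, ?_, rfl⟩
  change q.IsHomogeneous (k - 2 * m)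
  rwa [show k - 2 * m = r by omega]

theorem level_le {n k : ℕ} {N : Submodule ℂ (UTPoly n)}
    (h : ∀ m r, ∀ q : UPoly n, r + 2 * m = k → q.IsHomogeneous r → Finsupp.single m q ∈ N) :
    level n k ≤ N := by
  refine iSup_le fun m => ?_
  rintro _ ⟨q, hq, rfl⟩
  exact h m _ q (by have := m.2; omega) hq

theorem iSup_level (n : ℕ) : ⨆ k, level n k = ⊤ := by
  refine eq_top_iff.2 fun F _ => ?_
  rw [← F.sum_single]
  refine Submodule.sum_mem _ fun m _ => ?_
  refine mem_of_forall_homogeneous_mem ((⨆ k, level n k).comap (Finsupp.lsingle m))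
    (fun r q hq => ?_) (F m)
  exact Submodule.mem_iSup_of_mem (r + 2 * m) (single_mem_level rfl hq)

theorem exists_level_decomposition {n : ℕ} (F : UTPoly n) :
    ∃ G : ℕ →₀ UTPoly n, (∀ k, G k ∈ level n k) ∧ G.sum (fun _ x => x) = F :=
  (Submodule.mem_iSup_iff_exists_finsupp _ _).1 (iSup_level n ▸ Submodule.mem_top)

theorem energy_of_mem_level {n k : ℕ} {F : UTPoly n} (hF : F ∈ level n k) :
    energy F = (wt n - k) • F := by
  have : level n k ≤ LinearMap.ker (energy - (wt n - k) • LinearMap.id) := by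
    refine level_le fun m r q h hq => ?_
    rw [LinearMap.mem_ker, LinearMap.sub_apply, energy_single, euler_of_isHomogeneous hq,
      LinearMap.smul_apply, LinearMap.id_apply, Finsupp.smul_single, ← sub_smul, sub_eq_zero]
    congr 2
    rw [← h]; push_cast; ring
  have h := this hF
  rwa [LinearMap.mem_ker, LinearMap.sub_apply, sub_eq_zero] at h

theorem angular_mem_level {n k : ℕ} (i j : Fin n) {F : UTPoly n} (hF : F ∈ level n k) :
    angular i j F ∈ level n k := by
  have : level n k ≤ (level n k).comap (angular i j) := by
    refine level_le fun m r q h hq => ?_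
    rw [Submodule.mem_comap, angular_single]
    refine single_mem_level h ?_
    have hX : ∀ a b : Fin n, (X a * pderiv b q).IsHomogeneous r := by
      intro a b
      rcases r with _ | r
      · rw [← totalDegree_zero_iff_isHomogeneous, totalDegree_eq_zero_iff_eq_C] at hq
        rw [hq, pderiv_C, mul_zero]; exact isHomogeneous_zero _ _ _
      · have := (isHomogeneous_X ℂ a).mul (hq.pderiv (i := b))
        rwa [Nat.add_sub_cancel, add_comm] at this
    exact (homogeneousSubmodule (Fin n) ℂ r).sub_mem (hX i j) (hX j i)
  exact this hF

/-! ### Rotations of the time plane -/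

/-- The rotation by the angle `θ` in the plane of `y^{-1}, y^0`, lifted to the covering. -/
def rotPt {n : ℕ} (θ : ℝ) (p : Amb n) : Amb n := (p.1 + θ * Complex.I, p.2)

theorem rotPt_mem {n : ℕ} (θ : ℝ) {p : Amb n} (hp : p ∈ cov n) : rotPt θ p ∈ cov n := by
  have hp' : ‖p.2‖ ≤ Real.exp p.1.re := hp
  change ‖p.2‖ ≤ Real.exp (p.1 + θ * Complex.I).re
  simpa using hp'

theorem ysq_rotPt {n : ℕ} (θ : ℝ) (p : Amb n) : ysq (rotPt θ p) = ysq p := by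
  rw [ysq_eq, ysq_eq]
  simp [rotPt]

/-- The rotation, as a map of the covering. -/
def rotCov {n : ℕ} (θ : ℝ) (p : cov n) : cov n := ⟨rotPt θ p.1, rotPt_mem θ p.2⟩

theorem continuous_rotCov {n : ℕ} : Continuous fun x : ℝ × cov n => rotCov x.1 x.2 := by
  refine Continuous.subtype_mk ?_ _
  unfold rotPt
  fun_prop

theorem rotPt_hasFDerivAt {n : ℕ} (θ : ℝ) (p : Amb n) :
    HasFDerivAt (rotPt θ) (ContinuousLinearMap.id ℝ (Amb n)) p :=
  (hasFDerivAt_id p).add_const ((θ * Complex.I, 0) : Amb n) |>.congr_of_eventuallyEq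
    (Filter.Eventually.of_forall fun q => Prod.ext rfl (add_zero q.2).symm)

theorem rotPt_contDiff {n : ℕ} (θ : ℝ) : ContDiff ℝ ∞ (rotPt (n := n) θ) :=
  (contDiff_fst.add contDiff_const).prodMk contDiff_snd

/-- The action of the rotation on functions. -/
def rot {n : ℕ} (θ : ℝ) : Smooth n →ₗ[ℂ] Smooth n where
  toFun f := Smooth.of (fun p => ext f (rotPt θ p))
    (f.ext_contDiffOn.comp (rotPt_contDiff θ).contDiffOn fun _ hp => rotPt_mem θ hp)
  map_add' f g := Smooth.hext fun p => by
    change ext (f + g) (rotPt θ p) = ext f (rotPt θ p) + ext g (rotPt θ p)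
    have h := fun f : Smooth n => ext_apply f.1 (rotCov θ p)
    exact (h (f + g)).trans (congrArg₂ (· + ·) (h f).symm (h g).symm)
  map_smul' c f := Smooth.hext fun p => by
    change ext (c • f) (rotPt θ p) = c * ext f (rotPt θ p)
    have h := fun f : Smooth n => ext_apply f.1 (rotCov θ p)
    exact (h (c • f)).trans (congrArg (c * ·) (h f).symm)

theorem rot_apply {n : ℕ} (θ : ℝ) (f : Smooth n) (p : cov n) : rot θ f p = f (rotCov θ p) :=
  ext_apply f.1 (rotCov θ p)

theorem pd_rot_apply {n : ℕ} (θ : ℝ) (a : Idx n) (f : Smooth n) (p : cov n) :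
    pd a (rot θ f) p = fderivWithin ℝ (ext f) (cov n) (rotPt θ p.1) (frame a p.1) := by
  have h : HasFDerivWithinAt (fun p => ext f (rotPt θ p))
      ((fderivWithin ℝ (ext f) (cov n) (rotPt θ p.1)).comp (ContinuousLinearMap.id ℝ (Amb n)))
      (cov n) p.1 :=
    (f.differentiableWithinAt (rotCov θ p)).hasFDerivWithinAt.comp p.1
      (rotPt_hasFDerivAt θ p.1).hasFDerivWithinAt fun _ hp => rotPt_mem θ hp
  have h2 : pd a (rot θ f) p = fderivWithin ℝ (fun p => ext f (rotPt θ p)) (cov n) p (frame a p) :=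
    pd_of a _ p
  rw [h2, h.fderivWithin (cov_uniqueDiffOn n p p.2)]
  rfl

/-- The rotation mixes ∂_{-1} and ∂_0 by an orthogonal matrix with constant entries and fixes the
spatial fields. Bounded constant coefficients make derivatives of rotated functions controllable
uniformly in θ. -/
theorem exists_pd_rot {n : ℕ} (θ : ℝ) (a : Idx n) : ∃ c : Idx n → ℂ, (∀ b, ‖c b‖ ≤ 1) ∧
    ∀ f : Smooth n, pd a (rot θ f) = ∑ b, c b • rot θ (pd b f) := by
  have hf : ∀ (f : Smooth n) (p : cov n) (b : Idx n),
      rot θ (pd b f) p = fderivWithin ℝ (ext f) (cov n) (rotPt θ p.1) (frame b (rotPt θ p.1)) :=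
    fun f p b => rot_apply θ (pd b f) p
  have key : ∃ c : Idx n → ℝ, (∀ b, |c b| ≤ 1) ∧
      ∀ p : Amb n, frame a p = ∑ b, c b • frame b (rotPt θ p) := by
    have he : ∀ p : Amb n, Complex.exp (-p.1) =
        (Real.cos θ + Real.sin θ * Complex.I) * Complex.exp (-(rotPt θ p).1) := by
      intro p
      have : Complex.exp (-p.1) = Complex.exp (θ * Complex.I) * Complex.exp (-(rotPt θ p).1) := by
        rw [← Complex.exp_add]; congr 1; simp [rotPt]
      rw [this, Complex.exp_mul_I, Complex.ofReal_cos, Complex.ofReal_sin]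
    match a with
    | Sum.inl 0 =>
      refine ⟨Sum.elim ![Real.cos θ, Real.sin θ] 0, ?_, fun p => ?_⟩
      · rintro (i | j)
        · fin_cases i
          · exact Real.abs_cos_le_one θ
          · exact Real.abs_sin_le_one θ
        · simp
      · simp only [frame, Fintype.sum_sum_type, Fin.sum_univ_two, Sum.elim_inl, Sum.elim_inr,
          Matrix.cons_val_zero, Matrix.cons_val_one, Pi.zero_apply, zero_smul,
          Finset.sum_const_zero, add_zero, he p]
        refine Prod.ext ?_ (by simp)
        simp only [Prod.fst_add, Prod.smul_fst, Complex.real_smul]; ring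
    | Sum.inl 1 =>
      refine ⟨Sum.elim ![-Real.sin θ, Real.cos θ] 0, ?_, fun p => ?_⟩
      · rintro (i | j)
        · fin_cases i
          · simpa using Real.abs_sin_le_one θ
          · exact Real.abs_cos_le_one θ
        · simp
      · simp only [frame, Fintype.sum_sum_type, Fin.sum_univ_two, Sum.elim_inl, Sum.elim_inr,
          Matrix.cons_val_zero, Matrix.cons_val_one, Pi.zero_apply, zero_smul,
          Finset.sum_const_zero, add_zero, he p]
        refine Prod.ext ?_ (by simp)
        simp only [Prod.fst_add, Prod.smul_fst, Complex.real_smul]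
        push_cast
        linear_combination (Complex.sin θ * Complex.exp (-(rotPt θ p).1)) * Complex.I_sq
    | Sum.inr j =>
      refine ⟨Pi.single (Sum.inr j) 1, fun b => ?_, fun p => ?_⟩
      · by_cases h : b = Sum.inr j
        · subst h; simp
        · simp [h]
      · rw [Finset.sum_eq_single (Sum.inr j)]
        · simp [frame]
        · intro b _ hb; simp [hb]
        · simp
  obtain ⟨c, hc, hfr⟩ := key
  refine ⟨fun b => c b, fun b => by simpa using hc b, fun f => Smooth.hext fun p => ?_⟩
  rw [pd_rot_apply, hfr p.1, map_sum, Smooth.sum_apply]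
  refine Finset.sum_congr rfl fun b _ => ?_
  rw [map_smul, Smooth.smul_apply, hf, Complex.real_smul]

theorem aeval_mul_of_isHomogeneous {n r : ℕ} {q : UPoly n} (hq : q.IsHomogeneous r) (c : ℂ)
    (x : Fin n → ℂ) : aeval (fun k => c * x k) q = c ^ r * aeval x q := by
  simp only [aeval_def, eval₂_eq', Finset.mul_sum]
  refine Finset.sum_congr rfl fun α hα => ?_
  have h : ∑ i, α i = r := by
    rw [hq.degree_eq_sum_deg_support hα]
    exact (Finset.sum_subset (Finset.subset_univ _) (by simp)).symm
  rw [← h, ← Finset.prod_pow_eq_pow_sum]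
  simp only [mul_pow, Finset.prod_mul_distrib]
  ring

/-- Replacing w by e^{iθ}w multiplies u by e^{-iθ}, t by e^{-2iθ} and x₁^wt by e^{iθ wt}, so each
t^m q(u) with deg q + 2m = k is an eigenvector. -/
theorem rot_realize {n k : ℕ} (θ : ℝ) {F : UTPoly n} (hF : F ∈ level n k) :
    rot θ (realize F) = Complex.exp (θ * Complex.I * (wt n - k)) • realize F := by
  have : level n k ≤ LinearMap.ker (rot θ ∘ₗ realize -
      Complex.exp (θ * Complex.I * (wt n - k)) • realize) := by
    refine level_le fun m r q h hq => ?_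
    rw [LinearMap.mem_ker, LinearMap.sub_apply, sub_eq_zero, LinearMap.comp_apply,
      LinearMap.smul_apply, realize_single]
    refine Smooth.hext fun p => ?_
    rw [rot_apply, Smooth.smul_apply, mono_apply, mono_apply]
    change monoFun m q (rotPt θ p.1) = _ * monoFun m q p.1
    have hexp : Complex.exp (-(rotPt θ p.1).1) =
        Complex.exp (-(θ * Complex.I)) * Complex.exp (-p.1.1) := by
      rw [← Complex.exp_add]; congr 1; simp [rotPt]
    have hu : ∀ k, uFun k (rotPt θ p.1) = Complex.exp (-(θ * Complex.I)) * uFun k p.1 := by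
      intro k
      rw [uFun, hexp, uFun]
      simp only [rotPt]; ring
    have ht : tFun (rotPt θ p.1) = Complex.exp (-(θ * Complex.I)) ^ 2 * tFun p.1 := by
      rw [tFun, hexp, tFun, ysq_rotPt]; ring
    have hx : xPow (wt n) (rotPt θ p.1) = Complex.exp (θ * Complex.I * wt n) * xPow (wt n) p.1 := by
      rw [xPow, xPow, ← Complex.exp_add]
      congr 1
      simp only [logX, rotPt]; ring
    have ha : aeval (fun k => uFun k (rotPt θ p.1)) q =
        Complex.exp (-(θ * Complex.I)) ^ r * aeval (fun k => uFun k p.1) q := by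
      simp only [hu]
      exact aeval_mul_of_isHomogeneous hq _ _
    rw [monoFun, monoFun, hx, ht, ha]
    have : Complex.exp (θ * Complex.I * (wt n - k)) = Complex.exp (θ * Complex.I * wt n) *
        (Complex.exp (-(θ * Complex.I)) ^ r * (Complex.exp (-(θ * Complex.I)) ^ 2) ^ m) := by
      rw [← pow_mul, ← pow_add, h, ← Complex.exp_nat_mul, ← Complex.exp_add]
      congr 1; ring
    rw [this, mul_pow]
    ring
  have h := this hF
  rwa [LinearMap.mem_ker, LinearMap.sub_apply, sub_eq_zero] at h

/-! ### The topology of uniform convergence of all derivatives -/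

theorem continuous_derivs {n : ℕ} (l : List (Idx n)) : Continuous fun f => toC n (derivs l f) :=
  (continuous_apply l).comp (continuous_induced_dom (f := jets n))

theorem continuous_derivs_apply {n : ℕ} (l : List (Idx n)) (p : cov n) :
    Continuous fun f : Smooth n => derivs l f p :=
  (continuous_eval_const p).comp (continuous_derivs l)

theorem continuous_eval {n : ℕ} (p : cov n) : Continuous fun f : Smooth n => f p :=
  continuous_derivs_apply [] p

theorem Smooth.continuous_coe {n : ℕ} (f : Smooth n) : Continuous fun p : cov n => f p :=
  (toC n f).continuous

instance (n : ℕ) : T2Space (Smooth n) :=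
  T2Space.of_injective_continuous (f := fun f : Smooth n => fun p => f p)
    (fun _ _ h => Smooth.hext fun p => congrFun h p) (continuous_pi continuous_eval)

/-- A function on `C^∞` that bounds a linear map in terms of the topology. -/
structure IsGauge {n : ℕ} (q : Smooth n → ℝ) : Prop where
  continuous : Continuous q
  map_zero : q 0 = 0

theorem exists_isGauge_sup {n : ℕ} (l : List (Idx n)) {K : Set (cov n)} (hK : IsCompact K) :
    ∃ q : Smooth n → ℝ, IsGauge q ∧ ∀ f, ∀ p ∈ K, ‖derivs l f p‖ ≤ q f := by
  have : CompactSpace K := isCompact_iff_compactSpace.1 hK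
  refine ⟨fun f => ‖(toC n (derivs l f)).restrict K‖, ⟨?_, ?_⟩, fun f p hp => ?_⟩
  · exact ((ContinuousMap.continuous_restrict K).comp (continuous_derivs l)).norm
  · have : (toC n (derivs l (0 : Smooth n))).restrict K = 0 := by
      rw [map_zero, map_zero]; rfl
    simp only [this, norm_zero]
  · exact ((toC n (derivs l f)).restrict K).norm_coe_le_norm ⟨p, hp⟩

theorem IsGauge.comp {n : ℕ} {q : Smooth n → ℝ} (hq : IsGauge q) {T : Smooth n →ₗ[ℂ] Smooth n}
    (hT : Continuous T) : IsGauge fun f => q (T f) :=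
  ⟨hq.continuous.comp hT, by rw [_root_.map_zero, hq.map_zero]⟩

theorem IsGauge.sum {n : ℕ} {ι : Type*} (s : Finset ι) {q : ι → Smooth n → ℝ}
    (hq : ∀ i ∈ s, IsGauge (q i)) : IsGauge fun f => ∑ i ∈ s, q i f :=
  ⟨continuous_finsetSum _ fun i hi => (hq i hi).continuous,
    Finset.sum_eq_zero fun i hi => (hq i hi).map_zero⟩

theorem continuous_of_isGauge {n : ℕ} {L : Smooth n →ₗ[ℂ] ℂ} {q : Smooth n → ℝ} (hq : IsGauge q)
    (h : ∀ f, ‖L f‖ ≤ q f) : Continuous L := by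
  refine continuous_of_continuousAt_zero L ?_
  rw [ContinuousAt, map_zero]
  refine squeeze_zero_norm h ?_
  simpa [hq.map_zero] using hq.continuous.tendsto 0

/-- Without derivatives, the points swept out by rotating K through [0, 2π] form a compact set. Each
further derivative is moved past the rotation by `exists_pd_rot`. -/
theorem exists_isGauge_rot {n : ℕ} (l : List (Idx n)) {K : Set (cov n)} (hK : IsCompact K) :
    ∃ q : Smooth n → ℝ, IsGauge q ∧ ∀ θ ∈ Set.Icc 0 (2 * Real.pi), ∀ f, ∀ p ∈ K,
      ‖derivs l (rot θ f) p‖ ≤ q f := by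
  induction l with
  | nil =>
    have hK' : IsCompact ((fun x : ℝ × cov n => rotCov x.1 x.2) '' Set.Icc 0 (2 * Real.pi) ×ˢ K) :=
      (isCompact_Icc.prod hK).image continuous_rotCov
    obtain ⟨q, hq, h⟩ := exists_isGauge_sup [] hK'
    refine ⟨q, hq, fun θ hθ f p hp => ?_⟩
    have := h f (rotCov θ p) ⟨(θ, p), ⟨hθ, hp⟩, rfl⟩
    change ‖rot θ f p‖ ≤ q f
    rw [rot_apply]
    exact this
  | cons a l ih =>
    obtain ⟨q, hq, h⟩ := ih
    refine ⟨fun f => ∑ b, q (pd b f), IsGauge.sum _ fun b _ => hq.comp (continuous_pd b), ?_⟩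
    intro θ hθ f p hp
    obtain ⟨c, hc, hpd⟩ := exists_pd_rot θ a
    change ‖derivs l (pd a (rot θ f)) p‖ ≤ _
    rw [hpd, map_sum, Smooth.sum_apply]
    refine (norm_sum_le _ _).trans (Finset.sum_le_sum fun b _ => ?_)
    rw [map_smul, Smooth.smul_apply, norm_mul]
    exact (mul_le_of_le_one_left (norm_nonneg _) (hc b)).trans (h θ hθ _ p hp)

/-- A neighbourhood of zero in `C^∞` contains all functions with finitely many derivatives that are
small on a compact set. -/
theorem exists_forall_derivs_lt {n : ℕ} {U : Set (Smooth n)} (hU : U ∈ 𝓝 (0 : Smooth n)) :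
    ∃ (s : Finset (List (Idx n))) (K : Set (cov n)) (ε : ℝ), IsCompact K ∧ 0 < ε ∧
      ∀ f : Smooth n, (∀ l ∈ s, ∀ p ∈ K, ‖derivs l f p‖ < ε) → f ∈ U := by
  rw [nhds_induced, Filter.mem_comap, map_zero] at hU
  obtain ⟨V, hV, hVU⟩ := hU
  rw [nhds_pi, Filter.mem_pi] at hV
  obtain ⟨I, hI, t, ht, htV⟩ := hV
  have hl : ∀ l, ∃ (K : Set (cov n)) (ε : ℝ), IsCompact K ∧ 0 < ε ∧
      ∀ g : C(cov n, ℂ), (∀ p ∈ K, ‖g p‖ < ε) → g ∈ t l := by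
    intro l
    obtain ⟨⟨K, ε⟩, ⟨hK, hε⟩, h⟩ := (nhds_basis_uniformity'
      (Metric.uniformity_basis_dist.compactConvergenceUniformity (α := cov n) (β := ℂ))).mem_iff.1 (ht l)
    exact ⟨K, ε, hK, hε, fun g hg => h fun p hp => by simpa using hg p hp⟩
  choose K ε hK hε h using hl
  lift I to Finset (List (Idx n)) using hI
  have hI' : (insert [] I).Nonempty := Finset.insert_nonempty _ _
  refine ⟨insert [] I, ⋃ l ∈ insert [] I, K l, (insert [] I).inf' hI' ε,
    (insert [] I).isCompact_biUnion fun l _ => hK l, (Finset.lt_inf'_iff _).2 fun l _ => hε l, ?_⟩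
  intro f hf
  refine hVU (htV fun l hl => h l _ fun p hp => ?_)
  have hls : l ∈ insert [] I := Finset.mem_insert_of_mem hl
  exact (hf l hls p (Set.mem_biUnion hls hp)).trans_le (Finset.inf'_le _ hls)

/-! ### Fourier coefficients -/

theorem wt_sub_eq_ofReal (n k : ℕ) : wt n - k = ((-((n - 2) / 2) - k : ℝ) : ℂ) := by
  rw [wt]; push_cast; ring

theorem norm_exp_neg_level (n k : ℕ) (θ : ℝ) : ‖Complex.exp (-(θ * Complex.I * (wt n - k)))‖ = 1 := by
  rw [wt_sub_eq_ofReal, show -((θ : ℂ) * Complex.I * ((-((n - 2) / 2) - k : ℝ) : ℂ)) =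
    ((-θ * (-((n - 2) / 2) - k) : ℝ) : ℂ) * Complex.I by push_cast; ring, Complex.norm_exp_ofReal_mul_I]

/-- Rotation by 2π need not act trivially on the covering, since wt may be half-integral; but only
the integer k - j enters here, so orthogonality over [0, 2π] holds as usual. -/
theorem integral_exp_level (n j k : ℕ) :
    ∫ θ : ℝ in (0)..(2 * Real.pi), Complex.exp (-(θ * Complex.I * (wt n - k))) *
      Complex.exp (θ * Complex.I * (wt n - j)) = if j = k then (2 * Real.pi : ℂ) else 0 := by
  have h : ∀ θ : ℝ, Complex.exp (-(θ * Complex.I * (wt n - k))) *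
      Complex.exp (θ * Complex.I * (wt n - j)) =
      Complex.exp ((((k - j : ℤ) : ℂ) * Complex.I) * θ) := by
    intro θ
    rw [← Complex.exp_add]; congr 1; push_cast; ring
  simp only [h]
  split_ifs with hjk
  · subst hjk; simp
  · have hc : (((k - j : ℤ) : ℂ) * Complex.I) ≠ 0 := by
      refine mul_ne_zero ?_ Complex.I_ne_zero
      rw [Int.cast_ne_zero]; omega
    rw [integral_exp_mul_complex hc]
    have e : (((k - j : ℤ) : ℂ) * Complex.I) * ((2 * Real.pi : ℝ) : ℂ) =
        ((k - j : ℤ) : ℂ) * (2 * Real.pi * Complex.I) := by push_cast; ring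
    rw [e, Complex.exp_int_mul_two_pi_mul_I]
    simp

theorem norm_fourier_le {n : ℕ} (k : ℕ) {g : ℝ → ℂ} {c : ℝ}
    (h : ∀ θ ∈ Set.Icc 0 (2 * Real.pi), ‖g θ‖ ≤ c) :
    ‖(2 * Real.pi : ℂ)⁻¹ * ∫ θ : ℝ in (0)..(2 * Real.pi),
      Complex.exp (-(θ * Complex.I * (wt n - k))) * g θ‖ ≤ c := by
  have h1 := intervalIntegral.norm_integral_le_of_norm_le_const (a := 0) (b := 2 * Real.pi)
    (f := fun θ : ℝ => Complex.exp (-(θ * Complex.I * (wt n - k))) * g θ) (C := c) (by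
      intro θ hθ
      rw [Set.uIoc_of_le Real.two_pi_pos.le] at hθ
      rw [norm_mul, norm_exp_neg_level, one_mul]
      exact h θ ⟨hθ.1.le, hθ.2⟩)
  rw [sub_zero, abs_of_pos Real.two_pi_pos] at h1
  have h2 : ‖(2 * Real.pi : ℂ)⁻¹‖ = (2 * Real.pi)⁻¹ := by
    rw [norm_inv, norm_mul, Complex.norm_ofNat, Complex.norm_real, Real.norm_of_nonneg Real.pi_pos.le]
  rw [norm_mul, h2, inv_mul_le_iff₀ Real.two_pi_pos, mul_comm (2 * Real.pi)]
  exact h1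

/-- The Fourier coefficient of energy `wt - k` of a function, at the point `p`. -/
def fourierLin {n : ℕ} (k : ℕ) (p : cov n) : Smooth n →ₗ[ℂ] ℂ where
  toFun f := (2 * Real.pi : ℂ)⁻¹ * ∫ θ : ℝ in (0)..(2 * Real.pi),
    Complex.exp (-(θ * Complex.I * (wt n - k))) * rot θ f p
  map_add' f g := by
    have hc : ∀ f : Smooth n, IntervalIntegrable (fun θ : ℝ =>
        Complex.exp (-(θ * Complex.I * (wt n - k))) * rot θ f p) MeasureTheory.volume 0 (2 * Real.pi) := by
      intro f
      simp only [rot_apply]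
      exact (Continuous.mul (by fun_prop) (f.continuous_coe.comp
        (continuous_rotCov.comp (Continuous.prodMk continuous_id continuous_const)))).intervalIntegrable _ _
    simp only [map_add, Smooth.add_apply, mul_add]
    rw [intervalIntegral.integral_add (hc f) (hc g), mul_add]
  map_smul' c f := by
    simp only [map_smul, Smooth.smul_apply, RingHom.id_apply, smul_eq_mul]
    rw [mul_left_comm c, ← intervalIntegral.integral_const_mul c]
    congr 2
    funext θ; ring

theorem continuous_fourierLin {n : ℕ} (k : ℕ) (p : cov n) : Continuous (fourierLin k p) := by
  obtain ⟨q, hq, h⟩ := exists_isGauge_rot [] (isCompact_singleton (x := p))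
  exact continuous_of_isGauge hq fun f => norm_fourier_le k fun θ hθ => h θ hθ f p rfl

/-- The Fourier coefficient, as a continuous linear form. -/
def fourierAt {n : ℕ} (k : ℕ) (p : cov n) : Smooth n →L[ℂ] ℂ :=
  ⟨fourierLin k p, continuous_fourierLin k p⟩

theorem fourierAt_apply {n : ℕ} (k : ℕ) (p : cov n) (f : Smooth n) : fourierAt k p f =
    (2 * Real.pi : ℂ)⁻¹ * ∫ θ : ℝ in (0)..(2 * Real.pi),
      Complex.exp (-(θ * Complex.I * (wt n - k))) * rot θ f p := rfl

theorem fourier_level {n j : ℕ} (k : ℕ) (L : Smooth n →ₗ[ℂ] ℂ) {F : UTPoly n} (hF : F ∈ level n j) :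
    (2 * Real.pi : ℂ)⁻¹ * ∫ θ : ℝ in (0)..(2 * Real.pi),
      Complex.exp (-(θ * Complex.I * (wt n - k))) * L (rot θ (realize F)) =
    if j = k then L (realize F) else 0 := by
  simp only [rot_realize _ hF, map_smul, smul_eq_mul, ← mul_assoc]
  rw [intervalIntegral.integral_mul_const, integral_exp_level]
  have : (2 * Real.pi : ℂ) ≠ 0 := by exact_mod_cast Real.two_pi_pos.ne'
  split_ifs
  · rw [inv_mul_cancel_left₀ this]
  · simp

theorem level_ext {n : ℕ} {V : Type*} [AddCommGroup V] [Module ℂ V] {f g : UTPoly n →ₗ[ℂ] V}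
    (h : ∀ k, ∀ F ∈ level n k, f F = g F) (F : UTPoly n) : f F = g F := by
  have : (⨆ k, level n k) ≤ LinearMap.eqLocus f g := iSup_le fun k F hF => h k F hF
  exact this (iSup_level n ▸ Submodule.mem_top)

instance (X : Type*) : SeparatingDual ℂ (X → ℂ) :=
  ⟨fun x hx => by
    obtain ⟨p, hp⟩ := Function.ne_iff.1 hx
    exact ⟨ContinuousLinearMap.proj p, hp⟩⟩

/-- Linear coordinates on the finite-dimensional image of the level extend to continuous functionals
on all functions with pointwise convergence; these are applied to the pointwise Fourier coefficient.
The values then lie in the level for every f by construction, and continuity is automatic. Agreement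
with the Fourier coefficient is only asserted on `hull n` (`levelProj_apply`). -/
theorem exists_levelProj (n k : ℕ) : ∃ P : Smooth n →L[ℂ] Smooth n,
    (∀ f, P f ∈ (level n k).map realize) ∧
      ∀ j, ∀ F ∈ level n j, P (realize F) = if j = k then realize F else 0 := by
  let W : Submodule ℂ (Smooth n) := (level n k).map realize
  have hW : FiniteDimensional ℂ W := inferInstance
  let ev : W →ₗ[ℂ] (cov n → ℂ) := (smoothSubmodule n).subtype ∘ₗ W.subtype
  have hev : Function.Injective ev := Subtype.val_injective.comp Subtype.val_injective
  let b := Module.finBasis ℂ W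
  have hl : ∀ i, ∃ L : StrongDual ℂ (cov n → ℂ), ∀ x, L (ev x) = b.coord i x := by
    intro i
    obtain ⟨L, hL⟩ := SeparatingDual.dualMap_surjective_iff.2 hev (b.coord i)
    exact ⟨L, fun x => LinearMap.congr_fun hL x⟩
  choose L hL using hl
  let Φ : Smooth n →L[ℂ] (cov n → ℂ) := ContinuousLinearMap.pi fun p => fourierAt k p
  have hΦ : ∀ j, ∀ F ∈ level n j, Φ (realize F) = if j = k then fun p => realize F p else 0 := by
    intro j F hF
    funext p
    have := fourier_level k ((LinearMap.proj p).comp (smoothSubmodule n).subtype) hF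
    change fourierAt k p (realize F) = _
    refine (this : fourierAt k p (realize F) = _).trans ?_
    split_ifs <;> rfl
  refine ⟨∑ i, ((L i).comp Φ).smulRight (b i : Smooth n), fun f => ?_, fun j F hF => ?_⟩
  · rw [sum_apply]
    exact Submodule.sum_mem _ fun i _ => Submodule.smul_mem _ _ (b i).2
  · rw [sum_apply]
    simp only [ContinuousLinearMap.smulRight_apply, ContinuousLinearMap.comp_apply, hΦ j F hF]
    split_ifs with hjk
    · subst hjk
      have h1 : (fun p => realize F p) = ev ⟨realize F, F, hF, rfl⟩ := rfl
      have h2 := congrArg (fun x : W => (x : Smooth n)) (b.sum_repr ⟨realize F, F, hF, rfl⟩)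
      simp only [h1, hL, Module.Basis.coord_apply]
      exact (map_sum W.subtype _ _).symm.trans h2
    · simp

/-- The projection of `C^∞` to the functions of energy `wt - k`. -/
def levelProj (n k : ℕ) : Smooth n →L[ℂ] Smooth n := (exists_levelProj n k).choose

theorem levelProj_mem {n : ℕ} (k : ℕ) (f : Smooth n) :
    levelProj n k f ∈ (level n k).map realize := (exists_levelProj n k).choose_spec.1 f

theorem levelProj_realize {n j : ℕ} (k : ℕ) {F : UTPoly n} (hF : F ∈ level n j) :
    levelProj n k (realize F) = if j = k then realize F else 0 :=
  (exists_levelProj n k).choose_spec.2 j F hF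

theorem levelProj_levelProj {n : ℕ} (j k : ℕ) (f : Smooth n) :
    levelProj n k (levelProj n j f) = if j = k then levelProj n j f else 0 := by
  obtain ⟨F, hF, h⟩ := levelProj_mem j f
  rw [← h, levelProj_realize k hF]

/-- The closure of the space of functions that are attached to polynomials. -/
def hull (n : ℕ) : Submodule ℂ (Smooth n) := (LinearMap.range realize).topologicalClosure

theorem realize_mem_hull {n : ℕ} (F : UTPoly n) : realize F ∈ hull n :=
  Submodule.le_topologicalClosure _ ⟨F, rfl⟩

theorem eq_of_mem_hull {n : ℕ} {Y : Type*} [TopologicalSpace Y] [T2Space Y] {S T : Smooth n → Y}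
    (hS : Continuous S) (hT : Continuous T) (h : ∀ F, S (realize F) = T (realize F))
    {f : Smooth n} (hf : f ∈ hull n) : S f = T f :=
  Set.EqOn.closure (s := Set.range realize) (by rintro _ ⟨F, rfl⟩; exact h F) hS hT hf

theorem levelProj_apply {n : ℕ} (k : ℕ) {f : Smooth n} (hf : f ∈ hull n) (p : cov n) :
    levelProj n k f p = fourierAt k p f := by
  refine eq_of_mem_hull ((continuous_eval p).comp (levelProj n k).continuous)
    (fourierAt k p).continuous (fun F => ?_) hf
  let L : Smooth n →ₗ[ℂ] ℂ := (LinearMap.proj p).comp (smoothSubmodule n).subtype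
  refine level_ext (f := L ∘ₗ (levelProj n k).toLinearMap ∘ₗ realize)
    (g := (fourierAt k p).toLinearMap ∘ₗ realize) (fun j F hF => ?_) F
  have h1 : fourierAt k p (realize F) = _ := fourier_level k L hF
  change L (levelProj n k (realize F)) = fourierAt k p (realize F)
  rw [h1, levelProj_realize k hF]
  split_ifs
  · rfl
  · exact map_zero L

/-- The energy operator `-i M_{-1,0}`. -/
def ham (n : ℕ) : Smooth n →ₗ[ℂ] Smooth n :=
  (-Complex.I) • LieModule.toEnd ℂ (𝔤 n) (Smooth n) (M (Sum.inl 0) (Sum.inl 1))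

theorem ham_apply {n : ℕ} (f : Smooth n) :
    ham n f = -Complex.I • ⁅(M (Sum.inl 0) (Sum.inl 1) : 𝔤 n), f⁆ := rfl

theorem continuous_ham (n : ℕ) : Continuous (ham n) :=
  (continuous_lie (M (Sum.inl 0) (Sum.inl 1))).const_smul (-Complex.I)

theorem ham_realize {n : ℕ} (F : UTPoly n) : ham n (realize F) = realize (energy F) := by
  rw [ham_apply, lie_energy, smul_smul]
  simp

theorem ham_mem_hull {n : ℕ} {f : Smooth n} (hf : f ∈ hull n) : ham n f ∈ hull n :=
  map_mem_closure (continuous_ham n) hf (by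
    rintro _ ⟨F, rfl⟩
    exact ⟨energy F, (ham_realize F).symm⟩)

theorem levelProj_ham {n : ℕ} (k : ℕ) {f : Smooth n} (hf : f ∈ hull n) :
    levelProj n k (ham n f) = (wt n - k) • levelProj n k f := by
  refine eq_of_mem_hull ((levelProj n k).continuous.comp (continuous_ham n))
    ((levelProj n k).continuous.const_smul (wt n - k)) (fun F => ?_) hf
  refine level_ext (f := (levelProj n k).toLinearMap ∘ₗ ham n ∘ₗ realize)
    (g := (wt n - k : ℂ) • ((levelProj n k).toLinearMap ∘ₗ realize)) (fun j F hF => ?_) F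
  change levelProj n k (ham n (realize F)) = (wt n - k : ℂ) • levelProj n k (realize F)
  rw [ham_realize, energy_of_mem_level hF, map_smul, map_smul, levelProj_realize k hF]
  split_ifs with h
  · rw [h]
  · simp

/-! ### Convergence of the expansion in energy levels -/

/-- A component is an average of rotated functions against a unimodular factor, so the bound of
`exists_isGauge_rot` serves for all k at once. -/
theorem exists_isGauge_levelProj {n : ℕ} (l : List (Idx n)) {K : Set (cov n)} (hK : IsCompact K) :
    ∃ q : Smooth n → ℝ, IsGauge q ∧ ∀ k, ∀ f ∈ hull n, ∀ p ∈ K,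
      ‖derivs l (levelProj n k f) p‖ ≤ q f := by
  obtain ⟨q, hq, h⟩ := exists_isGauge_rot l hK
  refine ⟨q, hq, fun k f hf p hp => ?_⟩
  -- The inequality is a closed condition, so it need only be checked on polynomial functions. Their
  -- expansion is finite, and no differentiation under the integral is needed.
  have hc : IsClosed {f : Smooth n | ‖derivs l (levelProj n k f) p‖ ≤ q f} :=
    isClosed_le ((continuous_derivs_apply l p).comp (levelProj n k).continuous).norm hq.continuous
  refine closure_minimal (s := Set.range realize) ?_ hc hf
  rintro _ ⟨F, rfl⟩
  let L : Smooth n →ₗ[ℂ] ℂ := (LinearMap.proj p).comp (smoothSubmodule n).subtype ∘ₗ derivs l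
  obtain ⟨G, hG, rfl⟩ := exists_level_decomposition F
  have hL : L (levelProj n k (realize (G.sum fun _ x => x))) =
      (2 * Real.pi : ℂ)⁻¹ * ∫ θ : ℝ in (0)..(2 * Real.pi),
        Complex.exp (-(θ * Complex.I * (wt n - k))) *
          L (rot θ (realize (G.sum fun _ x => x))) := by
    simp only [Finsupp.sum, map_sum, Finset.mul_sum]
    rw [intervalIntegral.integral_finsetSum, Finset.mul_sum]
    · refine Finset.sum_congr rfl fun j _ => ?_
      rw [fourier_level k L (hG j), levelProj_realize k (hG j)]
      split_ifs
      · rfl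
      · exact map_zero L
    · intro j _
      simp only [rot_realize _ (hG j), map_smul, smul_eq_mul]
      exact Continuous.intervalIntegrable (by fun_prop) _ _
  change ‖L (levelProj n k (realize (G.sum fun _ x => x)))‖ ≤ _
  rw [hL]
  exact norm_fourier_le k fun θ hθ => h θ hθ _ p hp

theorem sum_inv_sq_le : ∃ c : ℝ, ∀ N : ℕ, ∑ k ∈ Finset.range N, 1 / ((k : ℝ) + 1) ^ 2 ≤ c := by
  have hs : Summable fun k : ℕ => 1 / ((k : ℝ) + 1) ^ 2 := by
    have := (summable_nat_add_iff 1).2 (Real.summable_one_div_nat_pow.2 (one_lt_two))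
    simpa using this
  exact ⟨_, fun N => hs.sum_le_tsum _ fun _ _ => by positivity⟩

theorem le_norm_wt_sub {n : ℕ} (hn : 3 ≤ n) (k : ℕ) : ((k : ℝ) + 1) / 2 ≤ ‖wt n - k‖ := by
  rw [wt_sub_eq_ofReal, Complex.norm_real, Real.norm_eq_abs]
  have h3 : (3 : ℝ) ≤ n := by exact_mod_cast hn
  have hk : (0 : ℝ) ≤ k := k.cast_nonneg
  rw [abs_of_nonpos (by linarith)]
  linarith

/-- Two applications of the energy operator multiply the k-th component by (wt - k)², of modulus at
least ((k+1)/2)². Applying the previous bound to the resulting function gives a summable majorant,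
hence a bound on the partial sums independent of N. -/
theorem exists_isGauge_sum_levelProj {n : ℕ} (hn : 3 ≤ n) (l : List (Idx n)) {K : Set (cov n)}
    (hK : IsCompact K) : ∃ q : Smooth n → ℝ, IsGauge q ∧ ∀ N : ℕ, ∀ f ∈ hull n, ∀ p ∈ K,
      ‖derivs l (∑ k ∈ Finset.range N, levelProj n k f) p‖ ≤ q f := by
  obtain ⟨q, hq, h⟩ := exists_isGauge_levelProj l hK
  obtain ⟨c, hc⟩ := sum_inv_sq_le
  refine ⟨fun f => c * (4 * q (ham n (ham n f))), ⟨?_, ?_⟩, fun N f hf p hp => ?_⟩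
  · exact continuous_const.mul (continuous_const.mul
      (hq.continuous.comp ((continuous_ham n).comp (continuous_ham n))))
  · simp only [map_zero, hq.map_zero, mul_zero]
  · rw [map_sum, Smooth.sum_apply]
    have hq0 : 0 ≤ q (ham n (ham n f)) :=
      (norm_nonneg _).trans (h 0 _ (ham_mem_hull (ham_mem_hull hf)) p hp)
    have hk : ∀ k, ‖derivs l (levelProj n k f) p‖ ≤
        1 / ((k : ℝ) + 1) ^ 2 * (4 * q (ham n (ham n f))) := by
      intro k
      have h1 := h k _ (ham_mem_hull (ham_mem_hull hf)) p hp
      rw [levelProj_ham k (ham_mem_hull hf), levelProj_ham k hf, map_smul, map_smul,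
        Smooth.smul_apply, Smooth.smul_apply, norm_mul, norm_mul] at h1
      have h2 := le_norm_wt_sub hn k
      have h3 : (0 : ℝ) < (k : ℝ) + 1 := by positivity
      have h4 : (((k : ℝ) + 1) / 2) ^ 2 * ‖derivs l (levelProj n k f) p‖ ≤
          q (ham n (ham n f)) := by
        refine le_trans ?_ h1
        rw [← mul_assoc, ← sq]
        gcongr
      rw [div_mul_eq_mul_div, one_mul, le_div_iff₀ (by positivity)]
      nlinarith
    calc ‖∑ k ∈ Finset.range N, derivs l (levelProj n k f) p‖
        ≤ ∑ k ∈ Finset.range N, 1 / ((k : ℝ) + 1) ^ 2 * (4 * q (ham n (ham n f))) :=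
          (norm_sum_le _ _).trans (Finset.sum_le_sum fun k _ => hk k)
      _ = (∑ k ∈ Finset.range N, 1 / ((k : ℝ) + 1) ^ 2) * (4 * q (ham n (ham n f))) :=
          (Finset.sum_mul _ _ _).symm
      _ ≤ c * (4 * q (ham n (ham n f))) :=
          mul_le_mul_of_nonneg_right (hc N) (by positivity)

theorem exists_sum_levelProj_eq {n : ℕ} (F : UTPoly n) :
    ∃ N, ∑ k ∈ Finset.range N, levelProj n k (realize F) = realize F := by
  obtain ⟨G, hG, rfl⟩ := exists_level_decomposition F
  obtain ⟨N, hN⟩ := G.support.exists_nat_subset_range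
  refine ⟨N, ?_⟩
  simp only [Finsupp.sum, map_sum]
  rw [Finset.sum_comm]
  refine Finset.sum_congr rfl fun j hj => ?_
  simp only [levelProj_realize _ (hG j), Finset.sum_ite_eq, hN hj, if_true]

/-- A function in the closure of the polynomial functions belongs to a closed subspace as soon as
all its components do. -/
theorem mem_of_levelProj_mem {n : ℕ} (hn : 3 ≤ n) {f : Smooth n} (hf : f ∈ hull n)
    {N : Submodule ℂ (Smooth n)} (hN : IsClosed (N : Set (Smooth n)))
    (h : ∀ k, levelProj n k f ∈ N) : f ∈ N := by
  rw [← SetLike.mem_coe, ← hN.closure_eq, mem_closure_iff_nhds]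
  intro V hV
  have hV' : (fun g => f - g) ⁻¹' V ∈ 𝓝 (0 : Smooth n) := by
    refine ContinuousAt.preimage_mem_nhds (continuous_const.sub continuous_id).continuousAt ?_
    simpa using hV
  obtain ⟨s, K, ε, hK, hε, hU⟩ := exists_forall_derivs_lt hV'
  have hq1 : ∀ l : List (Idx n), ∃ q : Smooth n → ℝ, IsGauge q ∧ ∀ f, ∀ p ∈ K, ‖derivs l f p‖ ≤ q f :=
    fun l => exists_isGauge_sup l hK
  have hq2 := fun l => exists_isGauge_sum_levelProj hn l hK
  choose q1 hq1 h1 using hq1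
  choose q2 hq2 h2 using hq2
  -- A polynomial function is chosen so close to f that both the difference and all partial sums of
  -- its expansion are small. The expansion of a polynomial function is finite, so a partial sum of
  -- f then approximates f.
  have hW : {g : Smooth n | ∀ l ∈ s, q1 l (f - g) + q2 l (f - g) < ε} ∈ 𝓝 f := by
    have : {g : Smooth n | ∀ l ∈ s, q1 l (f - g) + q2 l (f - g) < ε} =
        ⋂ l ∈ s, {g | q1 l (f - g) + q2 l (f - g) < ε} := by ext; simp
    rw [this, Filter.biInter_finset_mem]
    intro l _
    refine IsOpen.mem_nhds (isOpen_lt ?_ continuous_const) ?_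
    · exact (((hq1 l).continuous.add (hq2 l).continuous).comp (continuous_const.sub continuous_id))
    · simpa [(hq1 l).map_zero, (hq2 l).map_zero] using hε
  obtain ⟨_, hg, ⟨F, rfl⟩⟩ := mem_closure_iff_nhds.1 hf _ hW
  obtain ⟨m, hm⟩ := exists_sum_levelProj_eq F
  set S := ∑ k ∈ Finset.range m, levelProj n k f with hS
  refine ⟨S, ?_, N.sum_mem fun k _ => h k⟩
  have hmem : f - S ∈ (fun g => f - g) ⁻¹' V := by
    refine hU _ fun l hl p hp => lt_of_le_of_lt ?_ (hg l hl)
    have e : f - S = (f - realize F) - ∑ k ∈ Finset.range m, levelProj n k (f - realize F) := by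
      simp only [map_sub, Finset.sum_sub_distrib, hm, ← hS]; abel
    rw [e, map_sub, sub_eq_add_neg, Smooth.add_apply, Smooth.neg_apply]
    refine (norm_add_le _ _).trans (add_le_add (h1 l _ p hp) ?_)
    rw [norm_neg]
    exact h2 l m _ ((hull n).sub_mem hf (realize_mem_hull F)) p hp
  simpa using hmem

/-! ### Invariant subspaces and their components -/

/-- Applying T - c_a to the sum removes the a-th eigenvector and multiplies the others by nonzero
scalars; induction on the number of terms finishes. -/
theorem mem_of_sum_eigenvectors {V : Type*} [AddCommGroup V] [Module ℂ V] (T : V →ₗ[ℂ] V)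
    (N : Submodule ℂ V) (hN : ∀ v ∈ N, T v ∈ N) {c : ℕ → ℂ} (hc : Function.Injective c)
    (s : Finset ℕ) : ∀ v : ℕ → V, (∀ k ∈ s, T (v k) = c k • v k) → ∑ k ∈ s, v k ∈ N →
      ∀ k ∈ s, v k ∈ N := by
  induction s using Finset.induction_on with
  | empty => intro v _ _ k hk; simp at hk
  | insert a s ha ih =>
    intro v hv hsum
    have hs : ∀ k ∈ s, v k ∈ N := by
      intro k hk
      have h1 : ∑ k ∈ s, (c k - c a) • v k ∈ N := by
        have h2 := N.sub_mem (hN _ hsum) (N.smul_mem (c a) hsum)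
        rw [map_sum, Finset.smul_sum, ← Finset.sum_sub_distrib, Finset.sum_insert ha,
          hv a (Finset.mem_insert_self _ _), sub_self, zero_add] at h2
        convert h2 using 1
        exact Finset.sum_congr rfl fun k hk => by
          rw [hv k (Finset.mem_insert_of_mem hk), sub_smul]
      have h3 := ih (fun k => (c k - c a) • v k) (fun k hk => by
        rw [map_smul, hv k (Finset.mem_insert_of_mem hk), smul_comm]) h1 k hk
      refine (N.smul_mem_iff ?_).1 h3
      rw [sub_ne_zero]
      exact fun h => ha (hc h ▸ hk)
    intro k hk
    rcases Finset.mem_insert.1 hk with rfl | hk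
    · rw [Finset.sum_insert ha] at hsum
      exact (N.add_mem_iff_left (N.sum_mem hs)).1 hsum
    · exact hs k hk

theorem wt_sub_injective (n : ℕ) : Function.Injective fun k : ℕ => wt n - (k : ℂ) := fun j k h => by
  simpa using h

/-- Submodules consisting of polynomial functions contain the components of their elements. -/
theorem levelProj_mem_of_realize {n : ℕ} (W : LieSubmodule ℂ (𝔤 n) (Smooth n)) {F : UTPoly n}
    (hF : realize F ∈ W) (k : ℕ) : levelProj n k (realize F) ∈ W := by
  obtain ⟨N, hN⟩ := exists_sum_levelProj_eq F
  have hW : ∀ v ∈ W.toSubmodule, ham n v ∈ W.toSubmodule := fun v hv =>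
    W.smul_mem _ (W.lie_mem hv)
  have hham : ∀ k, ham n (levelProj n k (realize F)) = (wt n - k) • levelProj n k (realize F) := by
    intro k
    obtain ⟨G, hG, h⟩ := levelProj_mem k (realize F)
    rw [← h, ham_realize, energy_of_mem_level hG, map_smul]
  have key := fun s => mem_of_sum_eigenvectors (ham n) W.toSubmodule hW (wt_sub_injective n) s
    (fun k => levelProj n k (realize F)) (fun k _ => hham k)
  by_cases hk : k < N
  · exact key (Finset.range N) (by rw [hN]; exact hF) k (Finset.mem_range.2 hk)
  · have : levelProj n k (realize F) = 0 := by
      rw [← hN, map_sum]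
      refine Finset.sum_eq_zero fun j hj => ?_
      rw [levelProj_levelProj, if_neg]
      rintro rfl
      exact hk (Finset.mem_range.1 hj)
    rw [this]; exact W.zero_mem

theorem mem_closedSpan_self {n : ℕ} (φ : Smooth n) : φ ∈ closedSpan φ :=
  Submodule.le_topologicalClosure _ (LieSubmodule.subset_lieSpan (Set.mem_singleton φ))

theorem isClosed_closedSpan {n : ℕ} (φ : Smooth n) : IsClosed (closedSpan φ : Set (Smooth n)) :=
  Submodule.isClosed_topologicalClosure _

theorem lieSpan_le_closedSpan {n : ℕ} (φ : Smooth n) :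
    LieSubmodule.lieSpan ℂ (𝔤 n) {φ} ≤ closedSpan φ := fun _ h =>
  Submodule.le_topologicalClosure _ h

theorem closedSpan_le {n : ℕ} {φ : Smooth n} {N : LieSubmodule ℂ (𝔤 n) (Smooth n)}
    (hN : IsClosed (N : Set (Smooth n))) (h : φ ∈ N) : closedSpan φ ≤ N := fun _ hf =>
  closure_minimal (show ((LieSubmodule.lieSpan ℂ (𝔤 n) {φ} : Set (Smooth n))) ⊆ N from
    LieSubmodule.lieSpan_le.2 (Set.singleton_subset_iff.2 h)) hN hf

theorem closedSpan_le_hull {n : ℕ} (hn : 3 ≤ n) (F : UTPoly n) {f : Smooth n}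
    (hf : f ∈ closedSpan (realize F)) : f ∈ hull n := by
  refine closure_mono ?_ hf
  rw [lieSpan_realize hn]
  rintro _ ⟨G, -, rfl⟩
  exact ⟨G, rfl⟩

/-- The components of an element of the closure lie in the algebraic module. -/
theorem levelProj_mem_lieSpan {n : ℕ} (hn : 3 ≤ n) (F : UTPoly n) (k : ℕ) {f : Smooth n}
    (hf : f ∈ closedSpan (realize F)) :
    levelProj n k f ∈ LieSubmodule.lieSpan ℂ (𝔤 n) {realize F} := by
  set A := LieSubmodule.lieSpan ℂ (𝔤 n) {realize F} with hA
  -- The part of the algebraic module in one level is finite dimensional, hence already closed; the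
  -- continuous projection carries the closure into it.
  let W : Submodule ℂ (Smooth n) := A.toSubmodule ⊓ (level n k).map realize
  have : FiniteDimensional ℂ ((level n k).map realize) := inferInstance
  have hWf : FiniteDimensional ℂ W := Submodule.finiteDimensional_of_le (inf_le_right)
  have hWc : IsClosed (W : Set (Smooth n)) := W.closed_of_finiteDimensional
  have h1 : levelProj n k f ∈ closure (W : Set (Smooth n)) := by
    refine map_mem_closure (levelProj n k).continuous hf fun g hg => ?_
    refine ⟨?_, levelProj_mem k g⟩
    have hg' := hg
    rw [SetLike.mem_coe, lieSpan_realize hn] at hg'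
    obtain ⟨G, -, rfl⟩ := hg'
    exact levelProj_mem_of_realize A hg k
  rw [hWc.closure_eq] at h1
  exact h1.1

/-! ### The generating functions and the Casimir operator -/

theorem xPow_add {n : ℕ} (s r : ℂ) (p : Amb n) : xPow (s + r) p = xPow s p * xPow r p := by
  rw [xPow, xPow, xPow, add_mul, Complex.exp_add]

theorem xPow_neg_one {n : ℕ} (p : Amb n) :
    xPow (-1) p = (Complex.I / (√2 : ℝ))⁻¹ * Complex.exp (-p.1) := by
  have h0 : Complex.I / ((√2 : ℝ) : ℂ) ≠ 0 := by simp
  rw [xPow, logX, neg_one_mul, neg_add, Complex.exp_add, Complex.exp_neg (Complex.log _),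
    Complex.exp_log h0, mul_comm]

theorem φ₂_eq (n : ℕ) : φ₂ n = realize (onePoly n) := by
  refine Smooth.hext fun p => ?_
  rw [onePoly, realize_single, mono_apply, monoFun, map_one, pow_zero, mul_one, mul_one]
  rfl

/-- The exponent splits as wt - 2, and x₁^{-2} = (i/√2)^{-2} w^{-2} = -2 w^{-2}. -/
theorem φ₃_eq (n : ℕ) : φ₃ n = (-2 : ℂ) • realize (tPoly n) := by
  refine Smooth.hext fun p => ?_
  rw [tPoly, realize_single, Smooth.smul_apply, mono_apply, monoFun, map_one, pow_one, mul_one]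
  change (ysq p.1 : ℂ) * xPow (-((n + 2) / 2)) p.1 = _
  have h : (Complex.I / ((√2 : ℝ) : ℂ)) ^ 2 = -(1 / 2) := by
    rw [div_pow, Complex.I_sq, ← Complex.ofReal_pow, Real.sq_sqrt (by norm_num)]
    norm_num
  have h' : ((Complex.I / ((√2 : ℝ) : ℂ))⁻¹) ^ 2 = -2 := by rw [inv_pow, h]; norm_num
  rw [show (-((n + 2) / 2) : ℂ) = wt n + -1 + -1 by rw [wt]; ring, xPow_add, xPow_add, xPow_neg_one,
    tFun, ← h']
  ring

/-- The exponent splits as wt - 1, and x₋₁/x₁ = w̄/w is t + u² by `tFun_add_usq`. -/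
theorem φ₁_eq (n : ℕ) : φ₁ n = realize (vPoly n) := by
  refine Smooth.hext fun p => ?_
  have h0 : Complex.I / ((√2 : ℝ) : ℂ) ≠ 0 := by simp
  rw [vPoly, map_add, realize_single, realize_single, Smooth.add_apply, mono_apply, mono_apply,
    monoFun, monoFun, map_one, pow_one, mul_one, pow_zero, mul_one, ← mul_add, tFun_add_usq]
  change xNeg p.1 * xPow (-(n / 2)) p.1 = _
  rw [show (-(n / 2) : ℂ) = wt n + -1 by rw [wt]; ring, xPow_add, xPow_neg_one, xNeg]
  field_simp

theorem lieSpan_smul {n : ℕ} {c : ℂ} (hc : c ≠ 0) (f : Smooth n) :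
    LieSubmodule.lieSpan ℂ (𝔤 n) {c • f} = LieSubmodule.lieSpan ℂ (𝔤 n) {f} := by
  refine le_antisymm (LieSubmodule.lieSpan_le.2 (Set.singleton_subset_iff.2 ?_))
    (LieSubmodule.lieSpan_le.2 (Set.singleton_subset_iff.2 ?_))
  · exact (LieSubmodule.lieSpan ℂ (𝔤 n) {f}).smul_mem c (LieSubmodule.subset_lieSpan rfl)
  · have := (LieSubmodule.lieSpan ℂ (𝔤 n) {c • f}).smul_mem c⁻¹
      (LieSubmodule.subset_lieSpan (Set.mem_singleton (c • f)))
    rwa [inv_smul_smul₀ hc] at this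

theorem H₁_eq (n : ℕ) : H₁ n = closedSpan (realize (vPoly n)) := by rw [H₁, φ₁_eq]

theorem H₂_eq (n : ℕ) : H₂ n = closedSpan (realize (onePoly n)) := by rw [H₂, φ₂_eq]

theorem H₃_eq (n : ℕ) : H₃ n = closedSpan (realize (tPoly n)) := by
  rw [H₃, φ₃_eq, closedSpan, closedSpan, lieSpan_smul (by norm_num)]

theorem onePoly_mem_level (n : ℕ) : onePoly n ∈ level n 0 := by
  rw [onePoly]
  exact single_mem_level (r := 0) (by norm_num) (isHomogeneous_one _ _)

theorem tPoly_mem_level (n : ℕ) : tPoly n ∈ level n 2 := by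
  rw [tPoly]
  exact single_mem_level (r := 0) (by norm_num) (isHomogeneous_one _ _)

theorem vPoly_mem_level (n : ℕ) : vPoly n ∈ level n 2 := by
  rw [vPoly]
  exact Submodule.add_mem _ (tPoly_mem_level n)
    (single_mem_level (r := 2) (by norm_num) usq_isHomogeneous)

theorem raise_onePoly {n : ℕ} (k : Fin n) : raise k (onePoly n) = 0 := by
  simp [onePoly, raise_single]

theorem raise_tPoly {n : ℕ} (k : Fin n) : raise k (tPoly n) = 0 := by
  simp [tPoly, raise_single]

theorem raise_vPoly {n : ℕ} (k : Fin n) : raise k (vPoly n) = Finsupp.single 0 (2 * X k) := by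
  simp [vPoly, raise_single, pderiv_usq]

theorem angular_onePoly {n : ℕ} (j k : Fin n) : angular j k (onePoly n) = 0 := by
  simp [onePoly, angular_single]

theorem angular_tPoly {n : ℕ} (j k : Fin n) : angular j k (tPoly n) = 0 := by
  simp [tPoly, angular_single]

theorem angular_vPoly {n : ℕ} (j k : Fin n) : angular j k (vPoly n) = 0 := by
  rw [vPoly, map_add, angular_single, angular_single, pderiv_usq, pderiv_usq,
    show (X j * (2 * X k) - X k * (2 * X j) : UPoly n) = 0 by ring]
  simp

/-- Raising gives 2u_k and lowering again 2t + 2u² + 4(wt - 1)u_k². The u² terms cancel in the sum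
since 4(wt - 1) = -2n. The surviving multiple of t is the nilpotent part of the Casimir operator on
φ₁. -/
theorem sum_lower_raise_vPoly {n : ℕ} :
    ∑ k, lower k (raise k (vPoly n)) = (2 * n : ℂ) • tPoly n := by
  have h : ∀ k : Fin n, lower k (raise k (vPoly n)) =
      Finsupp.single 1 2 + Finsupp.single 0 (2 * usq + C (4 * (wt n - 1)) * X k ^ 2) := by
    intro k
    rw [raise_vPoly, lower_single, conf_apply, Nat.cast_zero, mul_zero, sub_zero]
    have h1 : pderiv k (2 * X k : UPoly n) = 2 := by rw [two_mul, map_add, pderiv_X_self]; ring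
    have h2 : euler (2 * X k : UPoly n) = 2 * X k := by rw [two_mul, map_add, euler_X]
    rw [h1, h2]
    congr 2
    simp only [smul_eq_C_mul, map_mul, map_sub, map_one, map_ofNat]
    ring
  simp only [h, Finset.sum_add_distrib, ← Finsupp.single_finsetSum, ← Finset.mul_sum]
  have h3 : (2 * ∑ _k : Fin n, usq + C (4 * (wt n - 1)) * ∑ k : Fin n, X k ^ 2 : UPoly n) = 0 := by
    change 2 * ∑ _k : Fin n, usq + C (4 * (wt n - 1)) * usq = 0
    rw [Finset.sum_const, Finset.card_univ, Fintype.card_fin, nsmul_eq_mul,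
      show (4 * (wt n - 1)) = -(2 * n : ℂ) by rw [wt]; ring]
    simp only [map_neg, map_mul, map_natCast, map_ofNat]
    ring
  rw [h3, Finsupp.single_zero, add_zero, tPoly, Finsupp.smul_single, Finset.sum_const,
    Finset.card_univ, Fintype.card_fin]
  congr 1
  simp only [smul_eq_C_mul, nsmul_eq_mul, map_mul, map_natCast, map_ofNat]
  ring

/-- The Casimir operator in terms of polynomials. -/
theorem casimir_realize {n : ℕ} (F : UTPoly n) : casimir n (realize F) =
    realize (energy (energy F) + (n : ℂ) • energy F + ∑ k, lower k (raise k F) -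
      (1 / 2 : ℂ) • ∑ j, ∑ k, angular j k (angular j k F)) := by
  have hI : ∀ v : Smooth n, Complex.I • Complex.I • v = -v := fun v => by
    rw [smul_smul, Complex.I_mul_I, neg_one_smul]
  have hswap : ∀ (a b : Idx n) (v : Smooth n), ⁅(M b a : 𝔤 n), ⁅(M b a : 𝔤 n), v⁆⁆ =
      ⁅(M a b : 𝔤 n), ⁅(M a b : 𝔤 n), v⁆⁆ := fun a b v => by
    rw [M_swap a b, neg_lie, neg_lie, lie_neg, neg_neg]
  have he : ⁅(M (Sum.inl 0) (Sum.inl 1) : 𝔤 n), ⁅(M (Sum.inl 0) (Sum.inl 1) : 𝔤 n), realize F⁆⁆ =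
      -realize (energy (energy F)) := by
    rw [lie_energy, lie_smul, lie_energy, hI]
  have ha : ∀ j k, ⁅(M (Sum.inr j) (Sum.inr k) : 𝔤 n), ⁅(M (Sum.inr j) (Sum.inr k) : 𝔤 n), realize F⁆⁆ =
      realize (angular j k (angular j k F)) := fun j k => by
    rw [lie_angular, lie_neg, lie_angular, neg_neg]
  -- The squares of the two boosts add up to half the anticommutator of `raise k` and `lower k`;
  -- normal ordering leaves one energy term per k, which explains the summand n times the energy.
  have hb : ∀ k, ⁅(M (Sum.inl 0) (Sum.inr k) : 𝔤 n), ⁅(M (Sum.inl 0) (Sum.inr k) : 𝔤 n), realize F⁆⁆ +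
      ⁅(M (Sum.inl 1) (Sum.inr k) : 𝔤 n), ⁅(M (Sum.inl 1) (Sum.inr k) : 𝔤 n), realize F⁆⁆ =
      realize (energy F + lower k (raise k F)) := fun k => by
    rw [lie_boost_zero_realize, lie_boost_zero_realize, lie_boost_one_realize,
      lie_boost_one_realize, ← map_add]
    congr 1
    have h := two_smul_energy k F
    have h2 : energy F = (1 / 2 : ℂ) • (raise k (lower k F) - lower k (raise k F)) := by
      rw [← h, smul_smul]; norm_num
    rw [h2]
    simp only [map_smul, map_add, map_sub]
    match_scalars <;> ring_nf <;> norm_num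
  have hb0 : ∑ k, ⁅(M (Sum.inl 0) (Sum.inr k) : 𝔤 n), ⁅(M (Sum.inl 0) (Sum.inr k) : 𝔤 n), realize F⁆⁆ =
      realize ((n : ℂ) • energy F + ∑ k, lower k (raise k F)) -
      ∑ k, ⁅(M (Sum.inl 1) (Sum.inr k) : 𝔤 n), ⁅(M (Sum.inl 1) (Sum.inr k) : 𝔤 n), realize F⁆⁆ := by
    rw [eq_sub_iff_add_eq, ← Finset.sum_add_distrib]
    simp only [hb, ← map_sum, Finset.sum_add_distrib]
    simp [Nat.cast_smul_eq_nsmul]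
  rw [casimir]
  simp only [Fintype.sum_sum_type, Fin.sum_univ_two, M_self, zero_lie, eta, Sum.elim_inl,
    Sum.elim_inr, hswap (Sum.inl 0) (Sum.inl 1), hswap (Sum.inl _) (Sum.inr _), he, ha,
    mul_one, mul_neg, Complex.ofReal_one, Complex.ofReal_neg, one_smul, neg_smul,
    Finset.sum_neg_distrib, Finset.sum_add_distrib, hb0]
  simp only [map_add, map_sub, map_smul, map_sum]
  module

/-- For both m = 0 and m = 2 the scalar (wt - m)(wt - m + n) equals -(n-2)(n+2)/4, so the three
generators share one generalized eigenvalue. -/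
theorem casimir_realize_of_mem_level {n m : ℕ} {F : UTPoly n} (hF : F ∈ level n m)
    (ha : ∀ j k, angular j k F = 0) : casimir n (realize F) =
      ((wt n - m) * (wt n - m + n)) • realize F + realize (∑ k, lower k (raise k F)) := by
  rw [casimir_realize, energy_of_mem_level hF, map_smul, energy_of_mem_level hF]
  simp only [ha, map_zero, Finset.sum_const_zero, smul_zero, sub_zero, map_add, map_smul]
  module

theorem shiftedCasimir_smul {n : ℕ} (c : ℂ) (f : Smooth n) :
    shiftedCasimir n (c • f) = c • shiftedCasimir n f := by
  simp only [shiftedCasimir, casimir, lie_smul, smul_comm _ c, ← Finset.smul_sum, smul_add]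

theorem shiftedCasimir_φ₂ (n : ℕ) : shiftedCasimir n (φ₂ n) = 0 := by
  rw [φ₂_eq, shiftedCasimir, casimir_realize_of_mem_level (onePoly_mem_level n) angular_onePoly]
  simp only [raise_onePoly, map_zero, Finset.sum_const_zero, add_zero, ← add_smul]
  rw [show (wt n - (0 : ℕ)) * (wt n - (0 : ℕ) + n) + (((n - 2) * (n + 2) / 4 : ℝ) : ℂ) = 0 by
    rw [wt]; push_cast; ring, zero_smul]

theorem shiftedCasimir_φ₃ (n : ℕ) : shiftedCasimir n (φ₃ n) = 0 := by
  rw [φ₃_eq, shiftedCasimir_smul, shiftedCasimir,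
    casimir_realize_of_mem_level (tPoly_mem_level n) angular_tPoly]
  simp only [raise_tPoly, map_zero, Finset.sum_const_zero, add_zero, ← add_smul]
  rw [show (wt n - (2 : ℕ)) * (wt n - (2 : ℕ) + n) + (((n - 2) * (n + 2) / 4 : ℝ) : ℂ) = 0 by
    rw [wt]; push_cast; ring, zero_smul, smul_zero]

theorem shiftedCasimir_φ₁ (n : ℕ) : shiftedCasimir n (φ₁ n) = -(n : ℂ) • φ₃ n := by
  rw [φ₁_eq, shiftedCasimir, casimir_realize_of_mem_level (vPoly_mem_level n) angular_vPoly,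
    sum_lower_raise_vPoly, add_right_comm, ← add_smul,
    show (wt n - (2 : ℕ)) * (wt n - (2 : ℕ) + n) + (((n - 2) * (n + 2) / 4 : ℝ) : ℂ) = 0 by
    rw [wt]; push_cast; ring, zero_smul, zero_add, φ₃_eq, map_smul, smul_smul]
  congr 1
  ring

theorem φ₃_ne_zero (n : ℕ) : φ₃ n ≠ 0 := by
  rw [φ₃_eq]
  refine smul_ne_zero (by norm_num) fun h => ?_
  have : tPoly n = 0 := realize_injective (h.trans (map_zero realize).symm)
  simp [tPoly] at this

/-! ### Vectors that are finite under the compact subalgebra -/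

theorem isKFinite_realize {n : ℕ} (F : UTPoly n) : IsKFinite n (realize F) := by
  obtain ⟨N, hN⟩ := exists_sum_levelProj_eq F
  let W : ℕ → Submodule ℂ (Smooth n) := fun k => (level n k).map realize
  have hW : ∀ (k : ℕ) (A : 𝔤 n), IsCompactElt A → ∀ w ∈ W k, ⁅A, w⁆ ∈ W k := by
    intro k A hA w hw
    refine compact_lie_mem (N := W k) ?_ ?_ hA hw
    · rintro _ ⟨G, hG, rfl⟩
      rw [lie_energy, energy_of_mem_level hG, ← map_smul]
      exact ⟨_, Submodule.smul_mem _ _ (Submodule.smul_mem _ _ hG), rfl⟩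
    · rintro i j _ ⟨G, hG, rfl⟩
      rw [lie_angular, ← map_neg]
      exact ⟨_, Submodule.neg_mem _ (angular_mem_level i j hG), rfl⟩
  refine ⟨⨆ k : Fin N, W k, inferInstance, ?_, fun A hA w hw => ?_⟩
  · rw [← hN, Finset.sum_range]
    exact Submodule.sum_mem _ fun k _ => Submodule.mem_iSup_of_mem k (levelProj_mem k.1 _)
  · have : (⨆ k : Fin N, W k) ≤
        (⨆ k : Fin N, W k).comap (LieModule.toEnd ℂ (𝔤 n) (Smooth n) A) :=
      iSup_le fun k w hw => Submodule.mem_iSup_of_mem k (hW k A hA w hw)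
    exact this hw

section

variable {n : ℕ} {V V' : Type*} [AddCommGroup V] [Module ℂ V] [LieRingModule (𝔤 n) V]
  [AddCommGroup V'] [Module ℂ V'] [LieRingModule (𝔤 n) V']

theorem IsKFinite.map {v : V} (h : IsKFinite n v) (π : V →ₗ⁅ℂ, 𝔤 n⁆ V') : IsKFinite n (π v) := by
  obtain ⟨W, hW, hv, hst⟩ := h
  refine ⟨W.map (π : V →ₗ[ℂ] V'), inferInstance, ⟨v, hv, rfl⟩, ?_⟩
  rintro A hA _ ⟨w, hw, rfl⟩
  exact ⟨_, hst A hA w hw, LieModuleHom.map_lie π A w⟩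

theorem IsKFinite.restrict {H : LieSubmodule ℂ (𝔤 n) V} {v : H} (h : IsKFinite n (v : V)) :
    IsKFinite n v := by
  obtain ⟨W, hW, hv, hst⟩ := h
  refine ⟨W.comap H.toSubmodule.subtype, ?_, hv, fun A hA w hw => hst A hA _ hw⟩
  let g : W.comap H.toSubmodule.subtype →ₗ[ℂ] W :=
    (H.toSubmodule.subtype ∘ₗ Submodule.subtype _).codRestrict W fun x => x.2
  refine FiniteDimensional.of_injective g fun x y hxy => ?_
  have : (g x : V) = g y := congrArg Subtype.val hxy
  exact Subtype.ext (Subtype.ext this)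

theorem aeval_intertwine {U U' : Type*} [AddCommGroup U] [Module ℂ U] [AddCommGroup U'] [Module ℂ U']
    {S : Module.End ℂ U} {T : Module.End ℂ U'} (g : U →ₗ[ℂ] U') (h : ∀ x, g (S x) = T (g x))
    (q : Polynomial ℂ) (x : U) : g (Polynomial.aeval S q x) = Polynomial.aeval T q (g x) := by
  have hp : ∀ i : ℕ, g ((S ^ i) x) = (T ^ i) (g x) := fun i => by
    rw [Module.End.pow_apply, Module.End.pow_apply]
    exact (Function.Semiconj.iterate_right h i) x
  simp only [Polynomial.aeval_eq_sum_range, LinearMap.sum_apply, LinearMap.smul_apply, map_sum,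
    map_smul, hp]

theorem IsKFinite.exists_aeval_eq_zero [LieModule ℂ (𝔤 n) V] {v : V} (h : IsKFinite n v) :
    ∃ q : Polynomial ℂ, q ≠ 0 ∧ Polynomial.aeval ((-Complex.I) •
      LieModule.toEnd ℂ (𝔤 n) V (M (Sum.inl 0) (Sum.inl 1))) q v = 0 := by
  obtain ⟨W, hW, hv, hst⟩ := h
  have hc : IsCompactElt (M (Sum.inl 0) (Sum.inl 1) : 𝔤 n) := fun i j => by
    constructor <;> simp [M]
  let T : Module.End ℂ V := (-Complex.I) • LieModule.toEnd ℂ (𝔤 n) V (M (Sum.inl 0) (Sum.inl 1))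
  have hT : ∀ w ∈ W, T w ∈ W := fun w hw => W.smul_mem _ (hst _ hc w hw)
  let S : Module.End ℂ W := T.restrict hT
  refine ⟨S.charpoly, S.charpoly_monic.ne_zero, ?_⟩
  have := aeval_intertwine (S := S) (T := T) W.subtype (fun _ => rfl) S.charpoly ⟨v, hv⟩
  rw [LinearMap.aeval_self_charpoly] at this
  exact this.symm

end

theorem mem_lieSpan_realize_iff {n : ℕ} (hn : 3 ≤ n) {F G : UTPoly n} :
    realize G ∈ LieSubmodule.lieSpan ℂ (𝔤 n) {realize F} ↔ G ∈ gen F := by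
  rw [lieSpan_realize hn, mem_realizeSub]
  exact ⟨fun ⟨G', hG', h⟩ => realize_injective h ▸ hG', fun h => ⟨G, h, rfl⟩⟩

/-- Closure adds no polynomial functions: the components of `realize G` lie in the algebraic module,
and `realize G` is a finite sum of them. -/
theorem mem_closedSpan_realize_iff {n : ℕ} (hn : 3 ≤ n) {F G : UTPoly n} :
    realize G ∈ closedSpan (realize F) ↔ G ∈ gen F := by
  refine ⟨fun h => (mem_lieSpan_realize_iff hn).1 ?_, fun h =>
    lieSpan_le_closedSpan _ ((mem_lieSpan_realize_iff hn).2 h)⟩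
  obtain ⟨N, hN⟩ := exists_sum_levelProj_eq G
  rw [← hN]
  exact Submodule.sum_mem _ fun k _ => levelProj_mem_lieSpan hn F k h

/-- A `so(2)`-finite vector in an equivariant image of `cl(U(𝔤) φ)` is the image of a vector
of `U(𝔤) φ`. -/
theorem IsKFinite.exists_preimage {n : ℕ} (hn : 3 ≤ n) {F₀ : UTPoly n}
    {N : LieSubmodule ℂ (𝔤 n) (Smooth n)} (hN : IsClosed (N : Set (Smooth n)))
    (hproj : ∀ f ∈ closedSpan (realize F₀), f ∈ N → ∀ k, levelProj n k f ∈ N)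
    {V : Type*} [AddCommGroup V] [Module ℂ V] [LieRingModule (𝔤 n) V] [LieModule ℂ (𝔤 n) V]
    (π : closedSpan (realize F₀) →ₗ⁅ℂ, 𝔤 n⁆ V) (hs : Function.Surjective π)
    (hk : ∀ f, π f = 0 ↔ (f : Smooth n) ∈ N) {v : V} (hv : IsKFinite n v) :
    ∃ f : closedSpan (realize F₀),
      (f : Smooth n) ∈ LieSubmodule.lieSpan ℂ (𝔤 n) {realize F₀} ∧ π f = v := by
  obtain ⟨q, hq, hqv⟩ := hv.exists_aeval_eq_zero
  obtain ⟨f, rfl⟩ := hs v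
  let H := closedSpan (realize F₀)
  let T : Module.End ℂ H := (-Complex.I) • LieModule.toEnd ℂ (𝔤 n) H (M (Sum.inl 0) (Sum.inl 1))
  have hhull : ∀ f : H, (f : Smooth n) ∈ hull n := fun f => closedSpan_le_hull hn F₀ f.2
  have h1 : π (Polynomial.aeval T q f) = 0 := by
    rw [← hqv]
    exact aeval_intertwine (S := T) (π : H →ₗ[ℂ] V) (fun x => by simp [T]) q f
  -- Let q be a nonzero polynomial in the energy operator killing v, and f any lift of v. Then q
  -- applied to f lies in N; on the k-th component the energy is the number wt - k, so q becomes a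
  -- scalar.
  have h2 : ∀ k : ℕ, q.eval (wt n - k) • levelProj n k f ∈ N := by
    intro k
    have := hproj _ (Polynomial.aeval T q f).2 ((hk _).1 h1) k
    have h3 := aeval_intertwine (S := T) (T := algebraMap ℂ (Module.End ℂ (Smooth n)) (wt n - k))
      ((levelProj n k).toLinearMap ∘ₗ H.toSubmodule.subtype)
      (fun x => levelProj_ham k (hhull x)) q f
    rw [Polynomial.aeval_algebraMap_apply_eq_algebraMap_eval] at h3
    have h4 : levelProj n k (Polynomial.aeval T q f : H) = q.eval (wt n - k) • levelProj n k f := h3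
    rwa [h4] at this
  have hfin : {k : ℕ | q.eval (wt n - k) = 0}.Finite := by
    refine Set.Finite.preimage (wt_sub_injective n).injOn (s := {c | q.eval c = 0}) ?_
    exact q.finite_setOfPred_isRoot hq
  have hA : ∀ k, levelProj n k f ∈ LieSubmodule.lieSpan ℂ (𝔤 n) {realize F₀} := fun k =>
    levelProj_mem_lieSpan hn F₀ k f.2
  have hgA : ∑ k ∈ hfin.toFinset, levelProj n k f ∈ LieSubmodule.lieSpan ℂ (𝔤 n) {realize F₀} :=
    Submodule.sum_mem _ fun k _ => hA k
  -- The new lift keeps only the finitely many components whose energy is a root of q. All other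
  -- components of f lie in N, hence so does the difference, by `mem_of_levelProj_mem`.
  refine ⟨⟨_, lieSpan_le_closedSpan _ hgA⟩, hgA, ?_⟩
  rw [eq_comm, ← sub_eq_zero, ← map_sub, hk]
  refine mem_of_levelProj_mem (N := N.toSubmodule) hn (hhull _) hN fun k => ?_
  change levelProj n k ((f : Smooth n) - ∑ k ∈ hfin.toFinset, levelProj n k f) ∈ N
  simp only [map_sub, map_sum, levelProj_levelProj, Finset.sum_ite_eq', Set.Finite.mem_toFinset,
    Set.mem_ofPred_eq]
  split_ifs with h
  · rw [sub_self]; exact N.zero_mem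
  · rw [sub_zero]
    exact (Submodule.smul_mem_iff N.toSubmodule h).1 (h2 k)

/-- The functions in H whose image lies in W form a submodule; if it contains f it contains
everything that f generates. -/
theorem mem_of_forall_lieSpan {n : ℕ} {V : Type*} [AddCommGroup V] [Module ℂ V]
    [LieRingModule (𝔤 n) V] [LieModule ℂ (𝔤 n) V] {H : LieSubmodule ℂ (𝔤 n) (Smooth n)}
    (π : H →ₗ⁅ℂ, 𝔤 n⁆ V) (W : LieSubmodule ℂ (𝔤 n) V) {f g : H} (hf : π f ∈ W)
    (hg : (g : Smooth n) ∈ LieSubmodule.lieSpan ℂ (𝔤 n) {(f : Smooth n)}) : π g ∈ W := by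
  have h : LieSubmodule.lieSpan ℂ (𝔤 n) {(f : Smooth n)} ≤ (W.comap π).map H.incl :=
    LieSubmodule.lieSpan_le.2 (Set.singleton_subset_iff.2 ((LieSubmodule.mem_map _).2 ⟨f, hf, rfl⟩))
  obtain ⟨g', hg', e⟩ := (LieSubmodule.mem_map _).1 (h hg)
  rwa [← Subtype.ext (a1 := g') (a2 := g) e]

/-- A criterion for an equivariant image of `cl(U(𝔤) φ)` to carry an irreducible representation. -/
theorem carries_of_projection {n : ℕ} (hn : 3 ≤ n) {F₀ : UTPoly n} {m : ℕ} (hm : F₀ ∈ level n m)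
    (hang : ∀ j k, angular j k F₀ = 0) {H N : LieSubmodule ℂ (𝔤 n) (Smooth n)}
    (hH : H = closedSpan (realize F₀)) (hN : IsClosed (N : Set (Smooth n)))
    (hproj : ∀ f ∈ H, f ∈ N → ∀ k, levelProj n k f ∈ N) (h0 : realize F₀ ∉ N)
    (hraise : ∀ k, realize (raise k F₀) ∈ N)
    (hirr : ∀ F ∈ gen F₀, realize F ∉ N → ∃ G ∈ gen F, realize (G - F₀) ∈ N)
    {V : Type*} [AddCommGroup V] [Module ℂ V] [TopologicalSpace V] [LieRingModule (𝔤 n) V]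
    [LieModule ℂ (𝔤 n) V] (π : H →ₗ⁅ℂ, 𝔤 n⁆ V) (hc : Continuous π) (hs : Function.Surjective π)
    (hk : ∀ f, π f = 0 ↔ (f : Smooth n) ∈ N) {E : ℝ} (hE : (E : ℂ) = m - wt n) :
    Carries n V E := by
  subst hH
  have hKf : ∀ (F : UTPoly n) (hF : realize F ∈ closedSpan (realize F₀)),
      IsKFinite n (π ⟨realize F, hF⟩) := fun F hF =>
    (IsKFinite.restrict (v := ⟨realize F, hF⟩) (isKFinite_realize F)).map π
  have hself := mem_closedSpan_self (realize F₀)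
  refine ⟨?_, fun W hW => ?_, π ⟨realize F₀, hself⟩, hKf F₀ hself, ?_⟩
  · have hd : Dense {f : closedSpan (realize F₀) |
        (f : Smooth n) ∈ LieSubmodule.lieSpan ℂ (𝔤 n) {realize F₀}} := fun f => by
      rw [closure_subtype]
      have hf : (f : Smooth n) ∈ closure
        (LieSubmodule.lieSpan ℂ (𝔤 n) {realize F₀} : Set (Smooth n)) := f.2
      refine closure_mono (fun g hg => ?_) hf
      exact ⟨⟨g, lieSpan_le_closedSpan _ hg⟩, hg, rfl⟩
    refine (hs.denseRange.dense_image hc hd).mono ?_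
    rintro _ ⟨⟨f, hf'⟩, hf, rfl⟩
    obtain ⟨F, -, rfl⟩ := (lieSpan_realize hn F₀ ▸ hf : f ∈ realizeSub hn (gen F₀) (gen_isStable F₀))
    exact hKf F hf'
  · by_cases hb : W = ⊥
    · exact Or.inl hb
    right
    obtain ⟨w, hw, hw0⟩ := W.toSubmodule.exists_mem_ne_zero_of_ne_bot fun h =>
      hb (LieSubmodule.toSubmodule_eq_bot W |>.1 h)
    -- A nonzero finite vector of W lifts to a polynomial function outside N. By `hirr` the module
    -- it generates meets the coset of the generator modulo N, so W contains the image of the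
    -- generator and with it every finite vector.
    obtain ⟨⟨f, hf'⟩, hf, rfl⟩ := (hW w hw).exists_preimage hn hN hproj π hs hk
    obtain ⟨F, hF, rfl⟩ := (lieSpan_realize hn F₀ ▸ hf : f ∈ realizeSub hn (gen F₀) (gen_isStable F₀))
    obtain ⟨G, hG, hGF⟩ := hirr F hF fun h => hw0 ((hk _).2 h)
    have hGH : realize G ∈ closedSpan (realize F₀) := (mem_closedSpan_realize_iff hn).2
      (gen_le (gen_isStable F₀) hF hG)
    have hGW : π ⟨realize G, hGH⟩ ∈ W :=
      mem_of_forall_lieSpan π W hw ((mem_lieSpan_realize_iff hn).2 hG)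
    have hφ : π ⟨realize F₀, hself⟩ ∈ W := by
      have : π ⟨realize G, hGH⟩ = π ⟨realize F₀, hself⟩ := by
        rw [← sub_eq_zero, ← map_sub, hk]
        rw [map_sub] at hGF
        exact hGF
      rwa [← this]
    intro v hv
    obtain ⟨g, hg, rfl⟩ := hv.exists_preimage hn hN hproj π hs hk
    exact mem_of_forall_lieSpan π W hφ hg
  · refine ⟨fun h => h0 ((hk _).1 h), ?_, fun j k => ?_, fun k => ?_⟩
    · rw [← LieModuleHom.map_lie, ← map_smul, ← map_smul]
      congr 1
      refine Subtype.ext ?_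
      change ham n (realize F₀) = -(E : ℂ) • realize F₀
      rw [ham_realize, energy_of_mem_level hm, map_smul, hE, neg_sub]
    · rw [← LieModuleHom.map_lie, hk]
      change ⁅(M (Sum.inr j) (Sum.inr k) : 𝔤 n), realize F₀⁆ ∈ N
      rw [lie_angular, hang, map_zero, neg_zero]
      exact N.zero_mem
    · rw [← LieModuleHom.map_lie, ← LieModuleHom.map_lie, ← map_smul, ← map_add, hk]
      change ⁅(M (Sum.inl 0) (Sum.inr k) : 𝔤 n), realize F₀⁆ +
        Complex.I • ⁅(M (Sum.inl 1) (Sum.inr k) : 𝔤 n), realize F₀⁆ ∈ N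
      rw [lie_raise]
      exact hraise k

/-! ### Functions vanishing on the cone -/

theorem isClosed_coneIdeal (n : ℕ) : IsClosed (coneIdeal n : Set (Smooth n)) := by
  have : (coneIdeal n : Set (Smooth n)) = ⋂ p : cov n, ⋂ _ : ysq p.1 = 0, {f | f p = 0} := by
    ext f
    simp only [Set.mem_iInter]
    rfl
  rw [this]
  exact isClosed_iInter fun p => isClosed_iInter fun _ =>
    isClosed_eq (continuous_eval p) continuous_const

/-- Rotations of the time plane preserve y², so the Fourier integrand vanishes identically at points
of the cone. -/
theorem levelProj_mem_coneIdeal {n : ℕ} {f : Smooth n} (hf : f ∈ hull n) (hc : f ∈ coneIdeal n)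
    (k : ℕ) : levelProj n k f ∈ coneIdeal n := fun p hp => by
  rw [levelProj_apply k hf, fourierAt_apply]
  have : ∀ θ : ℝ, rot θ f p = 0 := fun θ => by
    rw [rot_apply]
    exact hc _ ((ysq_rotPt θ p.1).trans hp)
  simp [this]

theorem realize_tPoly_mem_coneIdeal (n : ℕ) : realize (tPoly n) ∈ coneIdeal n := fun p hp => by
  rw [tPoly, realize_single, mono_apply, monoFun, tFun, hp]
  simp

theorem H₃_le_coneIdeal (n : ℕ) : H₃ n ≤ coneIdeal n := by
  rw [H₃_eq]
  exact closedSpan_le (isClosed_coneIdeal n) (realize_tPoly_mem_coneIdeal n)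

theorem φ₂_notMem_coneIdeal {n : ℕ} (hn : 3 ≤ n) : φ₂ n ∉ coneIdeal n := fun h => by
  let y : EuclideanSpace ℝ (Fin n) := EuclideanSpace.single ⟨0, by omega⟩ 1
  have hy : ysq ((0, y) : Amb n) = 0 := by simp [ysq_eq, y]
  exact Complex.exp_ne_zero _ (h ⟨(0, y), (mem_cov_iff _).2 hy.ge⟩ hy)

theorem continuous_quotient_mk {n : ℕ} {V : Type*} [AddCommGroup V] [Module ℂ V] [TopologicalSpace V]
    [LieRingModule (𝔤 n) V] [LieModule ℂ (𝔤 n) V] (N : LieSubmodule ℂ (𝔤 n) V) :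
    Continuous (LieSubmodule.Quotient.mk' N) :=
  continuous_quot_mk

/-! ### The three modules -/

theorem isClosed_H₁ (n : ℕ) : IsClosed (H₁ n : Set (Smooth n)) := isClosed_closedSpan _

theorem isClosed_H₂ (n : ℕ) : IsClosed (H₂ n : Set (Smooth n)) := isClosed_closedSpan _

theorem isClosed_H₃ (n : ℕ) : IsClosed (H₃ n : Set (Smooth n)) := isClosed_closedSpan _

theorem H₂_lt_H₁ {n : ℕ} (hn : 3 ≤ n) : H₂ n < H₁ n := by
  refine lt_of_le_not_ge ?_ fun h => ?_
  · rw [H₂_eq]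
    refine closedSpan_le (isClosed_H₁ n) ?_
    rw [H₁_eq, mem_closedSpan_realize_iff hn]
    exact onePoly_mem_gen_vPoly hn
  · have h1 := h (mem_closedSpan_self (φ₁ n))
    -- The inclusion is strict because `wave` sends t + u² to 2n t ≠ 0.
    rw [φ₁_eq, H₂_eq, mem_closedSpan_realize_iff hn, gen_onePoly hn, LinearMap.mem_ker,
      wave_vPoly, smul_eq_zero] at h1
    have hn0 : (n : ℂ) ≠ 0 := by exact_mod_cast (by omega : n ≠ 0)
    simp [hn0, tPoly] at h1

theorem H₃_lt_H₂ {n : ℕ} (hn : 3 ≤ n) : H₃ n < H₂ n := by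
  refine lt_of_le_not_ge ?_ fun h =>
    φ₂_notMem_coneIdeal hn (H₃_le_coneIdeal n (h (mem_closedSpan_self (φ₂ n))))
  rw [H₃_eq]
  refine closedSpan_le (isClosed_H₂ n) ?_
  rw [H₂_eq, mem_closedSpan_realize_iff hn]
  exact tPoly_mem_gen_onePoly hn

theorem realize_mem_H₂_iff {n : ℕ} (hn : 3 ≤ n) {F : UTPoly n} :
    realize F ∈ H₂ n ↔ F ∈ gen (onePoly n) := by rw [H₂_eq, mem_closedSpan_realize_iff hn]

theorem realize_mem_H₃_iff {n : ℕ} (hn : 3 ≤ n) {F : UTPoly n} :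
    realize F ∈ H₃ n ↔ F ∈ gen (tPoly n) := by rw [H₃_eq, mem_closedSpan_realize_iff hn]

theorem levelProj_mem_H₂ {n : ℕ} (hn : 3 ≤ n) {f : Smooth n} (hf : f ∈ H₂ n) (k : ℕ) :
    levelProj n k f ∈ H₂ n := by
  rw [H₂_eq] at hf ⊢
  exact lieSpan_le_closedSpan _ (levelProj_mem_lieSpan hn _ k hf)

theorem levelProj_mem_H₃ {n : ℕ} (hn : 3 ≤ n) {f : Smooth n} (hf : f ∈ H₃ n) (k : ℕ) :
    levelProj n k f ∈ H₃ n := by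
  rw [H₃_eq] at hf ⊢
  exact lieSpan_le_closedSpan _ (levelProj_mem_lieSpan hn _ k hf)

theorem mem_hull_of_mem_H₂ {n : ℕ} (hn : 3 ≤ n) {f : Smooth n} (hf : f ∈ H₂ n) : f ∈ hull n := by
  rw [H₂_eq] at hf
  exact closedSpan_le_hull hn _ hf

theorem carries_subQuot {n : ℕ} (hn : 3 ≤ n) {F₀ : UTPoly n} {m : ℕ} (hm : F₀ ∈ level n m)
    (hang : ∀ j k, angular j k F₀ = 0) {H N : LieSubmodule ℂ (𝔤 n) (Smooth n)}
    (hH : H = closedSpan (realize F₀)) (hN : IsClosed (N : Set (Smooth n)))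
    (hproj : ∀ f ∈ N, ∀ k, levelProj n k f ∈ N) (h0 : realize F₀ ∉ N)
    (hraise : ∀ k, realize (raise k F₀) ∈ N)
    (hirr : ∀ F ∈ gen F₀, realize F ∉ N → ∃ G ∈ gen F, realize (G - F₀) ∈ N)
    {E : ℝ} (hE : (E : ℂ) = m - wt n) : Carries n (SubQuot H N) E :=
  carries_of_projection hn hm hang hH hN (fun f _ => hproj f) h0 hraise hirr
    (LieSubmodule.Quotient.mk' (N.comap H.incl)) (continuous_quotient_mk _)
    (LieSubmodule.Quotient.surjective_mk' _)
    (fun _ => LieSubmodule.Quotient.mk_eq_zero _) hE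

/-- The generator t + u² has level 2, so E = 2 - wt = (n+2)/2. It is a highest weight vector only
modulo H₂: raising it gives 2u_k, which is nonzero but solves the wave equation. -/
theorem carries_H₁_quotient {n : ℕ} (hn : 3 ≤ n) : Carries n (SubQuot (H₁ n) (H₂ n)) ((n + 2) / 2) := by
  refine carries_subQuot hn (vPoly_mem_level n) angular_vPoly (H₁_eq n) (isClosed_H₂ n)
    (fun f hf => levelProj_mem_H₂ hn hf) (fun h => (H₂_lt_H₁ hn).not_ge ?_) (fun k => ?_)
    (fun F hF h => ?_) ?_
  · rw [H₁_eq]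
    exact closedSpan_le (isClosed_H₂ n) h
  · rw [realize_mem_H₂_iff hn, raise_vPoly, gen_onePoly hn, LinearMap.mem_ker, wave_single,
      two_mul (X k), map_add, lap_eq_zero_of_isHomogeneous (isHomogeneous_X ℂ k) one_lt_two]
    simp
  · rw [realize_mem_H₂_iff hn] at h
    obtain ⟨G, hG, h'⟩ := exists_mem_gen_sub_vPoly hn hF h
    exact ⟨G, hG, (realize_mem_H₂_iff hn).2 h'⟩
  · rw [wt]; push_cast; ring

theorem carries_H₂_quotient {n : ℕ} (hn : 3 ≤ n) : Carries n (SubQuot (H₂ n) (H₃ n)) ((n - 2) / 2) := by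
  refine carries_subQuot hn (onePoly_mem_level n) angular_onePoly (H₂_eq n) (isClosed_H₃ n)
    (fun f hf => levelProj_mem_H₃ hn hf) (fun h => (H₃_lt_H₂ hn).not_ge ?_) (fun k => ?_)
    (fun F hF h => ?_) ?_
  · rw [H₂_eq]
    exact closedSpan_le (isClosed_H₃ n) h
  · rw [raise_onePoly, map_zero]
    exact (H₃ n).zero_mem
  · rw [realize_mem_H₃_iff hn] at h
    obtain ⟨G, hG, h'⟩ := exists_mem_gen_sub_onePoly hn hF h
    exact ⟨G, hG, (realize_mem_H₃_iff hn).2 h'⟩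
  · rw [wt]; push_cast; ring

theorem carries_H₃ {n : ℕ} (hn : 3 ≤ n) : Carries n (H₃ n) ((n + 2) / 2) := by
  refine carries_of_projection hn (N := ⊥) (tPoly_mem_level n) angular_tPoly (H₃_eq n)
    ?_ (fun f _ hf k => ?_) (fun h => ?_) (fun k => ?_)
    (fun F hF h => ?_) (LieModuleHom.id (R := ℂ) (L := 𝔤 n) (M := H₃ n)) continuous_id
    Function.surjective_id (fun f => ?_) ?_
  · rw [LieSubmodule.bot_coe]
    exact isClosed_singleton
  · rw [(LieSubmodule.mem_bot _).1 hf, map_zero]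
    exact LieSubmodule.zero_mem _
  · refine φ₃_ne_zero n ?_
    rw [φ₃_eq, (LieSubmodule.mem_bot _).1 h, smul_zero]
  · rw [raise_tPoly, map_zero]
    exact LieSubmodule.zero_mem _
  · refine ⟨tPoly n, tPoly_mem_gen hF ?_, ?_⟩
    · rintro rfl
      exact h (by rw [map_zero]; exact LieSubmodule.zero_mem _)
    · rw [sub_self, map_zero]
      exact LieSubmodule.zero_mem _
  · rw [LieSubmodule.mem_bot]
    exact Subtype.ext_iff
  · rw [wt]; push_cast; ring

/-- It suffices to treat components, which are polynomial functions of H₂ vanishing on the cone. If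
one were outside H₃, the irreducibility of the middle layer would produce 1 modulo `gen (tPoly n)`
inside the invariant space `coneIdeal n`, and φ₂, which has no zeros, would vanish on the cone. -/
theorem mem_H₃_iff_vanishes {n : ℕ} (hn : 3 ≤ n) {f : Smooth n} (hf : f ∈ H₂ n) :
    f ∈ coneIdeal n ↔ f ∈ H₃ n := by
  refine ⟨fun hc => ?_, fun h => H₃_le_coneIdeal n h⟩
  have hh := mem_hull_of_mem_H₂ hn hf
  refine mem_of_levelProj_mem (N := (H₃ n).toSubmodule) hn hh (isClosed_H₃ n) fun k => ?_
  have h1 := levelProj_mem_H₂ hn hf k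
  have h2 := levelProj_mem_coneIdeal hh hc k
  obtain ⟨F, -, e⟩ := levelProj_mem k f
  rw [← e] at h1 h2 ⊢
  change realize F ∈ H₃ n
  rw [realize_mem_H₂_iff hn] at h1
  rw [realize_mem_H₃_iff hn]
  by_contra h3
  obtain ⟨G, hG, hG1⟩ := exists_mem_gen_sub_onePoly hn h1 h3
  have hGc : realize G ∈ coneIdeal n := gen_le (isStable_comap_realize (coneIdeal n)) h2 hG
  have hGt := H₃_le_coneIdeal n ((realize_mem_H₃_iff hn).2 hG1)
  refine φ₂_notMem_coneIdeal hn ?_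
  rw [map_sub] at hGt
  have := (coneIdeal n).sub_mem hGc hGt
  rwa [sub_sub_cancel, ← φ₂_eq] at this

/-- The restriction to the cone of the functions in `H`. -/
def toCone {n : ℕ} (H : LieSubmodule ℂ (𝔤 n) (Smooth n)) : H →ₗ⁅ℂ, 𝔤 n⁆ onCone H where
  toFun f := ⟨LieSubmodule.Quotient.mk' (coneIdeal n) f, LieSubmodule.mem_map_of_mem f.2⟩
  map_add' _ _ := rfl
  map_smul' _ _ := rfl
  map_lie' := rfl

/-- The criterion is applied to restriction itself, with `coneIdeal n` as the kernel. The topology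
on restrictions is induced from the quotient of all smooth functions, so this case is treated
separately from `carries_H₂_quotient`. -/
theorem carries_onCone {n : ℕ} (hn : 3 ≤ n) : Carries n (onCone (H₂ n)) ((n - 2) / 2) := by
  refine carries_of_projection hn (onePoly_mem_level n) angular_onePoly (H₂_eq n)
    (isClosed_coneIdeal n) (fun f hf hc k => levelProj_mem_coneIdeal (mem_hull_of_mem_H₂ hn hf) hc k)
    (φ₂_eq n ▸ φ₂_notMem_coneIdeal hn) (fun k => ?_) (fun F hF h => ?_) (toCone (H₂ n))
    ?_ ?_ (fun f => ?_) ?_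
  · rw [raise_onePoly, map_zero]
    exact (coneIdeal n).zero_mem
  · obtain ⟨G, hG, h'⟩ := exists_mem_gen_sub_onePoly hn hF fun h' =>
      h (H₃_le_coneIdeal n ((realize_mem_H₃_iff hn).2 h'))
    exact ⟨G, hG, H₃_le_coneIdeal n ((realize_mem_H₃_iff hn).2 h')⟩
  · exact ((continuous_quotient_mk (coneIdeal n)).comp continuous_subtype_val).subtype_mk _
  · rintro ⟨v, hv⟩
    obtain ⟨f, hf, rfl⟩ := (LieSubmodule.mem_map _).1 hv
    exact ⟨⟨f, hf⟩, rfl⟩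
  · rw [Subtype.ext_iff]
    exact LieSubmodule.Quotient.mk_eq_zero _
  · rw [wt]; push_cast; ring

theorem tendsto_zero_of_mem_coneIdeal {n : ℕ} {f : Smooth n} (hf : f ∈ coneIdeal n) {p : cov n}
    (hp : ysq p.1 = 0) (s : Set (cov n)) : Filter.Tendsto f (nhdsWithin p s) (nhds 0) := by
  rw [← hf p hp]
  exact (f.continuous_coe.tendsto p).mono_left nhdsWithin_le_nhds

end GuptaBleuler

end

/-! ### Assembly of the four statements. -/

open GuptaBleuler in
theorem mainTheorem9 (n : ℕ) (hn : 3 ≤ n) :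
    -- a chain of closed invariant subspaces
    (IsClosed (H₁ n : Set (Smooth n)) ∧ IsClosed (H₂ n : Set (Smooth n)) ∧
      IsClosed (H₃ n : Set (Smooth n)) ∧ H₂ n < H₁ n ∧ H₃ n < H₂ n) ∧
    -- the representations carried by the quotients
    (Carries n (SubQuot (H₁ n) (H₂ n)) ((n + 2) / 2) ∧
      Carries n (SubQuot (H₂ n) (H₃ n)) ((n - 2) / 2) ∧
      Carries n (H₃ n) ((n + 2) / 2)) ∧
    -- the shifted Casimir operator
    (shiftedCasimir n (φ₂ n) = 0 ∧ shiftedCasimir n (φ₃ n) = 0 ∧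
      shiftedCasimir n (φ₁ n) = -(n : ℂ) • φ₃ n ∧ φ₃ n ≠ 0 ∧
      shiftedCasimir n (shiftedCasimir n (φ₁ n)) = 0) ∧
    -- gauge states vanish on the cone
    (∀ φ ∈ H₃ n, ∀ p : cov n, ysq p.1 = 0 →
      Filter.Tendsto φ (nhdsWithin p {q : cov n | 0 < ysq q.1}) (nhds 0)) ∧
    -- the massless representation is realized on the cone
    ((∀ φ ∈ H₂ n, (∀ p : cov n, ysq p.1 = 0 → φ p = 0) ↔ φ ∈ H₃ n) ∧
      Carries n (onCone (H₂ n)) ((n - 2) / 2)) := by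
  refine ⟨⟨isClosed_H₁ n, isClosed_H₂ n, isClosed_H₃ n, H₂_lt_H₁ hn, H₃_lt_H₂ hn⟩,
    ⟨carries_H₁_quotient hn, carries_H₂_quotient hn, carries_H₃ hn⟩,
    ⟨shiftedCasimir_φ₂ n, shiftedCasimir_φ₃ n, shiftedCasimir_φ₁ n, φ₃_ne_zero n, ?_⟩,
    fun φ hφ p hp => tendsto_zero_of_mem_coneIdeal (H₃_le_coneIdeal n hφ) hp _,
    fun φ hφ => mem_H₃_iff_vanishes hn hφ, carries_onCone hn⟩
  rw [shiftedCasimir_φ₁, shiftedCasimir_smul, shiftedCasimir_φ₃, smul_zero]
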